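/- Let $\mathbb H=\mathbb R^3$ be the Heisenberg group with vector fields $X=\partial_{x_1}+2x_2\partial_{x_3}$, $Y=\partial_{x_2}-2x_1\partial_{x_3}$, $T=[X,Y]=-4\partial_{x_3}$; let $\hat{\mathbb H}=\mathbb H\times(0,\infty)$ with points $(x,y)$, and write $\nabla_{\mathbb H}u=(Xu,Yu)$, $\nabla_{\hat{\mathbb H}}u=(Xu,Yu,u_y)$ and $B_R^+=\{(x,y)\in\hat{\mathbb H}:|(x,y)|<R\}$ (Euclidean norm). Let $a\in(-1,1)$ and $f\in C^{1,\gamma}(\mathbb R)$ with $\gamma>\max\{0,a\}$ ($f'$ being Hölder continuous on bounded sets). Call $\xi:\hat{\mathbb H}\to\mathbb R$ a test function if it is bounded and locally Lipschitz on $\hat{\mathbb H}$, vanishes on $\hat{\mathbb H}\setminus B_R^+$ for some $R>0$, and $y^a|\nabla_{\hat{\mathbb H}}\xi|^2\in L^1(B_R^+)$. Values on $\mathbb H\times\{0\}$ are understood as the limits for $y\to0^+$, which exist for almost every $x$. A function $u\in C^2(\hat{\mathbb H})$ is a weak solution of $$\operatorname{div}_{\hat{\mathbb H}}(y^a\nabla_{\hat{\mathbb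 H}}u)=0\ \text{ in }\mathbb H\times(0,\infty),\qquad -y^au_y=f(u)\ \text{ on }\mathbb H\times\{0\},$$ if $u\in L^\infty(B_R^+)$ and $y^a|\nabla_{\hat{\mathbb H}}u|^2\in L^1(B_R^+)$ for all $R>0$, and $\int_{\hat{\mathbb H}}y^a\langle\nabla_{\hat{\mathbb H}}u,\nabla_{\hat{\mathbb H}}\xi\rangle=\int_{\mathbb H}f(u)\,\xi$ for every test function $\xi$; it is stable if $\int_{\hat{\mathbb H}}y^a|\nabla_{\hat{\mathbb H}}\xi|^2-\int_{\mathbb H}f'(u)\,\xi^2\ge0$ for every test function $\xi$. On $\mathcal R_u=\{(x,y)\in\hat{\mathbb H}:\nabla_{\mathbb H}u(x,y)\ne0\}$ define, for the level sets of $u(\cdot,y)$, the intrinsic normal $\nu=\nabla_{\mathbb H}u/|\nabla_{\mathbb H}u|$, the intrinsic unit tangent $v=(Yu,-Xu)/|\nabla_{\mathbb H}u|$, the intrinsic mean curvature $h=X\nu_1+Y\nu_2$, the imaginary curvature $p=-Tu/|\nabla_{\mathbb H}u|$, and $T\nu=(T\nu_1,T\nu_2)$. Let $$Hu=\begin{pmatrix}XXu&YXu\\XYu&YYu\end{pmatrix},\qquad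 (Hu)^2:=(Hu)(Hu)^{T},$$ and let $|Hu|$ be the Euclidean norm of the entries of $Hu$. Theorem. Let $u\in C^2(\hat{\mathbb H})$ be a bounded, stable weak solution such that $|\nabla_{\mathbb H}u|$ is bounded on $B_R^+$ for every $R>0$. Then for every $\phi\in C_0^\infty(\mathbb R^4)$ the integrals below converge absolutely and $$\int_{\hat{\mathbb H}}y^a|\nabla_{\mathbb H}u|^2|\nabla_{\hat{\mathbb H}}\phi|^2\ \ge\ \int_{\mathcal R_u}y^a\Big(|Hu|^2-\langle(Hu)^2\nu,\nu\rangle-2(TYu\,Xu-TXu\,Yu)\Big)\phi^2$$ $$=\int_{\mathcal R_u}y^a|\nabla_{\mathbb H}u|^2\Big[h^2+\Big(p+\frac{\langle Hu\,v,\nu\rangle}{|\nabla_{\mathbb H}u|}\Big)^2+2\langle T\nu,v\rangle\Big]\phi^2 ,$$ and the last two integrands are equal at every point of $\mathcal R_u$. -/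

import Mathlib

open MeasureTheory Filter Topology Set
open scoped ContDiff Matrix

noncomputable section

namespace HeisenbergExtension

/-- The underlying manifold `ℝ³` of the Heisenberg group, with coordinates
`x = (x₁, x₂, x₃)` and Haar measure the Lebesgue measure. -/
abbrev Heis : Type := ℝ × ℝ × ℝ

/-- `ℝ⁴ = ℍ × ℝ`, with points `(x, y)`. -/
abbrev ExtHeis : Type := Heis × ℝ

/-- The open half-space `ℍ × (0, ∞)`. -/
def halfSpace : Set ExtHeis := {p | 0 < p.2}

/-- The Euclidean half-ball: the points of the open half-space whose Euclidean distance to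
the origin is less than `R`. -/
def halfBall (R : ℝ) : Set ExtHeis :=
  {p | 0 < p.2 ∧ √(p.1.1 ^ 2 + p.1.2.1 ^ 2 + p.1.2.2 ^ 2 + p.2 ^ 2) < R}

/-! ### The vector fields, acting on functions of `(x, y)` -/

/-- `X = ∂₁ + 2 x₂ ∂₃`. -/
def X (g : ExtHeis → ℝ) (p : ExtHeis) : ℝ := fderiv ℝ g p ((1, 0, 2 * p.1.2.1), 0)

/-- `Y = ∂₂ - 2 x₁ ∂₃`. -/
def Y (g : ExtHeis → ℝ) (p : ExtHeis) : ℝ := fderiv ℝ g p ((0, 1, -2 * p.1.1), 0)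

/-- `T = [X, Y] = -4 ∂₃`. -/
def T (g : ExtHeis → ℝ) (p : ExtHeis) : ℝ := fderiv ℝ g p ((0, 0, -4), 0)

/-- The derivative in the extension variable `y`. -/
def Dy (g : ExtHeis → ℝ) (p : ExtHeis) : ℝ := fderiv ℝ g p ((0, 0, 0), 1)

/-- The pointwise product of the full gradients `(X g, Y g, ∂_y g)` and `(X k, Y k, ∂_y k)`.
Locally Lipschitz functions are differentiable almost everywhere, so for them this is defined
almost everywhere. -/
def gradInner (g k : ExtHeis → ℝ) (p : ExtHeis) : ℝ := X g p * X k p + Y g p * Y k p + Dy g p * Dy k p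

/-- The squared length of the full gradient `(X g, Y g, ∂_y g)`. -/
def gradSq (g : ExtHeis → ℝ) (p : ExtHeis) : ℝ := gradInner g g p

/-- The intrinsic (horizontal) gradient, in coordinates with respect to `X, Y`. -/
def hGrad (g : ExtHeis → ℝ) (p : ExtHeis) : Fin 2 → ℝ := ![X g p, Y g p]

/-- The length of the intrinsic gradient. -/
def hGradNorm (g : ExtHeis → ℝ) (p : ExtHeis) : ℝ := √(X g p ^ 2 + Y g p ^ 2)

/-! ### Weak solutions and stability -/

/-- The boundary values on `ℍ × {0}`: the limit along the vertical lines. For `-1 < a < 1` and a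
locally Lipschitz function on the open half-space with `y ^ a |∇ g|²` integrable on half-balls, the
limit exists for almost every `x`. -/
def trace (g : ExtHeis → ℝ) (x : Heis) : ℝ := limUnder (𝓝[>] (0 : ℝ)) (fun y => g (x, y))

/-- The admissible test functions for the weak formulation and for stability. -/
structure IsTestFunction (a : ℝ) (ξ : ExtHeis → ℝ) : Prop where
  bounded : ∃ M, ∀ p ∈ halfSpace, |ξ p| ≤ M
  locallyLipschitz : LocallyLipschitzOn halfSpace ξ
  vanishes : ∃ R > 0, (∀ p ∈ halfSpace \ halfBall R, ξ p = 0) ∧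
    IntegrableOn (fun p => p.2 ^ a * gradSq ξ p) (halfBall R)

/-- `u`, a function that is `C²` in the open half-space (so that its weak gradient is the classical
one), is a weak solution of `div (y ^ a ∇ u) = 0` in `ℍ × (0, ∞)`, `- y ^ a ∂_y u = f u` on
`ℍ × {0}`. -/
structure IsWeakSolution (a : ℝ) (f : ℝ → ℝ) (u : ExtHeis → ℝ) : Prop where
  locallyBounded : ∀ R > 0, MemLp u ⊤ (volume.restrict (halfBall R))
  finiteEnergy : ∀ R > 0, IntegrableOn (fun p => p.2 ^ a * gradSq u p) (halfBall R)
  weakEquation : ∀ ξ, IsTestFunction a ξ →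
    ∫ p in halfSpace, p.2 ^ a * gradInner u ξ p = ∫ x : Heis, f (trace u x) * trace ξ x

/-- Stability: the second variation is nonnegative. -/
def IsStable (a : ℝ) (f : ℝ → ℝ) (u : ExtHeis → ℝ) : Prop :=
  ∀ ξ, IsTestFunction a ξ →
    0 ≤ (∫ p in halfSpace, p.2 ^ a * gradSq ξ p) -
      ∫ x : Heis, deriv f (trace u x) * trace ξ x ^ 2

/-- `f` is of class `C^{1,γ}`: continuously differentiable with a derivative that is
`γ`-Hölder continuous on bounded sets. -/
def IsC1Holder (γ : ℝ) (f : ℝ → ℝ) : Prop :=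
  ContDiff ℝ 1 f ∧
    ∀ M : ℝ, ∃ C : ℝ, ∀ s ∈ Icc (-M) M, ∀ t ∈ Icc (-M) M,
      |deriv f s - deriv f t| ≤ C * |s - t| ^ γ

/-! ### Geometry of the level sets -/

/-- The points of the open half-space at which the intrinsic gradient does not vanish. -/
def regularSet (u : ExtHeis → ℝ) : Set ExtHeis := {p | 0 < p.2 ∧ hGrad u p ≠ 0}

/-- The horizontal intrinsic Hessian; its first row is `X(Xu), Y(Xu)` and its second row is
`X(Yu), Y(Yu)`. -/
def hess (u : ExtHeis → ℝ) (p : ExtHeis) : Matrix (Fin 2) (Fin 2) ℝ :=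
  !![X (X u) p, Y (X u) p; X (Y u) p, Y (Y u) p]

/-- The norm of the intrinsic Hessian. -/
def hessNorm (u : ExtHeis → ℝ) (p : ExtHeis) : ℝ :=
  √(X (X u) p ^ 2 + Y (X u) p ^ 2 + X (Y u) p ^ 2 + Y (Y u) p ^ 2)

/-- `(Hu)²`, which stands for `(Hu)(Hu)ᵀ`. -/
def hessSq (u : ExtHeis → ℝ) (p : ExtHeis) : Matrix (Fin 2) (Fin 2) ℝ := hess u p * (hess u p)ᵀ

/-- The intrinsic normal to the level set of `u(·, y)`. -/
def normal (u : ExtHeis → ℝ) (p : ExtHeis) : Fin 2 → ℝ :=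
  ![X u p / hGradNorm u p, Y u p / hGradNorm u p]

/-- The intrinsic unit tangent to the level set of `u(·, y)`. -/
def tangent (u : ExtHeis → ℝ) (p : ExtHeis) : Fin 2 → ℝ :=
  ![Y u p / hGradNorm u p, -X u p / hGradNorm u p]

/-- The intrinsic mean curvature `div_ℍ ν = X ν₁ + Y ν₂`. -/
def meanCurvature (u : ExtHeis → ℝ) (p : ExtHeis) : ℝ :=
  X (fun q => normal u q 0) p + Y (fun q => normal u q 1) p

/-- The imaginary curvature. -/
def imaginaryCurvature (u : ExtHeis → ℝ) (p : ExtHeis) : ℝ := -T u p / hGradNorm u p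

/-- `T ν`, the derivative of the coordinates of the intrinsic normal along `T`. -/
def TNormal (u : ExtHeis → ℝ) (p : ExtHeis) : Fin 2 → ℝ :=
  ![T (fun q => normal u q 0) p, T (fun q => normal u q 1) p]

/-- `|Hu|² - ⟨(Hu)² ν, ν⟩ - 2 (TYu Xu - TXu Yu)`. -/
def analyticDensity (u : ExtHeis → ℝ) (p : ExtHeis) : ℝ :=
  hessNorm u p ^ 2 - (hessSq u p *ᵥ normal u p) ⬝ᵥ normal u p
    - 2 * (T (Y u) p * X u p - T (X u) p * Y u p)

/-- `h² + (p + ⟨Hu v, ν⟩ / |∇_ℍ u|)² + 2 ⟨Tν, v⟩`. -/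
def curvatureDensity (u : ExtHeis → ℝ) (p : ExtHeis) : ℝ :=
  meanCurvature u p ^ 2
    + (imaginaryCurvature u p
        + ((hess u p *ᵥ tangent u p) ⬝ᵥ normal u p) / hGradNorm u p) ^ 2
    + 2 * (TNormal u p ⬝ᵥ tangent u p)

end HeisenbergExtension

end

open HeisenbergExtension

/-! Stability is tested with ξ = |∇_ℍ u| φ, and the resulting energy is computed from the equations
of Xu and Yu. As X and Y do not commute, these are not simply the linearized equation. The
right-invariant fields Z do commute with X, Y and ∂_y, and they generate left translations, which
preserve the weighted measure. Hence Zu solves the linearized equation with boundary term f'(u) Zu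
(`linearized_eq`). Writing X = Z₁ - x₂T and Y = Z₂ + x₁T with T central, the linear coefficients
produce the extra terms 2∫y^a T(Yu)ξ in the equation of Xu and -2∫y^a T(Xu)ξ in that of Yu
(`horizontal_eq`).

Testing these equations with Xu φ² and Yu φ² and adding gives (`integral_horizontal_energy`) ∫ y^a
(|∇(Xu φ)|² + |∇(Yu φ)|² - 2(TYu Xu - TXu Yu)φ²) = ∫ f'(u)|∇_ℍ u|²φ² + ∫ y^a |∇_ℍ u|²|∇φ|².
Stability bounds the f' integral by the energy of |∇_ℍ u|φ. Lagrange's identity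
(`gradSq_pairNorm_add`) computes what that energy lacks: where ∇_ℍ u ≠ 0 it is φ² Σ_i (Xu D_iYu - Yu
D_iXu)²/|∇_ℍ u|². Discarding the ∂_y summand leaves the analytic density.

All this needs Xu, Yu and their first derivatives to be locally square integrable up to y = 0, and
this is the long part. Difference quotients w of u along right-invariant fields solve an equation
whose boundary coefficient is bounded, so a trace inequality with a small constant in front of the
energy (`trace_inequality`) yields `caccioppoli`: the energy of w is controlled by its L² norm. The
L² norm itself is not obvious for the vertical quotients, since Tu is not controlled by ∇_ℍ u
pointwise. In `exists_bound_dq_T` one uses T = [X,Y] and one integration by parts: ∫ w·wχ² is at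
most sup|∇_ℍ u| times ∫ |∇_ℍ(wχ²)|. The right side is linear in ∇w, whose square is controlled by ∫
w²χ², so Young's inequality absorbs it. Then Z₁u = Xu + x₂Tu and Z₂u = Yu - x₁Tu are locally in L²,
and Caccioppoli gives the energy of all three.

The geometric form of the density is algebra in the orthonormal basis (ν, v): |Hu|² - |(Hu)ᵀν|² =
|(Hu)ᵀv|², whose components along v and ν are h|∇_ℍ u| and ⟨Hu ν, v⟩. The latter differs from ⟨Hu v,
ν⟩ by the antisymmetric part of Hu, which is Tu and enters as the imaginary curvature
(`density_identity`). -/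

namespace HeisenbergExtension

/-! ### Left-invariant frame, right-invariant fields, left translations -/

/-- The left-invariant fields `X`, `Y`, `∂_y`. -/
def frame : Fin 3 → ExtHeis → ExtHeis
  | 0 => fun p => ((1, 0, 2 * p.1.2.1), 0)
  | 1 => fun p => ((0, 1, -2 * p.1.1), 0)
  | 2 => fun _ => ((0, 0, 0), 1)

/-- The derivative along the `i`-th field of the frame. -/
noncomputable def D (i : Fin 3) (g : ExtHeis → ℝ) (p : ExtHeis) : ℝ := fderiv ℝ g p (frame i p)

lemma D_zero (g : ExtHeis → ℝ) : D 0 g = X g := rfl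
lemma D_one (g : ExtHeis → ℝ) : D 1 g = Y g := rfl
lemma D_two (g : ExtHeis → ℝ) : D 2 g = Dy g := rfl

lemma gradInner_eq_sum (g k : ExtHeis → ℝ) (p : ExtHeis) :
    gradInner g k p = ∑ i, D i g p * D i k p := by
  simp [gradInner, Fin.sum_univ_three, D_zero, D_one, D_two]

/-- The right-invariant fields; they commute with the frame. -/
def killing (e : Heis) (p : ExtHeis) : ExtHeis :=
  ((e.1, e.2.1, e.2.2 - 2 * e.1 * p.1.2.1 + 2 * e.2.1 * p.1.1), 0)

/-- The derivative along a right-invariant field. -/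
noncomputable def Z (e : Heis) (g : ExtHeis → ℝ) (p : ExtHeis) : ℝ := fderiv ℝ g p (killing e p)

/-- The left translations of the Heisenberg group. -/
def tauH (e : Heis) (h : ℝ) (x : Heis) : Heis :=
  (x.1 + h * e.1, x.2.1 + h * e.2.1, x.2.2 + h * (e.2.2 - 2 * e.1 * x.2.1 + 2 * e.2.1 * x.1))

/-- The left translations, acting on `ℍ × ℝ`. -/
def tau (e : Heis) (h : ℝ) (p : ExtHeis) : ExtHeis := (tauH e h p.1, p.2)

/-- A right-invariant field is constant along its own orbits, so the orbits are straight lines and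
the flow is affine in the time h. -/
lemma tau_eq (e : Heis) (h : ℝ) (p : ExtHeis) : tau e h p = p + h • killing e p := by
  ext <;> simp [tau, tauH, killing]

lemma tauH_tauH (e : Heis) (h s : ℝ) (x : Heis) : tauH e h (tauH e s x) = tauH e (h + s) x := by
  ext <;> simp [tauH] <;> ring

lemma tauH_zero (e : Heis) (x : Heis) : tauH e 0 x = x := by
  ext <;> simp [tauH]

lemma tau_tau (e : Heis) (h s : ℝ) (p : ExtHeis) : tau e h (tau e s p) = tau e (h + s) p := by
  simp [tau, tauH_tauH]

lemma tau_zero (e : Heis) (p : ExtHeis) : tau e 0 p = p := by simp [tau, tauH_zero]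

lemma tau_mem {e : Heis} {h : ℝ} {p : ExtHeis} : tau e h p ∈ halfSpace ↔ p ∈ halfSpace := Iff.rfl

lemma contDiff_tau (e : Heis) (h : ℝ) {n : ℕ∞ω} : ContDiff ℝ n (tau e h) := by
  unfold tau tauH; fun_prop

lemma continuous_tau_uncurry (e : Heis) : Continuous fun q : ExtHeis × ℝ => tau e q.2 q.1 := by
  unfold tau tauH; fun_prop

lemma contDiff_frame (i : Fin 3) {n : ℕ∞ω} : ContDiff ℝ n (frame i) := by
  fin_cases i <;> (simp only [frame]; fun_prop)

lemma contDiff_killing (e : Heis) {n : ℕ∞ω} : ContDiff ℝ n (killing e) := by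
  unfold killing; fun_prop

lemma isOpen_halfSpace : IsOpen halfSpace := isOpen_lt continuous_const continuous_snd

/-- The first coordinate as a linear functional. -/
noncomputable def coordA : ExtHeis →L[ℝ] ℝ :=
  (ContinuousLinearMap.fst ℝ ℝ (ℝ × ℝ)).comp (ContinuousLinearMap.fst ℝ Heis ℝ)

/-- The second coordinate as a linear functional. -/
noncomputable def coordB : ExtHeis →L[ℝ] ℝ :=
  (ContinuousLinearMap.fst ℝ ℝ ℝ).comp
    ((ContinuousLinearMap.snd ℝ ℝ (ℝ × ℝ)).comp (ContinuousLinearMap.fst ℝ Heis ℝ))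

/-- A vertical vector with linear coefficient. -/
noncomputable def vertLin (l : ExtHeis →L[ℝ] ℝ) : ExtHeis →L[ℝ] ExtHeis :=
  l.smulRight ((0, 0, 1), 0)

/-- Every field in play is a constant plus a vertical vector with linear coefficient. Its derivative
is therefore explicit and constant, which reduces all commutators to linear algebra. -/
lemma hasFDerivAt_add_vertLin {V : ExtHeis → ExtHeis} (l : ExtHeis →L[ℝ] ℝ)
    (hV : ∀ p, V p = V 0 + vertLin l p) (p : ExtHeis) : HasFDerivAt V (vertLin l) p := by
  have : V = fun p => V 0 + vertLin l p := funext hV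
  rw [this]
  exact (vertLin l).hasFDerivAt.const_add _

lemma hasFDerivAt_frame_zero (p : ExtHeis) :
    HasFDerivAt (frame 0) (vertLin ((2 : ℝ) • coordB)) p :=
  hasFDerivAt_add_vertLin _ (fun p => by
    ext <;> simp [frame, vertLin, coordB]) p

lemma hasFDerivAt_frame_one (p : ExtHeis) :
    HasFDerivAt (frame 1) (vertLin ((-2 : ℝ) • coordA)) p :=
  hasFDerivAt_add_vertLin _ (fun p => by
    ext <;> simp [frame, vertLin, coordA]) p

lemma hasFDerivAt_frame_two (p : ExtHeis) : HasFDerivAt (frame 2) (vertLin 0) p :=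
  hasFDerivAt_add_vertLin _ (fun p => by ext <;> simp [frame, vertLin]) p

lemma hasFDerivAt_killing (e : Heis) (p : ExtHeis) :
    HasFDerivAt (killing e) (vertLin ((-2 * e.1) • coordB + (2 * e.2.1) • coordA)) p :=
  hasFDerivAt_add_vertLin _ (fun p => by
    ext <;> simp [killing, vertLin, coordA, coordB]; ring) p

/-- This is left invariance of the frame: the differential of a translation is the identity plus a
vertical shear, evaluated here on the three fields. -/
lemma fderiv_tau_frame (e : Heis) (h : ℝ) (i : Fin 3) (p : ExtHeis) :
    fderiv ℝ (tau e h) p (frame i p) = frame i (tau e h p) := by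
  have h1 : HasFDerivAt (tau e h) (ContinuousLinearMap.id ℝ ExtHeis +
      h • (vertLin ((-2 * e.1) • coordB + (2 * e.2.1) • coordA))) p := by
    have : tau e h = fun p => p + h • killing e p := funext (tau_eq e h)
    rw [this]
    exact (hasFDerivAt_id p).add ((hasFDerivAt_killing e p).const_smul h)
  rw [h1.fderiv]
  fin_cases i <;> ext <;> simp [frame, vertLin, coordA, coordB, tau, tauH] <;> ring

lemma D_comp_tau (e : Heis) (h : ℝ) (i : Fin 3) {g : ExtHeis → ℝ} {p : ExtHeis}
    (hg : DifferentiableAt ℝ g (tau e h p)) :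
    D i (fun q => g (tau e h q)) p = D i g (tau e h p) := by
  have h2 : DifferentiableAt ℝ (tau e h) p := (contDiff_tau e h (n := 1)).differentiable one_ne_zero p
  have := fderiv_comp p hg h2
  unfold D
  rw [show (fun q => g (tau e h q)) = g ∘ tau e h from rfl, this]
  simp [fderiv_tau_frame]

lemma killing_tau (e : Heis) (h : ℝ) (p : ExtHeis) : killing e (tau e h p) = killing e p := by
  ext <;> simp [killing, tau, tauH]; ring

lemma hasDerivAt_tau (e : Heis) {g : ExtHeis → ℝ} {p : ExtHeis} {s : ℝ}
    (hg : DifferentiableAt ℝ g (tau e s p)) :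
    HasDerivAt (fun s => g (tau e s p)) (Z e g (tau e s p)) s := by
  have h1 : HasDerivAt (fun s => tau e s p) (killing e p) s := by
    have : (fun s => tau e s p) = fun s => p + s • killing e p := funext fun s => tau_eq e s p
    rw [this]
    simpa using ((hasDerivAt_id s).smul_const (killing e p)).const_add p
  have := hg.hasFDerivAt.comp_hasDerivAt s h1
  rwa [← killing_tau e s p] at this

section rules
variable {g k : ExtHeis → ℝ} {p : ExtHeis} (i : Fin 3)

lemma D_mul (hg : DifferentiableAt ℝ g p) (hk : DifferentiableAt ℝ k p) :
    D i (fun q => g q * k q) p = g p * D i k p + D i g p * k p := by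
  unfold D; rw [fderiv_fun_mul hg hk]; simp; ring

lemma D_add (hg : DifferentiableAt ℝ g p) (hk : DifferentiableAt ℝ k p) :
    D i (fun q => g q + k q) p = D i g p + D i k p := by
  unfold D; rw [fderiv_fun_add hg hk]; simp

lemma D_sub (hg : DifferentiableAt ℝ g p) (hk : DifferentiableAt ℝ k p) :
    D i (fun q => g q - k q) p = D i g p - D i k p := by
  unfold D; rw [fderiv_fun_sub hg hk]; simp

lemma D_div_const (hg : DifferentiableAt ℝ g p) (c : ℝ) :
    D i (fun q => g q / c) p = D i g p / c := by
  unfold D; simp only [div_eq_mul_inv]; rw [fderiv_mul_const hg]; simp [mul_comm]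

lemma D_congr (h : g =ᶠ[𝓝 p] k) : D i g p = D i k p := by
  unfold D; rw [h.fderiv_eq]

end rules

/-! ### Smoothness of directional derivatives and commutation relations -/

lemma contDiffOn_dir {g : ExtHeis → ℝ} {V : ExtHeis → ExtHeis} {m n : ℕ∞ω}
    (hg : ContDiffOn ℝ n g halfSpace) (hV : ContDiff ℝ m V) (hmn : m + 1 ≤ n) :
    ContDiffOn ℝ m (fun p => fderiv ℝ g p (V p)) halfSpace :=
  (hg.fderiv_of_isOpen isOpen_halfSpace hmn).clm_apply hV.contDiffOn

lemma contDiffOn_D {g : ExtHeis → ℝ} (i : Fin 3) (hg : ContDiffOn ℝ 2 g halfSpace) :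
    ContDiffOn ℝ 1 (D i g) halfSpace :=
  contDiffOn_dir hg (contDiff_frame i) (by norm_num)

lemma contDiffOn_Z {g : ExtHeis → ℝ} (e : Heis) (hg : ContDiffOn ℝ 2 g halfSpace) :
    ContDiffOn ℝ 1 (Z e g) halfSpace :=
  contDiffOn_dir hg (contDiff_killing e) (by norm_num)

lemma continuousOn_D {g : ExtHeis → ℝ} (i : Fin 3) (hg : ContDiffOn ℝ 1 g halfSpace) :
    ContinuousOn (D i g) halfSpace :=
  (contDiffOn_dir hg (m := 0) (contDiff_frame i) (by norm_num)).continuousOn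

lemma continuousOn_Z {g : ExtHeis → ℝ} (e : Heis) (hg : ContDiffOn ℝ 1 g halfSpace) :
    ContinuousOn (Z e g) halfSpace :=
  (contDiffOn_dir hg (m := 0) (contDiff_killing e) (by norm_num)).continuousOn

lemma differentiableAt_of_mem {g : ExtHeis → ℝ} (hg : ContDiffOn ℝ 1 g halfSpace) {p : ExtHeis}
    (hp : p ∈ halfSpace) : DifferentiableAt ℝ g p :=
  (hg.contDiffAt (isOpen_halfSpace.mem_nhds hp)).differentiableAt one_ne_zero

lemma hasFDerivAt_dir {g : ExtHeis → ℝ} {V : ExtHeis → ExtHeis} {V' : ExtHeis →L[ℝ] ExtHeis}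
    {p : ExtHeis} (hg : ContDiffAt ℝ 2 g p) (hV : HasFDerivAt V V' p) :
    HasFDerivAt (fun q => fderiv ℝ g q (V q))
      ((fderiv ℝ g p).comp V' + (fderiv ℝ (fderiv ℝ g) p).flip (V p)) p :=
  ((hg.fderiv_right (m := 1) (by norm_num)).differentiableAt
    one_ne_zero).hasFDerivAt.clm_apply hV

/-- The commutator formula for second derivatives. -/
lemma dir_comm {g : ExtHeis → ℝ} {V W : ExtHeis → ExtHeis} {V' W' : ExtHeis →L[ℝ] ExtHeis}
    {p : ExtHeis} (hg : ContDiffAt ℝ 2 g p) (hV : HasFDerivAt V V' p) (hW : HasFDerivAt W W' p) :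
    fderiv ℝ (fun q => fderiv ℝ g q (V q)) p (W p) - fderiv ℝ (fun q => fderiv ℝ g q (W q)) p (V p)
      = fderiv ℝ g p (V' (W p) - W' (V p)) := by
  rw [(hasFDerivAt_dir hg hV).fderiv, (hasFDerivAt_dir hg hW).fderiv]
  have := (hg.isSymmSndFDerivAt (by simp)).eq (V p) (W p)
  simp [this]

variable {u : ExtHeis → ℝ} {p : ExtHeis}

/-- Left- and right-invariant fields commute: in `dir_comm` the two vertical corrections cancel.
This is what allows differentiating the equation along Z. -/
lemma Z_D_comm (hu : ContDiffAt ℝ 2 u p) (e : Heis) (i : Fin 3) :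
    Z e (D i u) p = D i (Z e u) p := by
  refine sub_eq_zero.1 ?_
  fin_cases i
  · refine (dir_comm hu (hasFDerivAt_frame_zero p) (hasFDerivAt_killing e p)).trans ?_
    simp [vertLin, killing, frame, coordA, coordB]
  · refine (dir_comm hu (hasFDerivAt_frame_one p) (hasFDerivAt_killing e p)).trans ?_
    simp [vertLin, killing, frame, coordA, coordB]
  · refine (dir_comm hu (hasFDerivAt_frame_two p) (hasFDerivAt_killing e p)).trans ?_
    simp [vertLin, killing, frame, coordA, coordB]

lemma T_eq_commutator (hu : ContDiffAt ℝ 2 u p) : T u p = X (Y u) p - Y (X u) p := by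
  refine Eq.trans ?_ (dir_comm hu (hasFDerivAt_frame_one p) (hasFDerivAt_frame_zero p)).symm
  unfold T
  congr 1
  ext <;> simp [vertLin, frame, coordA, coordB]
  norm_num

/-- T spans the centre, so it is both left- and right-invariant, and everything proved for Z applies
to it. -/
lemma T_eq_Z (g : ExtHeis → ℝ) : T g = Z (0, 0, -4) g := by
  ext p; simp [T, Z, killing]

lemma T_D_comm (hu : ContDiffAt ℝ 2 u p) (i : Fin 3) : T (D i u) p = D i (T u) p := by
  rw [T_eq_Z, T_eq_Z, Z_D_comm hu]

/-- The vertical components of the left- and right-invariant extensions of one direction differ by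
4x₂, that is, by -x₂T. Equations for Zu and Tu thus give one for Xu. -/
lemma X_eq (g : ExtHeis → ℝ) (p : ExtHeis) : X g p = Z (1, 0, 0) g p - p.1.2.1 * T g p := by
  unfold X Z T
  rw [← smul_eq_mul p.1.2.1, ← map_smul, ← map_sub]
  congr 1
  ext <;> simp [killing]
  ring

lemma Y_eq (g : ExtHeis → ℝ) (p : ExtHeis) : Y g p = Z (0, 1, 0) g p + p.1.1 * T g p := by
  unfold Y Z T
  rw [← smul_eq_mul p.1.1, ← map_smul, ← map_add]
  congr 1
  ext <;> simp [killing]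
  ring

/-! ### The weighted measure on the half-space -/

/-- The measure `y ^ a dy` on `(0, ∞)`. -/
noncomputable def wMeasR (a : ℝ) : Measure ℝ :=
  (volume.restrict (Ioi 0)).withDensity fun y => ENNReal.ofReal (y ^ a)

/-- The measure `y ^ a dx dy` on the half-space. -/
noncomputable def wMeas (a : ℝ) : Measure ExtHeis := (volume : Measure Heis).prod (wMeasR a)

lemma measurable_weight (a : ℝ) : Measurable fun y : ℝ => ENNReal.ofReal (y ^ a) := by fun_prop

instance (a : ℝ) : SigmaFinite (wMeasR a) := by unfold wMeasR; infer_instance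

lemma measurableSet_halfSpace : MeasurableSet halfSpace := isOpen_halfSpace.measurableSet

/-- The product form serves Fubini over slices and vertical lines; the density form serves the
comparison with the integrals of the statement. -/
lemma wMeas_eq (a : ℝ) : wMeas a =
    (volume.restrict halfSpace).withDensity fun p : ExtHeis => ENNReal.ofReal (p.2 ^ a) := by
  have h1 : (volume : Measure ExtHeis).restrict halfSpace
      = (volume : Measure Heis).prod ((volume : Measure ℝ).restrict (Ioi 0)) := by
    have : halfSpace = (univ : Set Heis) ×ˢ (Ioi (0 : ℝ)) := by
      ext p; simp [halfSpace]
    rw [this, Measure.volume_eq_prod, ← Measure.prod_restrict, Measure.restrict_univ]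
  rw [h1, wMeas, wMeasR, prod_withDensity_right (measurable_weight a)]

lemma wMeas_restrict (a : ℝ) {S : Set ExtHeis} (hS : MeasurableSet S) (hS' : S ⊆ halfSpace) :
    (wMeas a).restrict S =
      (volume.restrict S).withDensity fun p : ExtHeis => ENNReal.ofReal (p.2 ^ a) := by
  rw [wMeas_eq, restrict_withDensity hS, Measure.restrict_restrict hS, inter_eq_left.2 hS']

lemma setIntegral_wMeas (a : ℝ) {S : Set ExtHeis} (hS : MeasurableSet S) (hS' : S ⊆ halfSpace)
    (F : ExtHeis → ℝ) : ∫ p in S, F p ∂wMeas a = ∫ p in S, p.2 ^ a * F p := by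
  rw [wMeas_restrict a hS hS', integral_withDensity_eq_integral_toReal_smul (by fun_prop) (by simp)]
  refine setIntegral_congr_fun hS fun p hp => ?_
  have : 0 < p.2 := hS' hp
  simp [ENNReal.toReal_ofReal (Real.rpow_nonneg this.le a)]

lemma integrableOn_wMeas (a : ℝ) {S : Set ExtHeis} (hS : MeasurableSet S) (hS' : S ⊆ halfSpace)
    {F : ExtHeis → ℝ} :
    IntegrableOn F S (wMeas a) ↔ IntegrableOn (fun p => p.2 ^ a * F p) S := by
  rw [IntegrableOn, wMeas_restrict a hS hS', integrable_withDensity_iff_integrable_smul'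
    (by fun_prop) (by simp)]
  refine integrableOn_congr_fun (fun p hp => ?_) hS
  have : 0 < p.2 := hS' hp
  simp [ENNReal.toReal_ofReal (Real.rpow_nonneg this.le a)]

lemma wMeas_restrict_halfSpace (a : ℝ) : (wMeas a).restrict halfSpace = wMeas a := by
  rw [wMeas_restrict a measurableSet_halfSpace le_rfl, ← wMeas_eq]

lemma integral_wMeas (a : ℝ) (F : ExtHeis → ℝ) :
    ∫ p, F p ∂wMeas a = ∫ p in halfSpace, p.2 ^ a * F p := by
  rw [← setIntegral_wMeas a measurableSet_halfSpace le_rfl, wMeas_restrict_halfSpace]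

lemma integrable_wMeas (a : ℝ) {F : ExtHeis → ℝ} :
    Integrable F (wMeas a) ↔ IntegrableOn (fun p => p.2 ^ a * F p) halfSpace := by
  rw [← integrableOn_wMeas a measurableSet_halfSpace le_rfl, IntegrableOn,
    wMeas_restrict_halfSpace]

lemma ae_mem_halfSpace (a : ℝ) : ∀ᵐ p ∂wMeas a, p ∈ halfSpace := by
  rw [← wMeas_restrict_halfSpace]; exact ae_restrict_mem measurableSet_halfSpace

lemma aesm_of_continuousOn {a : ℝ} {F : ExtHeis → ℝ} (hF : ContinuousOn F halfSpace) :
    AEStronglyMeasurable F (wMeas a) := by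
  rw [wMeas_eq]
  exact (hF.aestronglyMeasurable measurableSet_halfSpace).mono_ac
    (withDensity_absolutelyContinuous _ _)

lemma ae_mem_Ioi (a : ℝ) : ∀ᵐ y ∂wMeasR a, 0 < y := by
  have : ∀ᵐ y ∂((volume : Measure ℝ).restrict (Ioi 0)), 0 < y := ae_restrict_mem measurableSet_Ioi
  exact (withDensity_absolutelyContinuous _ _).ae_le this

lemma setIntegral_wMeasR (a : ℝ) {S : Set ℝ} (hS : MeasurableSet S) (hS' : S ⊆ Ioi 0)
    (F : ℝ → ℝ) : ∫ y in S, F y ∂wMeasR a = ∫ y in S, y ^ a * F y := by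
  rw [wMeasR, restrict_withDensity hS, Measure.restrict_restrict hS, inter_eq_left.2 hS',
    integral_withDensity_eq_integral_toReal_smul (by fun_prop) (by simp)]
  refine setIntegral_congr_fun hS fun y hy => ?_
  have : 0 < y := hS' hy
  simp [ENNReal.toReal_ofReal (Real.rpow_nonneg this.le a)]

lemma integrableOn_wMeasR (a : ℝ) {S : Set ℝ} (hS : MeasurableSet S) (hS' : S ⊆ Ioi 0)
    {F : ℝ → ℝ} : IntegrableOn F S (wMeasR a) ↔ IntegrableOn (fun y => y ^ a * F y) S := by
  rw [IntegrableOn, wMeasR, restrict_withDensity hS, Measure.restrict_restrict hS,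
    inter_eq_left.2 hS', integrable_withDensity_iff_integrable_smul' (by fun_prop) (by simp)]
  refine integrableOn_congr_fun (fun y hy => ?_) hS
  have : 0 < y := hS' hy
  simp [ENNReal.toReal_ofReal (Real.rpow_nonneg this.le a)]

lemma integrableOn_Ioc_rpow {r : ℝ} (hr : -1 < r) (b : ℝ) (hb : 0 ≤ b) :
    IntegrableOn (fun y : ℝ => y ^ r) (Ioc 0 b) :=
  (intervalIntegrable_iff_integrableOn_Ioc_of_le hb).1 (intervalIntegral.intervalIntegrable_rpow' hr)

/-- Since a > -1, the weight is integrable at 0. Compact sets touching y = 0 thus have finite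
measure, and local integrability for `wMeas` means integrability up to the boundary. -/
lemma isLocallyFinite_wMeasR {a : ℝ} (ha : -1 < a) : IsLocallyFiniteMeasure (wMeasR a) := by
  refine ⟨fun x => ⟨Iio (|x| + 1), Iio_mem_nhds (by linarith [le_abs_self x]), ?_⟩⟩
  have h0 : 0 ≤ |x| + 1 := by positivity
  have h1 : wMeasR a (Iio (|x| + 1)) ≤ wMeasR a (Ioc 0 (|x| + 1)) := by
    refine measure_mono_ae ?_
    filter_upwards [ae_mem_Ioi a] with y hy hy' using ⟨hy, le_of_lt hy'⟩
  refine h1.trans_lt ?_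
  have h2 : IntegrableOn (fun _ => (1 : ℝ)) (Ioc 0 (|x| + 1)) (wMeasR a) := by
    rw [integrableOn_wMeasR a measurableSet_Ioc (fun y hy => hy.1)]
    simpa using integrableOn_Ioc_rpow ha _ h0
  have := (integrable_const_iff.1 h2)
  simpa [isFiniteMeasure_iff] using this

lemma isLocallyFinite_wMeas {a : ℝ} (ha : -1 < a) : IsLocallyFiniteMeasure (wMeas a) := by
  have := isLocallyFinite_wMeasR ha
  unfold wMeas; infer_instance

/-! ### Translations preserve the measure -/

/-- The translation is triangular: each coordinate is shifted by an amount depending only on the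
earlier ones. Two skew products of one-dimensional translations give the invariance. -/
lemma measurePreserving_tauH (e : Heis) (h : ℝ) : MeasurePreserving (tauH e h) := by
  have h1 : MeasurePreserving (fun q : ℝ × ℝ => q + (h * e.1, h * e.2.1)) :=
    measurePreserving_add_right volume _
  have A : ∀ c : ℝ, MeasurePreserving (fun x : ℝ => x + c) := fun c =>
    measurePreserving_add_right volume c
  have B : ∀ x1 : ℝ, MeasurePreserving (fun q : ℝ × ℝ =>
      (q.1 + h * e.2.1, q.2 + h * (e.2.2 - 2 * e.1 * q.1 + 2 * e.2.1 * x1))) := by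
    intro x1
    refine (A (h * e.2.1)).skew_product
      (g := fun s t => t + h * (e.2.2 - 2 * e.1 * s + 2 * e.2.1 * x1)) (by
        unfold Function.uncurry; fun_prop) (Eventually.of_forall fun s => (A _).map_eq)
  exact (A (h * e.1)).skew_product
    (g := fun (x1 : ℝ) (q : ℝ × ℝ) => (q.1 + h * e.2.1, q.2 + h * (e.2.2 - 2 * e.1 * q.1 + 2 * e.2.1 * x1)))
    (by unfold Function.uncurry; fun_prop) (Eventually.of_forall fun s => (B s).map_eq)

lemma measurePreserving_tau (a : ℝ) (e : Heis) (h : ℝ) :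
    MeasurePreserving (tau e h) (wMeas a) (wMeas a) :=
  (measurePreserving_tauH e h).prod (MeasurePreserving.id _)

/-- The left translations of `ℍ × ℝ` as homeomorphisms. -/
def tauHomeo (e : Heis) (h : ℝ) : ExtHeis ≃ₜ ExtHeis where
  toFun := tau e h
  invFun := tau e (-h)
  left_inv p := by simp [tau_tau, tau_zero]
  right_inv p := by simp [tau_tau, tau_zero]
  continuous_toFun := (contDiff_tau e h (n := 0)).continuous
  continuous_invFun := (contDiff_tau e (-h) (n := 0)).continuous

/-- The left translations of `ℍ` as homeomorphisms. -/
def tauHHomeo (e : Heis) (h : ℝ) : Heis ≃ₜ Heis where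
  toFun := tauH e h
  invFun := tauH e (-h)
  left_inv p := by simp [tauH_tauH, tauH_zero]
  right_inv p := by simp [tauH_tauH, tauH_zero]
  continuous_toFun := by unfold tauH; fun_prop
  continuous_invFun := by unfold tauH; fun_prop

lemma measurableEmbedding_tau (e : Heis) (h : ℝ) : MeasurableEmbedding (tau e h) :=
  (tauHomeo e h).measurableEmbedding

lemma measurableEmbedding_tauH (e : Heis) (h : ℝ) : MeasurableEmbedding (tauH e h) :=
  (tauHHomeo e h).measurableEmbedding

lemma integral_comp_tau (a : ℝ) (e : Heis) (h : ℝ) (F : ExtHeis → ℝ) :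
    ∫ p, F (tau e h p) ∂wMeas a = ∫ p, F p ∂wMeas a :=
  (measurePreserving_tau a e h).integral_comp (measurableEmbedding_tau e h) F

lemma integral_comp_tauH (e : Heis) (h : ℝ) (F : Heis → ℝ) :
    ∫ x, F (tauH e h x) = ∫ x, F x :=
  (measurePreserving_tauH e h).integral_comp (measurableEmbedding_tauH e h) F

/-! ### Integration by parts along the horizontal fields -/

lemma integral_fderiv_eq_zero {k : Heis → ℝ} (hk : ContDiff ℝ 1 k) (hc : HasCompactSupport k)
    (v : Heis) : ∫ x, fderiv ℝ k x v = 0 := by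
  have hd := hc.fderiv (𝕜 := ℝ)
  have hcont : Continuous fun x => fderiv ℝ k x v := (hk.continuous_fderiv one_ne_zero).clm_apply
    continuous_const
  have hcs : HasCompactSupport fun x => fderiv ℝ k x v := by
    refine hd.mono fun x hx h0 => hx ?_
    simp only [h0]; rfl
  have : (volume : Measure Heis).IsAddHaarMeasure :=
    @Measure.prod.instIsAddHaarMeasure ℝ _ _ _ (ℝ × ℝ) _ _ _ volume volume _
      (Measure.prod.instIsAddHaarMeasure volume volume) _ _ _ _
  have := integral_bilinear_hasLineDerivAt_right_eq_neg_left_of_integrable (μ := volume)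
    (f := fun _ : Heis => (1 : ℝ)) (f' := fun _ => 0) (g := k) (g' := fun x => fderiv ℝ k x v)
    (v := v) (B := ContinuousLinearMap.mul ℝ ℝ) (by simp)
    (by simpa using hcont.integrable_of_hasCompactSupport hcs)
    (by simpa using hk.continuous.integrable_of_hasCompactSupport hc)
    (fun x _ => by simpa using (hasFDerivAt_const (1 : ℝ) x).hasLineDerivAt v)
    (fun x _ => ((hk.differentiable one_ne_zero x).hasFDerivAt).hasLineDerivAt v)
  simpa using this

/-- Horizontal derivatives on a slice have zero mean. -/
lemma integral_slice_D {g : ExtHeis → ℝ} (hg : ContDiffOn ℝ 1 g halfSpace) {y : ℝ} (hy : 0 < y)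
    (hc : HasCompactSupport fun x => g (x, y)) {i : Fin 3} (hi : i ≠ 2) :
    ∫ x, D i g (x, y) = 0 := by
  set k : Heis → ℝ := fun x => g (x, y) with hk
  have hmem : ∀ x : Heis, ((x, y) : ExtHeis) ∈ halfSpace := fun x => hy
  have hkc : ContDiff ℝ 1 k := by
    rw [← contDiffOn_univ]
    exact hg.comp (contDiff_id.prodMk contDiff_const).contDiffOn fun x _ => hmem x
  have hfd : ∀ x v, fderiv ℝ k x v = fderiv ℝ g (x, y) (v, 0) := by
    intro x v
    have h1 : HasFDerivAt (fun x : Heis => ((x, y) : ExtHeis)) (ContinuousLinearMap.inl ℝ Heis ℝ) x :=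
      hasFDerivAt_prodMk_left x y
    have h2 := (differentiableAt_of_mem hg (hmem x)).hasFDerivAt.comp x h1
    rw [show k = g ∘ fun x => (x, y) from rfl, h2.fderiv]
    simp
  -- A coefficient that is constant in the direction v can be moved under the derivative. It applies
  -- to 2x₂∂₃ and -2x₁∂₃, which is why X and Y are divergence free.
  have key : ∀ (v : Heis) (c : Heis → ℝ), ContDiff ℝ 1 c → (∀ x, fderiv ℝ c x v = 0) →
      ∫ x, c x * fderiv ℝ k x v = 0 := by
    intro v c hcd hv
    have h1 := integral_fderiv_eq_zero (hcd.mul hkc) (hc.mul_left (f := c)) v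
    rw [← h1]
    refine integral_congr_ae (Eventually.of_forall fun x => ?_)
    simp only
    rw [show (fun x => c x * k x) = c * k from rfl,
      fderiv_mul (hcd.differentiable one_ne_zero x) (hkc.differentiable one_ne_zero x)]
    simp [hv]
  have hint : ∀ (v : Heis) (c : Heis → ℝ), Continuous c →
      Integrable fun x => c x * fderiv ℝ k x v := by
    intro v c hcc
    have hcs : HasCompactSupport fun x => fderiv ℝ k x v := by
      refine (hc.fderiv (𝕜 := ℝ)).mono fun x hx h0 => hx ?_
      simp only [h0]; rfl
    exact (hcc.mul ((hkc.continuous_fderiv one_ne_zero).clm_apply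
      continuous_const)).integrable_of_hasCompactSupport hcs.mul_left
  fin_cases i
  · have h : ∀ x : Heis, D 0 g (x, y) = 1 * fderiv ℝ k x (1, 0, 0)
        + 2 * x.2.1 * fderiv ℝ k x (0, 0, 1) := by
      intro x
      simp only [hfd, D, frame]
      rw [one_mul, ← smul_eq_mul (2 * x.2.1), ← map_smul, ← map_add]
      congr 1
      ext <;> simp
    simp only [Fin.zero_eta, h]
    rw [integral_add (hint _ _ continuous_const) (hint _ _ (by fun_prop)),
      key _ _ contDiff_const (by simp), key _ _ (by fun_prop), add_zero]
    intro x
    have h2 : HasFDerivAt (fun x : Heis => 2 * x.2.1) ((2 : ℝ) •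
      ((ContinuousLinearMap.fst ℝ ℝ ℝ).comp (ContinuousLinearMap.snd ℝ ℝ (ℝ × ℝ)))) x :=
      HasFDerivAt.const_mul (ContinuousLinearMap.hasFDerivAt
        ((ContinuousLinearMap.fst ℝ ℝ ℝ).comp (ContinuousLinearMap.snd ℝ ℝ (ℝ × ℝ)))) (2 : ℝ)
    rw [h2.fderiv]; simp
  · have h : ∀ x : Heis, D 1 g (x, y) = 1 * fderiv ℝ k x (0, 1, 0)
        + -2 * x.1 * fderiv ℝ k x (0, 0, 1) := by
      intro x
      simp only [hfd, D, frame]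
      rw [one_mul, ← smul_eq_mul (-2 * x.1), ← map_smul, ← map_add]
      congr 1
      ext <;> simp
    simp only [Fin.mk_one, h]
    rw [integral_add (hint _ _ continuous_const) (hint _ _ (by fun_prop)),
      key _ _ contDiff_const (by simp), key _ _ (by fun_prop), add_zero]
    intro x
    have h2 : HasFDerivAt (fun x : Heis => -2 * x.1) ((-2 : ℝ) •
      (ContinuousLinearMap.fst ℝ ℝ (ℝ × ℝ))) x :=
      HasFDerivAt.const_mul (ContinuousLinearMap.hasFDerivAt
        (ContinuousLinearMap.fst ℝ ℝ (ℝ × ℝ))) (-2 : ℝ)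
    rw [h2.fderiv]; simp
  · exact absurd rfl hi

lemma integral_wMeas_slices {a : ℝ} {F : ExtHeis → ℝ} (hF : Integrable F (wMeas a)) :
    ∫ p, F p ∂wMeas a = ∫ y, (∫ x, F (x, y)) ∂wMeasR a :=
  integral_prod_symm F hF

/-! ### Locally square integrable functions -/

/-- Functions continuous in the half-space, locally square integrable up to its boundary. -/
structure L2loc (a : ℝ) (g : ExtHeis → ℝ) : Prop where
  cont : ContinuousOn g halfSpace
  sq : LocallyIntegrable (fun p => g p ^ 2) (wMeas a)

/-- Functions locally bounded up to the boundary. -/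
def LocBdd (g : ExtHeis → ℝ) : Prop := ∀ R : ℝ, ∃ C, ∀ p ∈ halfSpace, ‖p‖ ≤ R → |g p| ≤ C

lemma locallyIntegrable_of_le {a : ℝ} {F G : ExtHeis → ℝ} (hF : ContinuousOn F halfSpace)
    (hG : LocallyIntegrable G (wMeas a)) (h : ∀ p ∈ halfSpace, |F p| ≤ G p) :
    LocallyIntegrable F (wMeas a) := by
  refine locallyIntegrable_iff.2 fun K hK => ?_
  refine (hG.integrableOn_isCompact hK).mono' (aesm_of_continuousOn hF).restrict
    (ae_restrict_of_ae ?_)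
  filter_upwards [ae_mem_halfSpace a] with p hp using h p hp

/-- The closed ball is taken in all of ℝ⁴, so it meets y = 0; local integrability there already
includes the behaviour at the boundary. -/
lemma integrable_of_vanishing {a : ℝ} {F : ExtHeis → ℝ} (hF : LocallyIntegrable F (wMeas a))
    {R : ℝ} (h : ∀ p ∈ halfSpace, R < ‖p‖ → F p = 0) : Integrable F (wMeas a) := by
  refine IntegrableOn.integrable_of_ae_notMem_eq_zero
    (hF.integrableOn_isCompact (isCompact_closedBall 0 R)) ?_
  filter_upwards [ae_mem_halfSpace a] with p hp hp'
  exact h p hp (by simpa using hp')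

lemma LocBdd.of_bound {g : ExtHeis → ℝ} {M : ℝ} (h : ∀ p ∈ halfSpace, |g p| ≤ M) : LocBdd g :=
  fun _ => ⟨M, fun p hp _ => h p hp⟩

lemma LocBdd.of_continuous {g : ExtHeis → ℝ} (h : Continuous g) : LocBdd g := by
  intro R
  obtain ⟨C, hC⟩ := (isCompact_closedBall (0 : ExtHeis) R).exists_bound_of_continuousOn
    h.continuousOn
  exact ⟨C, fun p _ hp => hC p (by simpa using hp)⟩

lemma LocBdd.mul {g k : ExtHeis → ℝ} (hg : LocBdd g) (hk : LocBdd k) :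
    LocBdd fun p => g p * k p := by
  intro R
  obtain ⟨C, hC⟩ := hg R
  obtain ⟨C', hC'⟩ := hk R
  refine ⟨C * C', fun p hp hpR => ?_⟩
  rw [abs_mul]
  exact mul_le_mul (hC p hp hpR) (hC' p hp hpR) (abs_nonneg _) ((abs_nonneg _).trans (hC p hp hpR))

section
variable {a : ℝ} {g k c : ExtHeis → ℝ}

lemma LocBdd.locallyIntegrable [IsLocallyFiniteMeasure (wMeas a)] (hg : LocBdd g)
    (hc : ContinuousOn g halfSpace) : LocallyIntegrable g (wMeas a) := by
  refine locallyIntegrable_iff.2 fun K hK => ?_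
  obtain ⟨R, hR⟩ := hK.isBounded.exists_norm_le
  obtain ⟨C, hC⟩ := hg R
  refine ((integrableOn_const_iff (C := C)).2 (Or.inr hK.measure_lt_top)).mono'
    (aesm_of_continuousOn hc).restrict ?_
  filter_upwards [ae_restrict_of_ae (ae_mem_halfSpace a), ae_restrict_mem hK.measurableSet]
    with p hp hpK using hC p hp (hR p hpK)

lemma LocBdd.l2loc [IsLocallyFiniteMeasure (wMeas a)] (hg : LocBdd g)
    (hc : ContinuousOn g halfSpace) : L2loc a g :=
  ⟨hc, (by simpa [sq] using (hg.mul hg).locallyIntegrable (hc.mul hc))⟩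

lemma L2loc.mul_locallyIntegrable (hg : L2loc a g) (hk : L2loc a k) :
    LocallyIntegrable (fun p => g p * k p) (wMeas a) :=
  locallyIntegrable_of_le (hg.cont.mul hk.cont) (hg.sq.add hk.sq) fun p _ => by
    simp only [Pi.add_apply, abs_mul]
    nlinarith [sq_nonneg (|g p| - |k p|), sq_abs (g p), sq_abs (k p), abs_nonneg (g p),
      abs_nonneg (k p), mul_nonneg (abs_nonneg (g p)) (abs_nonneg (k p))]

lemma L2loc.add (hg : L2loc a g) (hk : L2loc a k) : L2loc a fun p => g p + k p :=
  ⟨hg.cont.add hk.cont, locallyIntegrable_of_le ((hg.cont.add hk.cont).pow 2)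
    ((hg.sq.add hk.sq).add (hg.sq.add hk.sq)) fun p _ => by
      simp only [Pi.add_apply, abs_of_nonneg (sq_nonneg (g p + k p))]
      nlinarith [sq_nonneg (g p - k p)]⟩

lemma L2loc.sub (hg : L2loc a g) (hk : L2loc a k) : L2loc a fun p => g p - k p :=
  ⟨hg.cont.sub hk.cont, locallyIntegrable_of_le ((hg.cont.sub hk.cont).pow 2)
    ((hg.sq.add hk.sq).add (hg.sq.add hk.sq)) fun p _ => by
      simp only [Pi.add_apply, abs_of_nonneg (sq_nonneg (g p - k p))]
      nlinarith [sq_nonneg (g p + k p)]⟩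

lemma L2loc.mul_locBdd (hg : L2loc a g) (hc : LocBdd c) (hcc : ContinuousOn c halfSpace) :
    L2loc a fun p => g p * c p := by
  refine ⟨hg.cont.mul hcc, locallyIntegrable_iff.2 fun K hK => ?_⟩
  obtain ⟨R, hR⟩ := hK.isBounded.exists_norm_le
  obtain ⟨C, hC⟩ := hc R
  refine ((hg.sq.integrableOn_isCompact hK).const_mul (C ^ 2)).mono'
    (aesm_of_continuousOn ((hg.cont.mul hcc).pow 2)).restrict ?_
  filter_upwards [ae_restrict_of_ae (ae_mem_halfSpace a), ae_restrict_mem hK.measurableSet]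
    with p hp hpK
  have := hC p hp (hR p hpK)
  rw [Real.norm_eq_abs, abs_of_nonneg (sq_nonneg _), mul_pow, mul_comm, ← sq_abs (c p)]
  gcongr

lemma L2loc.mul_continuous (hg : L2loc a g) (hc : Continuous c) : L2loc a fun p => g p * c p :=
  hg.mul_locBdd (LocBdd.of_continuous hc) hc.continuousOn

lemma L2loc.div_const (hg : L2loc a g) (t : ℝ) : L2loc a fun p => g p / t := by
  simpa [div_eq_mul_inv] using hg.mul_continuous (continuous_const (y := t⁻¹))

lemma L2loc.congr (hg : L2loc a g) (h : ∀ p ∈ halfSpace, k p = g p) : L2loc a k := by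
  have hc : ContinuousOn k halfSpace := hg.cont.congr h
  refine ⟨hc, locallyIntegrable_of_le (hc.pow 2) hg.sq fun p hp => ?_⟩
  rw [h p hp, abs_of_nonneg (sq_nonneg _)]

lemma continuousOn_comp_tau (hg : ContinuousOn g halfSpace) (e : Heis) (h : ℝ) :
    ContinuousOn (fun p => g (tau e h p)) halfSpace :=
  hg.comp (contDiff_tau e h (n := 0)).continuous.continuousOn fun _ hp => hp

lemma L2loc.comp_tau (hg : L2loc a g) (e : Heis) (h : ℝ) : L2loc a fun p => g (tau e h p) := by
  refine ⟨continuousOn_comp_tau hg.cont e h, locallyIntegrable_iff.2 fun K hK => ?_⟩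
  have h1 : IntegrableOn (fun p => g p ^ 2) (tau e h '' K) (wMeas a) :=
    hg.sq.integrableOn_isCompact (hK.image (contDiff_tau e h (n := 0)).continuous)
  have h2 := ((measurePreserving_tau a e h).integrableOn_comp_preimage
    (measurableEmbedding_tau e h)).2 h1
  rwa [preimage_image_eq K (measurableEmbedding_tau e h).injective] at h2

end

/-! ### Locally finite energy -/

/-- `C¹` functions on the half-space with locally finite energy up to the boundary. -/
structure Adm (a : ℝ) (v : ExtHeis → ℝ) : Prop where
  smooth : ContDiffOn ℝ 1 v halfSpace
  l2 : L2loc a v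
  grad : ∀ i, L2loc a (D i v)

section
variable {a : ℝ} {v w c : ExtHeis → ℝ}

lemma Adm.diff (hv : Adm a v) {p : ExtHeis} (hp : p ∈ halfSpace) : DifferentiableAt ℝ v p :=
  differentiableAt_of_mem hv.smooth hp

lemma Adm.add (hv : Adm a v) (hw : Adm a w) : Adm a fun p => v p + w p :=
  ⟨hv.smooth.add hw.smooth, hv.l2.add hw.l2, fun i => ((hv.grad i).add (hw.grad i)).congr
    fun _ hp => D_add i (hv.diff hp) (hw.diff hp)⟩

lemma Adm.sub (hv : Adm a v) (hw : Adm a w) : Adm a fun p => v p - w p :=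
  ⟨hv.smooth.sub hw.smooth, hv.l2.sub hw.l2, fun i => ((hv.grad i).sub (hw.grad i)).congr
    fun _ hp => D_sub i (hv.diff hp) (hw.diff hp)⟩

lemma Adm.div_const (hv : Adm a v) (t : ℝ) : Adm a fun p => v p / t :=
  ⟨hv.smooth.div_const t, hv.l2.div_const t, fun i => ((hv.grad i).div_const t).congr
    fun _ hp => D_div_const i (hv.diff hp) t⟩

lemma continuous_D {c : ExtHeis → ℝ} (hc : ContDiff ℝ 1 c) (i : Fin 3) : Continuous (D i c) :=
  (hc.continuous_fderiv one_ne_zero).clm_apply (contDiff_frame i (n := 0)).continuous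

lemma Adm.mul_contDiff (hv : Adm a v) (hc : ContDiff ℝ 1 c) : Adm a fun p => v p * c p :=
  ⟨hv.smooth.mul hc.contDiffOn, hv.l2.mul_continuous hc.continuous, fun i =>
    ((hv.l2.mul_continuous (continuous_D hc i)).add
      ((hv.grad i).mul_continuous hc.continuous)).congr
    fun _ hp => D_mul i (hv.diff hp) (hc.differentiable one_ne_zero _)⟩

lemma Adm.comp_tau (hv : Adm a v) (e : Heis) (h : ℝ) : Adm a fun p => v (tau e h p) :=
  ⟨hv.smooth.comp (contDiff_tau e h).contDiffOn fun _ hp => hp, hv.l2.comp_tau e h, fun i =>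
    ((hv.grad i).comp_tau e h).congr fun _ hp => D_comp_tau e h i (hv.diff (tau_mem.2 hp))⟩

end

/-! ### Test functions and their translates -/

/-- Bounded `C¹` test functions. -/
structure C1Test (a : ℝ) (ξ : ExtHeis → ℝ) : Prop where
  adm : Adm a ξ
  bdd : ∃ M, ∀ p ∈ halfSpace, |ξ p| ≤ M
  vanish : ∃ R > 0, ∀ p ∈ halfSpace, R < ‖p‖ → ξ p = 0

lemma D_eq_zero_of_vanish {ξ : ExtHeis → ℝ} {R : ℝ} (h : ∀ p ∈ halfSpace, R < ‖p‖ → ξ p = 0)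
    (i : Fin 3) : ∀ p ∈ halfSpace, R < ‖p‖ → D i ξ p = 0 := by
  intro p hp hR
  have : ξ =ᶠ[𝓝 p] fun _ => 0 := by
    filter_upwards [isOpen_halfSpace.mem_nhds hp,
      (isOpen_lt continuous_const continuous_norm).mem_nhds hR] with q hq hqR using h q hq hqR
  rw [D_congr i this]
  simp [D]

/-- The norm of the nested product is the maximum of the four coordinates, so the Euclidean norm is
at most 2R; the factor 3 makes the inequality strict. -/
lemma mem_halfBall_of_norm {R : ℝ} (hR : 0 < R) {p : ExtHeis} (hp : p ∈ halfSpace)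
    (h : ‖p‖ ≤ R) : p ∈ halfBall (3 * R) := by
  refine ⟨hp, ?_⟩
  have h1 : |p.1.1| ≤ R := (norm_fst_le p.1).trans ((norm_fst_le p).trans h)
  have h2 : |p.1.2.1| ≤ R := (norm_fst_le p.1.2).trans ((norm_snd_le p.1).trans
    ((norm_fst_le p).trans h))
  have h3 : |p.1.2.2| ≤ R := (norm_snd_le p.1.2).trans ((norm_snd_le p.1).trans
    ((norm_fst_le p).trans h))
  have h4 : |p.2| ≤ R := (norm_snd_le p).trans h
  rw [Real.sqrt_lt' (by positivity)]
  nlinarith [sq_le_sq' (abs_le.1 h1).1 (abs_le.1 h1).2, sq_le_sq' (abs_le.1 h2).1 (abs_le.1 h2).2,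
    sq_le_sq' (abs_le.1 h3).1 (abs_le.1 h3).2, sq_le_sq' (abs_le.1 h4).1 (abs_le.1 h4).2]

lemma measurableSet_halfBall (R : ℝ) : MeasurableSet (halfBall R) := by
  have : IsOpen {p : ExtHeis | √(p.1.1 ^ 2 + p.1.2.1 ^ 2 + p.1.2.2 ^ 2 + p.2 ^ 2) < R} :=
    isOpen_lt (by fun_prop) (by fun_prop)
  exact measurableSet_halfSpace.inter this.measurableSet

lemma locallyIntegrable_of_halfBall {a : ℝ} {F : ExtHeis → ℝ}
    (h : ∀ R > 0, IntegrableOn (fun p => p.2 ^ a * F p) (halfBall R)) :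
    LocallyIntegrable F (wMeas a) := by
  refine locallyIntegrable_iff.2 fun K hK => ?_
  obtain ⟨R, hR⟩ := hK.isBounded.exists_norm_le
  have hpos : 0 < |R| + 1 := by positivity
  have h1 := (integrableOn_wMeas a (measurableSet_halfBall (3 * (|R| + 1))) fun p hp => hp.1).2
    (h (3 * (|R| + 1)) (by positivity))
  have : IntegrableOn F (K ∩ halfSpace) (wMeas a) := h1.mono_set fun p hp =>
    mem_halfBall_of_norm hpos hp.2 ((hR p hp.1).trans (by linarith [le_abs_self R]))
  rw [IntegrableOn, ← wMeas_restrict_halfSpace, Measure.restrict_restrict hK.measurableSet]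
  exact this

section
variable {a : ℝ} {ξ v g ψ : ExtHeis → ℝ}

lemma C1Test.integrable_mul (hξ : C1Test a ξ) (hg : L2loc a g) :
    Integrable (fun p => g p * ξ p) (wMeas a) := by
  obtain ⟨R, -, hR⟩ := hξ.vanish
  exact integrable_of_vanishing (hg.mul_locallyIntegrable hξ.adm.l2)
    (R := R) fun p hp h => by simp [hR p hp h]

lemma C1Test.integrable_mul_D (hξ : C1Test a ξ) (hg : L2loc a g) (i : Fin 3) :
    Integrable (fun p => g p * D i ξ p) (wMeas a) := by
  obtain ⟨R, -, hR⟩ := hξ.vanish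
  exact integrable_of_vanishing (hg.mul_locallyIntegrable (hξ.adm.grad i))
    (R := R) fun p hp h => by simp [D_eq_zero_of_vanish hR i p hp h]

lemma C1Test.integrable_gradInner (hξ : C1Test a ξ) (hv : Adm a v) :
    Integrable (gradInner v ξ) (wMeas a) := by
  have : gradInner v ξ = fun p => ∑ i, D i v p * D i ξ p := funext fun p => gradInner_eq_sum v ξ p
  rw [this]
  exact integrable_finsetSum _ fun i _ => hξ.integrable_mul_D (hv.grad i) i

lemma C1Test.isTestFunction (hξ : C1Test a ξ) : IsTestFunction a ξ := by
  obtain ⟨R, hR0, hR⟩ := hξ.vanish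
  refine ⟨hξ.bdd, ?_, 3 * R, by positivity, ?_, ?_⟩
  · intro p hp
    obtain ⟨K, t, ht, hK⟩ := (hξ.adm.smooth.contDiffAt
      (isOpen_halfSpace.mem_nhds hp)).exists_lipschitzOnWith
    exact ⟨K, t, mem_nhdsWithin_of_mem_nhds ht, hK⟩
  · rintro p ⟨hp, hp'⟩
    refine hR p hp (not_le.1 fun hle => hp' (mem_halfBall_of_norm hR0 hp hle))
  · exact (integrableOn_wMeas a (measurableSet_halfBall _) fun p hp => hp.1).1
      (hξ.integrable_gradInner hξ.adm).integrableOn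

lemma exists_vanish_of_compact (hc : HasCompactSupport ψ) :
    ∃ R > 0, ∀ p, R < ‖p‖ → ψ p = 0 := by
  obtain ⟨R, hR⟩ := (hc : IsCompact _).isBounded.exists_norm_le
  refine ⟨|R| + 1, by positivity, fun p hp => ?_⟩
  by_contra h
  have := hR p (subset_tsupport _ h)
  linarith [le_abs_self R]

lemma Adm.c1Test (hv : Adm a v) (hb : LocBdd v) (hψ : ContDiff ℝ 1 ψ) (hc : HasCompactSupport ψ) :
    C1Test a fun p => v p * ψ p := by
  obtain ⟨R, hR0, hR⟩ := exists_vanish_of_compact hc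
  refine ⟨hv.mul_contDiff hψ, ?_, R, hR0, fun p _ h => by simp [hR p h]⟩
  obtain ⟨C, hC⟩ := (hb.mul (LocBdd.of_continuous hψ.continuous)) R
  refine ⟨|C|, fun p hp => ?_⟩
  rcases le_or_gt ‖p‖ R with h | h
  · exact (hC p hp h).trans (le_abs_self _)
  · simp [hR p h]

/-- The vertical coefficient of the field is at most ‖e‖ + 4‖e‖‖p‖, whence the constant 5. -/
lemma norm_tau_le (e : Heis) (h : ℝ) (p : ExtHeis) :
    ‖tau e h p‖ ≤ ‖p‖ + |h| * (5 * ‖e‖ * (1 + ‖p‖)) := by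
  have h1 : ‖killing e p‖ ≤ 5 * ‖e‖ * (1 + ‖p‖) := by
    have e1 : |e.1| ≤ ‖e‖ := norm_fst_le e
    have e2 : |e.2.1| ≤ ‖e‖ := (norm_fst_le e.2).trans (norm_snd_le e)
    have e3 : |e.2.2| ≤ ‖e‖ := (norm_snd_le e.2).trans (norm_snd_le e)
    have p1 : |p.1.1| ≤ ‖p‖ := (norm_fst_le p.1).trans (norm_fst_le p)
    have p2 : |p.1.2.1| ≤ ‖p‖ := (norm_fst_le p.1.2).trans ((norm_snd_le p.1).trans
      (norm_fst_le p))
    have hn := norm_nonneg p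
    have hn' := norm_nonneg e
    have hb : ‖e‖ ≤ 5 * ‖e‖ * (1 + ‖p‖) := by nlinarith [mul_nonneg hn hn']
    rw [Prod.norm_def, Prod.norm_def, Prod.norm_def]
    refine max_le (max_le (e1.trans hb) (max_le (e2.trans hb) ?_)) (by simp [killing]; positivity)
    simp only [killing, Real.norm_eq_abs]
    have a1 : |e.1 * p.1.2.1| ≤ ‖e‖ * ‖p‖ := by rw [abs_mul]; gcongr
    have a2 : |e.2.1 * p.1.1| ≤ ‖e‖ * ‖p‖ := by rw [abs_mul]; gcongr
    rw [abs_le] at *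
    constructor <;> nlinarith [mul_nonneg hn hn']
  rw [tau_eq]
  refine (norm_add_le _ _).trans ?_
  rw [norm_smul, Real.norm_eq_abs]
  gcongr

lemma C1Test.comp_tau (hξ : C1Test a ξ) (e : Heis) (h : ℝ) : C1Test a fun p => ξ (tau e h p) := by
  obtain ⟨M, hM⟩ := hξ.bdd
  obtain ⟨R, hR0, hR⟩ := hξ.vanish
  refine ⟨hξ.adm.comp_tau e h, ⟨M, fun p hp => hM _ (tau_mem.2 hp)⟩,
    R + |h| * (5 * ‖e‖ * (1 + R)), by positivity, fun p hp hp' => hR _ (tau_mem.2 hp) ?_⟩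
  by_contra hle
  push Not at hle
  -- A point is recovered from its translate by the inverse translation, so if the translate has
  -- norm at most R, the point cannot be far out.
  have := norm_tau_le e (-h) (tau e h p)
  rw [tau_tau, neg_add_cancel, tau_zero, abs_neg] at this
  have h2 : |h| * (5 * ‖e‖ * (1 + ‖tau e h p‖)) ≤ |h| * (5 * ‖e‖ * (1 + R)) := by gcongr
  linarith

lemma LocBdd.comp_tau (hg : LocBdd g) (e : Heis) (h : ℝ) : LocBdd fun p => g (tau e h p) := by
  intro R
  obtain ⟨C, hC⟩ := hg (R + |h| * (5 * ‖e‖ * (1 + R)))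
  refine ⟨C, fun p hp hpR => hC _ (tau_mem.2 hp) ((norm_tau_le e h p).trans ?_)⟩
  gcongr

end

/-! ### Traces -/

lemma wMeasR_Ioc_pos {a δ : ℝ} (ha : -1 < a) (hδ : 0 < δ) :
    0 < (wMeasR a).real (Ioc 0 δ) := by
  have h1 : ∫ _ in Ioc 0 δ, (1 : ℝ) ∂wMeasR a = (wMeasR a).real (Ioc 0 δ) := by simp
  rw [← h1, setIntegral_wMeasR a measurableSet_Ioc fun y hy => hy.1,
    ← intervalIntegral.integral_of_le hδ.le]
  simp only [mul_one]
  rw [integral_rpow (Or.inl ha), Real.zero_rpow (by linarith), sub_zero]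
  have : 0 < a + 1 := by linarith
  positivity

/-! ### One-dimensional estimates with the weight `y ^ a` -/

section oneDim
variable {a : ℝ} {g g' : ℝ → ℝ}

/-- By Young, |g'| ≤ y^a g'² + y^(-a), and y^(-a) is integrable at 0 because a < 1. -/
lemma integrableOn_of_weighted_sq (ha : a < 1) (hc : ContinuousOn g' (Ioi 0))
    (hint : IntegrableOn (fun y => g' y ^ 2) (Ioc 0 1) (wMeasR a)) :
    IntegrableOn g' (Ioc 0 1) := by
  rw [integrableOn_wMeasR a measurableSet_Ioc fun y hy => hy.1] at hint
  have h2 := integrableOn_Ioc_rpow (r := -a) (by linarith) 1 zero_le_one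
  refine (hint.add h2).mono' ((hc.mono fun y hy => hy.1).aestronglyMeasurable measurableSet_Ioc) ?_
  filter_upwards [ae_restrict_mem measurableSet_Ioc] with y hy
  have hy0 : 0 < y := hy.1
  simp only [Pi.add_apply, Real.norm_eq_abs]
  have h3 : 0 < y ^ a := Real.rpow_pos_of_pos hy0 a
  rw [Real.rpow_neg hy0.le, ← sq_abs (g' y)]
  have h4 : y ^ a * (y ^ a)⁻¹ = 1 := mul_inv_cancel₀ h3.ne'
  set t := y ^ a
  set s := t⁻¹
  have h5 : 0 < s := inv_pos.2 h3
  have h6 : t * |g' y| ^ 2 + s - |g' y| = t * (|g' y| - s / 2) ^ 2 + (3 / 4) * s := by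
    have : s = t * s ^ 2 := by rw [sq, ← mul_assoc, h4, one_mul]
    have h7 : t * (|g' y| - s / 2) ^ 2 = t * |g' y| ^ 2 - (t * s) * |g' y| + (t * s ^ 2) / 4 := by
      ring
    rw [h7, h4, ← this]; ring
  nlinarith [mul_nonneg h3.le (sq_nonneg (|g' y| - s / 2))]

/-- An integrable derivative near 0 makes g(1) - ∫_y^1 g' converge as y tends to 0. -/
lemma exists_limit_of_weighted_sq (ha : a < 1) (hd : ∀ y > 0, HasDerivAt g (g' y) y)
    (hc : ContinuousOn g' (Ioi 0))
    (hint : IntegrableOn (fun y => g' y ^ 2) (Ioc 0 1) (wMeasR a)) :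
    ∃ l, Tendsto g (𝓝[>] 0) (𝓝 l) := by
  have h1 := integrableOn_of_weighted_sq ha hc hint
  have h2 : ContinuousOn (fun y => ∫ t in y..1, g' t) (uIcc 0 1) :=
    intervalIntegral.continuousOn_primitive_interval_left (by
      rwa [uIcc_of_le zero_le_one, integrableOn_Icc_iff_integrableOn_Ioc])
  have h3 : Tendsto (fun y => ∫ t in y..1, g' t) (𝓝[>] 0) (𝓝 (∫ t in (0 : ℝ)..1, g' t)) := by
    have := h2 0 (by simp)
    rw [uIcc_of_le zero_le_one] at this
    refine this.tendsto.mono_left ?_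
    rw [← nhdsWithin_Ioc_eq_nhdsGT (zero_lt_one : (0 : ℝ) < 1)]
    exact nhdsWithin_mono _ Ioc_subset_Icc_self
  refine ⟨g 1 - ∫ t in (0 : ℝ)..1, g' t, (tendsto_const_nhds.sub h3).congr' ?_⟩
  filter_upwards [Ioc_mem_nhdsGT (zero_lt_one : (0 : ℝ) < 1)] with y hy
  have hsub : uIcc y 1 ⊆ Ioi 0 := by
    rw [uIcc_of_le hy.2]; exact fun t ht => lt_of_lt_of_le hy.1 ht.1
  rw [intervalIntegral.integral_eq_sub_of_hasDerivAt (fun t ht => hd t (hsub ht))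
    ((hc.mono hsub).intervalIntegrable)]
  ring

/-- Weighted Cauchy–Schwarz, with ∫ y^(-a) over (0, δ] equal to δ^(1-a)/(1-a). The positive power of
δ is the source of the small constant in the trace inequality. -/
lemma sq_integral_le {δ : ℝ} (ha : a < 1) (hδ : 0 < δ) (hδ1 : δ ≤ 1)
    (hc : ContinuousOn g' (Ioi 0))
    (hint : IntegrableOn (fun y => g' y ^ 2) (Ioc 0 1) (wMeasR a)) :
    (∫ y in Ioc 0 δ, |g' y|) ^ 2 ≤
      δ ^ (1 - a) / (1 - a) * ∫ y in Ioc 0 1, g' y ^ 2 ∂wMeasR a := by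
  have hsub : Ioc 0 δ ⊆ Ioc (0 : ℝ) 1 := Ioc_subset_Ioc_right hδ1
  have h1 := (integrableOn_of_weighted_sq ha hc hint).mono_set hsub
  set A := ∫ y in Ioc 0 δ, |g' y| with hA
  set J := δ ^ (1 - a) / (1 - a) with hJ
  have hJpos : 0 < J := by
    have : 0 < 1 - a := by linarith
    positivity
  have hJint : ∫ y in Ioc 0 δ, y ^ (-a) = J := by
    rw [← intervalIntegral.integral_of_le hδ.le, integral_rpow (Or.inl (by linarith)),
      Real.zero_rpow (by linarith), sub_zero, hJ]
    congr 1 <;> [congr 1; skip] <;> ring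
  have hmono : ∫ y in Ioc 0 δ, g' y ^ 2 ∂wMeasR a ≤ ∫ y in Ioc 0 1, g' y ^ 2 ∂wMeasR a :=
    setIntegral_mono_set hint (Eventually.of_forall fun y => sq_nonneg _) hsub.eventuallyLE
  have hint' := (integrableOn_wMeasR a measurableSet_Ioc fun y hy => hy.1).1 (hint.mono_set hsub)
  rw [setIntegral_wMeasR a measurableSet_Ioc fun y hy => hy.1] at hmono
  set I := ∫ y in Ioc 0 1, g' y ^ 2 ∂wMeasR a
  -- This is the optimal parameter in 2t|g'| ≤ y^a g'² + t² y^(-a).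
  set t := A / J with ht
  have key : ∫ y in Ioc 0 δ, 2 * t * |g' y| ≤
      ∫ y in Ioc 0 δ, (y ^ a * g' y ^ 2 + t ^ 2 * y ^ (-a)) := by
    refine setIntegral_mono_on (h1.norm.const_mul _) (hint'.add
      ((integrableOn_Ioc_rpow (by linarith) δ hδ.le).const_mul _)) measurableSet_Ioc fun y hy => ?_
    have h3 : 0 < y ^ a := Real.rpow_pos_of_pos hy.1 a
    rw [Real.rpow_neg hy.1.le, ← sq_abs (g' y)]
    have : y ^ a * |g' y| ^ 2 + t ^ 2 * (y ^ a)⁻¹ - 2 * t * |g' y|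
        = y ^ a * (|g' y| - t * (y ^ a)⁻¹) ^ 2 := by
      field_simp
      ring
    nlinarith [mul_nonneg h3.le (sq_nonneg (|g' y| - t * (y ^ a)⁻¹))]
  rw [integral_const_mul, integral_add hint'
    ((integrableOn_Ioc_rpow (by linarith) δ hδ.le).const_mul _), integral_const_mul, hJint,
    ← hA] at key
  have h5 : A = t * J := by rw [ht]; field_simp
  have h6 : t ^ 2 * J ≤ I := by
    rw [h5] at key
    nlinarith
  rw [h5]
  nlinarith

lemma sq_limit_sub_le {δ l s : ℝ} (ha : a < 1) (hs : 0 < s) (hsδ : s ≤ δ) (hδ1 : δ ≤ 1)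
    (hd : ∀ y > 0, HasDerivAt g (g' y) y) (hc : ContinuousOn g' (Ioi 0))
    (hint : IntegrableOn (fun y => g' y ^ 2) (Ioc 0 1) (wMeasR a))
    (hl : Tendsto g (𝓝[>] 0) (𝓝 l)) :
    (l - g s) ^ 2 ≤ δ ^ (1 - a) / (1 - a) * ∫ y in Ioc 0 1, g' y ^ 2 ∂wMeasR a := by
  have hδ : 0 < δ := hs.trans_le hsδ
  refine le_trans ?_ (sq_integral_le ha hδ hδ1 hc hint)
  have h1 := (integrableOn_of_weighted_sq ha hc hint).mono_set (Ioc_subset_Ioc_right hδ1)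
  have hev : ∀ᶠ y in 𝓝[>] (0 : ℝ), |g y - g s| ≤ ∫ y in Ioc 0 δ, |g' y| := by
    filter_upwards [Ioc_mem_nhdsGT hs] with y hy
    have hsub : uIcc y s ⊆ Ioi 0 := by
      rw [uIcc_of_le hy.2]; exact fun t ht => lt_of_lt_of_le hy.1 ht.1
    rw [abs_sub_comm, ← intervalIntegral.integral_eq_sub_of_hasDerivAt (fun t ht => hd t (hsub ht))
      ((hc.mono hsub).intervalIntegrable)]
    refine (intervalIntegral.abs_integral_le_integral_abs hy.2).trans ?_
    rw [intervalIntegral.integral_of_le hy.2]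
    exact setIntegral_mono_set h1.abs (Eventually.of_forall fun y => abs_nonneg _)
      (Ioc_subset_Ioc hy.1.le hsδ).eventuallyLE
  have hlim : |l - g s| ≤ ∫ y in Ioc 0 δ, |g' y| :=
    le_of_tendsto ((hl.sub_const (g s)).abs) hev
  rw [← sq_abs]
  gcongr

/-- Average l² ≤ 2g(s)² + 2(l - g(s))² over s in (0, δ] against the weighted measure; the second
summand is controlled uniformly by `sq_limit_sub_le`. -/
lemma sq_limit_le {δ l : ℝ} (ha1 : -1 < a) (ha : a < 1) (hδ : 0 < δ) (hδ1 : δ ≤ 1)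
    (hd : ∀ y > 0, HasDerivAt g (g' y) y) (hc : ContinuousOn g' (Ioi 0))
    (hint : IntegrableOn (fun y => g' y ^ 2) (Ioc 0 1) (wMeasR a))
    (hint0 : IntegrableOn (fun y => g y ^ 2) (Ioc 0 1) (wMeasR a))
    (hl : Tendsto g (𝓝[>] 0) (𝓝 l)) :
    l ^ 2 ≤ 2 / (wMeasR a).real (Ioc 0 δ) * (∫ y in Ioc 0 1, g y ^ 2 ∂wMeasR a) +
      2 * (δ ^ (1 - a) / (1 - a)) * ∫ y in Ioc 0 1, g' y ^ 2 ∂wMeasR a := by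
  have hm := wMeasR_Ioc_pos ha1 hδ
  set m := (wMeasR a).real (Ioc 0 δ) with hmdef
  set B := δ ^ (1 - a) / (1 - a) * ∫ y in Ioc 0 1, g' y ^ 2 ∂wMeasR a with hB
  have hsub : Ioc 0 δ ⊆ Ioc (0 : ℝ) 1 := Ioc_subset_Ioc_right hδ1
  have hfin : wMeasR a (Ioc 0 δ) ≠ ⊤ := by
    intro h; simp [hmdef, Measure.real, h] at hm
  have h1 : ∫ _ in Ioc 0 δ, l ^ 2 ∂wMeasR a ≤ ∫ y in Ioc 0 δ, (2 * g y ^ 2 + 2 * B) ∂wMeasR a := by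
    refine setIntegral_mono_on (integrableOn_const hfin) (((hint0.mono_set hsub).const_mul 2).add
      (integrableOn_const hfin)) measurableSet_Ioc fun y hy => ?_
    have := sq_limit_sub_le ha hy.1 hy.2 hδ1 hd hc hint hl
    nlinarith [sq_nonneg (l - 2 * g y)]
  rw [integral_add ((hint0.mono_set hsub).const_mul 2) (integrableOn_const hfin),
    integral_const_mul, setIntegral_const, setIntegral_const, smul_eq_mul, smul_eq_mul,
    ← hmdef] at h1
  have h2 : ∫ y in Ioc 0 δ, g y ^ 2 ∂wMeasR a ≤ ∫ y in Ioc 0 1, g y ^ 2 ∂wMeasR a :=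
    setIntegral_mono_set hint0 (Eventually.of_forall fun y => sq_nonneg _) hsub.eventuallyLE
  rw [mul_assoc, ← hB, div_mul_eq_mul_div, ← sub_le_iff_le_add, le_div_iff₀ hm]
  nlinarith

end oneDim

lemma hasDerivAt_slice {v : ExtHeis → ℝ} (hv : ContDiffOn ℝ 1 v halfSpace) (x : Heis) {y : ℝ}
    (hy : 0 < y) : HasDerivAt (fun y => v (x, y)) (D 2 v (x, y)) y := by
  have h1 : HasDerivAt (fun y : ℝ => ((x, y) : ExtHeis)) (0, 1) y :=
    (hasDerivAt_const y x).prodMk (hasDerivAt_id y)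
  exact (differentiableAt_of_mem hv (p := (x, y)) hy).hasFDerivAt.comp_hasDerivAt y h1

lemma continuousOn_slice {F : ExtHeis → ℝ} (hF : ContinuousOn F halfSpace) (x : Heis) :
    ContinuousOn (fun y => F (x, y)) (Ioi 0) :=
  hF.comp (by fun_prop) fun _ hy => hy

/-- Local integrability gives integrability on balls times [0, 1] only, so Fubini is applied ball by
ball and the exceptional null sets are united. -/
lemma ae_integrableOn_slice {a : ℝ} {F : ExtHeis → ℝ} (hF : LocallyIntegrable F (wMeas a)) :
    ∀ᵐ x : Heis, IntegrableOn (fun y => F (x, y)) (Ioc 0 1) (wMeasR a) := by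
  have h1 : ∀ n : ℕ, ∀ᵐ x : Heis, ‖x‖ ≤ n →
      IntegrableOn (fun y => F (x, y)) (Ioc 0 1) (wMeasR a) := by
    intro n
    have hs : MeasurableSet (Metric.closedBall (0 : Heis) n ×ˢ Icc (0 : ℝ) 1) :=
      Metric.isClosed_closedBall.measurableSet.prod measurableSet_Icc
    have h2 : Integrable ((Metric.closedBall (0 : Heis) n ×ˢ Icc (0 : ℝ) 1).indicator F)
        (wMeas a) := by
      rw [integrable_indicator_iff hs]
      exact hF.integrableOn_isCompact ((isCompact_closedBall _ _).prod isCompact_Icc)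
    filter_upwards [h2.prod_right_ae] with x hx hxn
    have h3 := hx.integrableOn (s := Ioc 0 1)
    refine h3.congr_fun (fun y hy => ?_) measurableSet_Ioc
    simp only
    rw [indicator_of_mem]
    exact ⟨by simpa using hxn, hy.1.le, hy.2⟩
  filter_upwards [ae_all_iff.2 h1] with x hx
  obtain ⟨n, hn⟩ := exists_nat_ge ‖x‖
  exact hx n hn

lemma tendsto_trace {v : ExtHeis → ℝ} {x : Heis} {l : ℝ}
    (h : Tendsto (fun y => v (x, y)) (𝓝[>] 0) (𝓝 l)) : trace v x = l := h.limUnder_eq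

section
variable {a : ℝ} {v w : ExtHeis → ℝ}

/-- Functions of locally finite energy have boundary values. -/
lemma Adm.tendsto (hv : Adm a v) (ha : a < 1) :
    ∀ᵐ x : Heis, Tendsto (fun y => v (x, y)) (𝓝[>] 0) (𝓝 (trace v x)) := by
  filter_upwards [ae_integrableOn_slice (hv.grad 2).sq] with x hx
  obtain ⟨l, hl⟩ := exists_limit_of_weighted_sq ha (fun y hy => hasDerivAt_slice hv.smooth x hy)
    (continuousOn_slice (hv.grad 2).cont x) hx
  rwa [tendsto_trace hl]

lemma Adm.aesm_trace (hv : Adm a v) (ha : a < 1) : AEStronglyMeasurable (trace v) volume := by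
  have h1 : Tendsto (fun n : ℕ => (1 : ℝ) / (n + 1)) atTop (𝓝[>] 0) :=
    tendsto_nhdsWithin_iff.2 ⟨tendsto_one_div_add_atTop_nhds_zero_nat, Eventually.of_forall
      fun n => by simp only [mem_Ioi]; positivity⟩
  refine aestronglyMeasurable_of_tendsto_ae atTop (f := fun (n : ℕ) x => v (x, 1 / (n + 1)))
    (fun n => ?_) ?_
  · refine Continuous.aestronglyMeasurable ?_
    rw [← continuousOn_univ]
    refine hv.smooth.continuousOn.comp (by fun_prop) fun x _ => ?_
    change (0 : ℝ) < 1 / (n + 1)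
    positivity
  · filter_upwards [hv.tendsto ha] with x hx using hx.comp h1

/-- The trace inequality with a small constant in front of the energy. -/
lemma trace_inequality (ha1 : -1 < a) (ha : a < 1) {ε : ℝ} (hε : 0 < ε) :
    ∃ C > 0, ∀ v : ExtHeis → ℝ, Adm a v → Integrable (fun p => v p ^ 2) (wMeas a) →
      Integrable (fun p => D 2 v p ^ 2) (wMeas a) →
      Integrable (fun x => trace v x ^ 2) ∧
      ∫ x, trace v x ^ 2 ≤ ε * ∫ p, D 2 v p ^ 2 ∂wMeas a + C * ∫ p, v p ^ 2 ∂wMeas a := by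
  -- The depth δ of the boundary layer is chosen so that the coefficient of the energy drops below
  -- ε; the price is the factor 2 over the weighted mass of (0, δ] in front of the L² norm.
  obtain ⟨δ, hδ, hδ1, hδε⟩ : ∃ δ > 0, δ ≤ 1 ∧ 2 * (δ ^ (1 - a) / (1 - a)) ≤ ε := by
    have h1 : Tendsto (fun δ : ℝ => 2 * (δ ^ (1 - a) / (1 - a))) (𝓝[>] 0) (𝓝 0) := by
      have h2 : ContinuousAt (fun δ : ℝ => 2 * (δ ^ (1 - a) / (1 - a))) 0 := by
        have := Real.continuousAt_rpow_const 0 (1 - a) (Or.inr (by linarith))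
        fun_prop
      have h3 := h2.tendsto
      simp only [Real.zero_rpow (by linarith : (1 - a) ≠ 0), zero_div, mul_zero] at h3
      exact h3.mono_left nhdsWithin_le_nhds
    obtain ⟨δ, h4, h5⟩ := ((h1.eventually (gt_mem_nhds hε)).and
      (Ioc_mem_nhdsGT (zero_lt_one : (0 : ℝ) < 1))).exists
    exact ⟨δ, h5.1, h5.2, h4.le⟩
  refine ⟨2 / (wMeasR a).real (Ioc 0 δ), div_pos two_pos (wMeasR_Ioc_pos ha1 hδ),
    fun v hv h0 h2 => ?_⟩
  set C := 2 / (wMeasR a).real (Ioc 0 δ) with hC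
  have hC0 : 0 < C := div_pos two_pos (wMeasR_Ioc_pos ha1 hδ)
  have hpt : ∀ᵐ x : Heis, trace v x ^ 2 ≤ C * (∫ y, v (x, y) ^ 2 ∂wMeasR a) +
      ε * ∫ y, D 2 v (x, y) ^ 2 ∂wMeasR a := by
    filter_upwards [hv.tendsto ha, h0.prod_right_ae, h2.prod_right_ae] with x hx hx0 hx2
    refine (sq_limit_le ha1 ha hδ hδ1 (fun y hy => hasDerivAt_slice hv.smooth x hy)
      (continuousOn_slice (hv.grad 2).cont x) hx2.integrableOn hx0.integrableOn hx).trans ?_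
    rw [← hC]
    gcongr ?_ * ?_ + ?_ * ?_
    · exact setIntegral_le_integral hx0 (Eventually.of_forall fun y => sq_nonneg _)
    · exact setIntegral_le_integral hx2 (Eventually.of_forall fun y => sq_nonneg _)
  have hi := (h0.integral_prod_left.const_mul C).add (h2.integral_prod_left.const_mul ε)
  have hint : Integrable (fun x => trace v x ^ 2) := by
    refine hi.mono' ((hv.aesm_trace ha).pow 2) ?_
    filter_upwards [hpt] with x hx
    rw [Real.norm_eq_abs, abs_of_nonneg (sq_nonneg _)]
    exact hx
  refine ⟨hint, (integral_mono_ae hint hi hpt).trans ?_⟩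
  simp only [Pi.add_apply]
  rw [integral_add (h0.integral_prod_left.const_mul C) (h2.integral_prod_left.const_mul ε),
    integral_const_mul, integral_const_mul, wMeas, integral_prod _ h0, integral_prod _ h2, add_comm]

end

/-! ### General facts on integrals -/

/-- Cauchy–Schwarz through the discriminant of the nonnegative quadratic ∫ (tG + K)² in t. -/
lemma sq_integral_mul_le {α : Type*} [MeasurableSpace α] {μ : Measure α} {G K : α → ℝ}
    (hG : Integrable (fun x => G x ^ 2) μ) (hK : Integrable (fun x => K x ^ 2) μ)
    (hGK : Integrable (fun x => G x * K x) μ) :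
    (∫ x, G x * K x ∂μ) ^ 2 ≤ (∫ x, G x ^ 2 ∂μ) * ∫ x, K x ^ 2 ∂μ := by
  have h : ∀ t : ℝ, 0 ≤ (∫ x, G x ^ 2 ∂μ) * (t * t) + (2 * ∫ x, G x * K x ∂μ) * t
      + ∫ x, K x ^ 2 ∂μ := by
    intro t
    have h1 : 0 ≤ ∫ x, ((t * t) * G x ^ 2 + (2 * t) * (G x * K x) + K x ^ 2) ∂μ :=
      integral_nonneg fun x => by
        have : (t * t) * G x ^ 2 + (2 * t) * (G x * K x) + K x ^ 2 = (t * G x + K x) ^ 2 := by ring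
        simp only [this]; positivity
    have i1 : Integrable (fun x => (t * t) * G x ^ 2 + (2 * t) * (G x * K x)) μ :=
      (hG.const_mul _).add (hGK.const_mul _)
    rw [integral_add i1 hK, integral_add (hG.const_mul _) (hGK.const_mul _), integral_const_mul,
      integral_const_mul] at h1
    linarith
  have := discrim_le_zero h
  unfold discrim at this
  nlinarith

lemma tendsto_integral_mul {α : Type*} [MeasurableSpace α] {μ : Measure α} {G : ℕ → α → ℝ}
    {K : α → ℝ} (hG : ∀ n, Integrable (fun x => G n x ^ 2) μ)
    (hK : Integrable (fun x => K x ^ 2) μ) (hGK : ∀ n, Integrable (fun x => G n x * K x) μ)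
    (h : Tendsto (fun n => ∫ x, G n x ^ 2 ∂μ) atTop (𝓝 0)) :
    Tendsto (fun n => ∫ x, G n x * K x ∂μ) atTop (𝓝 0) := by
  have h1 : Tendsto (fun n => (∫ x, G n x * K x ∂μ) ^ 2) atTop (𝓝 0) := by
    refine squeeze_zero (fun n => sq_nonneg _) (fun n => sq_integral_mul_le (hG n) hK (hGK n)) ?_
    simpa using h.mul_const (∫ x, K x ^ 2 ∂μ)
  have h2 := h1.sqrt
  simp only [Real.sqrt_sq_eq_abs, Real.sqrt_zero] at h2
  exact (tendsto_zero_iff_abs_tendsto_zero _).2 h2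

/-- Fatou's lemma: it passes uniform bounds on difference quotients to the derivative. -/
lemma integrable_of_tendsto_of_bound {α : Type*} [MeasurableSpace α] {μ : Measure α}
    {G : ℕ → α → ℝ} {F : α → ℝ} {C : ℝ} (h0 : ∀ n, ∀ᵐ x ∂μ, 0 ≤ G n x)
    (hG : ∀ n, Integrable (G n) μ)
    (hC : ∀ n, ∫ x, G n x ∂μ ≤ C) (h : ∀ᵐ x ∂μ, Tendsto (fun n => G n x) atTop (𝓝 (F x))) :
    Integrable F μ := by
  refine ⟨aestronglyMeasurable_of_tendsto_ae _ (fun n => (hG n).1) h, ?_⟩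
  have h1 : ∫⁻ x, ‖F x‖ₑ ∂μ ≤ liminf (fun n => ∫⁻ x, ‖G n x‖ₑ ∂μ) atTop :=
    lintegral_congr_ae (by filter_upwards [h] with x hx using hx.enorm.liminf_eq) ▸
      lintegral_liminf_le' fun n => (hG n).1.enorm
  refine h1.trans_lt ((liminf_le_of_frequently_le' (x := ENNReal.ofReal C)
    (Frequently.of_forall fun n => ?_)).trans_lt ENNReal.ofReal_lt_top)
  rw [← ofReal_integral_norm_eq_lintegral_enorm (hG n)]
  refine ENNReal.ofReal_le_ofReal (le_trans (le_of_eq (integral_congr_ae ?_)) (hC n))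
  filter_upwards [h0 n] with x hx using abs_of_nonneg hx

/-- No regularity of v is required, since `fderiv` is always measurable. This matters for the length
|∇_ℍ u|φ, which need not be differentiable at its zeros. -/
lemma measurable_dir (v : ExtHeis → ℝ) {V : ExtHeis → ExtHeis} (hV : Measurable V) :
    Measurable fun p => fderiv ℝ v p (V p) := by
  have h : ∀ p, fderiv ℝ v p (V p) = (V p).1.1 * fderiv ℝ v p ((1, 0, 0), 0)
      + (V p).1.2.1 * fderiv ℝ v p ((0, 1, 0), 0) + (V p).1.2.2 * fderiv ℝ v p ((0, 0, 1), 0)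
      + (V p).2 * fderiv ℝ v p ((0, 0, 0), 1) := by
    intro p
    simp only [← smul_eq_mul, ← map_smul, ← map_add]
    congr 1
    ext <;> simp
  simp only [h]
  have hm : ∀ w, Measurable fun p => fderiv ℝ v p w := fun w => measurable_fderiv_apply_const ℝ v w
  have h1 := hm ((1, 0, 0), 0)
  have h2 := hm ((0, 1, 0), 0)
  have h3 := hm ((0, 0, 1), 0)
  have h4 := hm ((0, 0, 0), 1)
  fun_prop

lemma measurable_D (v : ExtHeis → ℝ) (i : Fin 3) : Measurable (D i v) :=
  measurable_dir v (contDiff_frame i (n := 0)).continuous.measurable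

lemma measurable_Z (v : ExtHeis → ℝ) (e : Heis) : Measurable (Z e v) :=
  measurable_dir v (contDiff_killing e (n := 0)).continuous.measurable

/-! ### Difference quotients -/

/-- Difference quotients along right-invariant fields. -/
noncomputable def dq (e : Heis) (h : ℝ) (v : ExtHeis → ℝ) (p : ExtHeis) : ℝ :=
  (v (tau e h p) - v p) / h

/-- The steps of the difference quotients. -/
noncomputable def step (n : ℕ) : ℝ := 1 / (n + 1)

lemma step_pos (n : ℕ) : 0 < step n := by unfold step; positivity

lemma step_le_one (n : ℕ) : step n ≤ 1 := by
  unfold step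
  rw [div_le_one (by positivity)]
  linarith [(Nat.cast_nonneg n : (0 : ℝ) ≤ n)]

lemma tendsto_step : Tendsto step atTop (𝓝 0) := tendsto_one_div_add_atTop_nhds_zero_nat

section
variable {a : ℝ} {v : ExtHeis → ℝ}

lemma Adm.dq (hv : Adm a v) (e : Heis) (h : ℝ) : Adm a (dq e h v) :=
  ((hv.comp_tau e h).sub hv).div_const h

lemma L2loc.dq (hv : L2loc a v) (e : Heis) (h : ℝ) : L2loc a (dq e h v) :=
  ((hv.comp_tau e h).sub hv).div_const h

lemma D_dq (hv : ContDiffOn ℝ 1 v halfSpace) (e : Heis) (h : ℝ) (i : Fin 3) {p : ExtHeis}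
    (hp : p ∈ halfSpace) : D i (dq e h v) p = dq e h (D i v) p := by
  have h1 : DifferentiableAt ℝ v (tau e h p) := differentiableAt_of_mem hv (tau_mem.2 hp)
  have h2 : DifferentiableAt ℝ (fun q => v (tau e h q)) p :=
    h1.comp p ((contDiff_tau e h (n := 1)).differentiable one_ne_zero p)
  have h3 := differentiableAt_of_mem hv hp
  unfold HeisenbergExtension.dq
  have h4 : DifferentiableAt ℝ (fun q => v (tau e h q) - v q) p := h2.sub h3
  rw [D_div_const i h4 h, D_sub i h2 h3, D_comp_tau e h i h1]

lemma continuous_Z_tau (hv : ContinuousOn (Z e v) halfSpace) {p : ExtHeis} (hp : p ∈ halfSpace) :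
    Continuous fun s => Z e v (tau e s p) := by
  rw [← continuousOn_univ]
  refine hv.comp ?_ fun s _ => tau_mem.2 hp
  exact ((continuous_tau_uncurry e).comp (continuous_const.prodMk continuous_id)).continuousOn

lemma dq_eq_integral (hv : ContDiffOn ℝ 1 v halfSpace) (e : Heis) {h : ℝ} {p : ExtHeis}
    (hp : p ∈ halfSpace) : dq e h v p = (∫ s in (0 : ℝ)..h, Z e v (tau e s p)) / h := by
  rw [intervalIntegral.integral_eq_sub_of_hasDerivAt
    (fun s _ => hasDerivAt_tau e (differentiableAt_of_mem hv (tau_mem.2 hp)))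
    ((continuous_Z_tau (continuousOn_Z e hv) hp).intervalIntegrable _ _), tau_zero]
  rfl

lemma tendsto_dq (hv : ContDiffOn ℝ 1 v halfSpace) (e : Heis) {p : ExtHeis}
    (hp : p ∈ halfSpace) : Tendsto (fun n => dq e (step n) v p) atTop (𝓝 (Z e v p)) := by
  have h1 := hasDerivAt_tau e (s := 0) (differentiableAt_of_mem hv (tau_mem (e := e) (h := 0).2 hp))
  rw [hasDerivAt_iff_tendsto_slope_zero, tau_zero] at h1
  have h2 : Tendsto step atTop (𝓝[≠] 0) := tendsto_nhdsWithin_iff.2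
    ⟨tendsto_step, Eventually.of_forall fun n => (step_pos n).ne'⟩
  refine (h1.comp h2).congr fun n => ?_
  simp [dq, div_eq_inv_mul]

/-- Jensen for the average m of Zv along an orbit segment: integrate 2m Zv - m² ≤ (Zv)². -/
lemma sq_dq_le (hv : ContDiffOn ℝ 1 v halfSpace) (e : Heis) {h : ℝ} (hh : 0 < h) {p : ExtHeis}
    (hp : p ∈ halfSpace) :
    dq e h v p ^ 2 ≤ h⁻¹ * ∫ s in (0 : ℝ)..h, Z e v (tau e s p) ^ 2 := by
  have hc := continuous_Z_tau (continuousOn_Z e hv) hp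
  have h0 := dq_eq_integral hv e (h := h) hp
  set m := dq e h v p
  have h1 : ∫ s in (0 : ℝ)..h, (2 * m * Z e v (tau e s p) - m ^ 2) ≤
      ∫ s in (0 : ℝ)..h, Z e v (tau e s p) ^ 2 :=
    intervalIntegral.integral_mono_on hh.le
      (((continuous_const.mul hc).sub continuous_const).intervalIntegrable _ _)
      ((hc.pow 2).intervalIntegrable _ _)
      fun s _ => by nlinarith [sq_nonneg (Z e v (tau e s p) - m)]
  have hc' : Continuous fun s => 2 * m * Z e v (tau e s p) := continuous_const.mul hc
  rw [intervalIntegral.integral_sub (hc'.intervalIntegrable _ _)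
    (continuous_const.intervalIntegrable _ _), intervalIntegral.integral_const_mul,
    intervalIntegral.integral_const, sub_zero, smul_eq_mul] at h1
  have h2 : ∫ s in (0 : ℝ)..h, Z e v (tau e s p) = m * h := by rw [h0]; field_simp
  rw [h2] at h1
  rw [inv_mul_eq_div, le_div_iff₀ hh]
  nlinarith

/-- The `L²` norm of a difference quotient is bounded by that of the derivative. -/
lemma lintegral_dq_le (hv : ContDiffOn ℝ 1 v halfSpace) (e : Heis) {h : ℝ} (hh : 0 < h)
    {S S' : Set ExtHeis} (hS : ∀ s ∈ Ioc 0 h, ∀ p ∈ S, tau e s p ∈ S') :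
    ∫⁻ p in S, ENNReal.ofReal (dq e h v p ^ 2) ∂wMeas a ≤
      ∫⁻ p in S', ENNReal.ofReal (Z e v p ^ 2) ∂wMeas a := by
  have hmeas : Measurable fun q : ExtHeis × ℝ => ENNReal.ofReal (Z e v (tau e q.2 q.1) ^ 2) :=
    (((measurable_Z v e).comp (continuous_tau_uncurry e).measurable).pow_const 2).ennreal_ofReal
  have h1 : ∀ᵐ p ∂(wMeas a).restrict S, ENNReal.ofReal (dq e h v p ^ 2) ≤
      ENNReal.ofReal h⁻¹ * ∫⁻ s in Ioc 0 h, ENNReal.ofReal (Z e v (tau e s p) ^ 2) := by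
    filter_upwards [ae_restrict_of_ae (ae_mem_halfSpace a)] with p hp
    have hc : Continuous fun s => Z e v (tau e s p) ^ 2 :=
      (continuous_Z_tau (continuousOn_Z e hv) hp).pow 2
    rw [← ofReal_integral_eq_lintegral_ofReal (hc.integrableOn_Icc.mono_set Ioc_subset_Icc_self)
      (Eventually.of_forall fun s => sq_nonneg _), ← ENNReal.ofReal_mul (by positivity),
      ← intervalIntegral.integral_of_le hh.le]
    exact ENNReal.ofReal_le_ofReal (sq_dq_le hv e hh hp)
  refine (lintegral_mono_ae h1).trans ?_
  have : SigmaFinite (wMeas a) := by unfold wMeas; infer_instance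
  rw [lintegral_const_mul _ hmeas.lintegral_prod_right',
    lintegral_lintegral_swap hmeas.aemeasurable]
  -- After Fubini, invariance of the measure bounds the contribution of each time s by the integral
  -- over S'. The average over s then costs nothing.
  have h2 : ∀ s ∈ Ioc 0 h, ∫⁻ p in S, ENNReal.ofReal (Z e v (tau e s p) ^ 2) ∂wMeas a ≤
      ∫⁻ p in S', ENNReal.ofReal (Z e v p ^ 2) ∂wMeas a := by
    intro s hs
    rw [← (measurePreserving_tau a e s).setLIntegral_comp_preimage_emb
      (measurableEmbedding_tau e s) (fun p => ENNReal.ofReal (Z e v p ^ 2)) S']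
    exact lintegral_mono_set fun p hp => hS s hs p hp
  refine (mul_le_mul_right (setLIntegral_mono_ae measurable_const.aemeasurable
    (Eventually.of_forall h2)) _).trans ?_
  rw [setLIntegral_const, Real.volume_Ioc, sub_zero, mul_comm _ (ENNReal.ofReal h), ← mul_assoc,
    ← ENNReal.ofReal_mul (by positivity), inv_mul_cancel₀ hh.ne', ENNReal.ofReal_one, one_mul]

/-- Enlarged radii, which absorb translations by steps at most one. -/
noncomputable def bigR (e : Heis) (R : ℝ) : ℝ := R + 5 * ‖e‖ * (1 + R)

lemma norm_tau_le_bigR {e : Heis} {R h : ℝ} (hh : 0 ≤ h) (hh1 : h ≤ 1) {p : ExtHeis}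
    (hp : ‖p‖ ≤ R) : ‖tau e h p‖ ≤ bigR e R := by
  refine (norm_tau_le e h p).trans ?_
  rw [abs_of_nonneg hh]
  unfold bigR
  have : h * (5 * ‖e‖ * (1 + ‖p‖)) ≤ 1 * (5 * ‖e‖ * (1 + R)) := by gcongr
  linarith

lemma integrableOn_sq (hv : L2loc a v) (S : Set ExtHeis) (R : ℝ) (hS : ∀ p ∈ S, ‖p‖ ≤ R) :
    IntegrableOn (fun p => v p ^ 2) S (wMeas a) :=
  (hv.sq.integrableOn_isCompact (isCompact_closedBall 0 R)).mono_set fun p hp => by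
    simpa using hS p hp

/-- Translations fix y, so the boundary layer y < δ is not thickened. This uniformity in the step
gives smallness near y = 0. -/
lemma setIntegral_dq_le (hv : ContDiffOn ℝ 1 v halfSpace) (hv2 : L2loc a v) (e : Heis)
    (hZ : L2loc a (Z e v)) {h : ℝ} (hh : 0 < h) (hh1 : h ≤ 1) (R δ : ℝ) :
    ∫ p in {p | ‖p‖ ≤ R ∧ p.2 < δ}, dq e h v p ^ 2 ∂wMeas a ≤
      ∫ p in {p | ‖p‖ ≤ bigR e R ∧ p.2 < δ}, Z e v p ^ 2 ∂wMeas a := by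
  have h1 := lintegral_dq_le (a := a) hv e hh (S := {p | ‖p‖ ≤ R ∧ p.2 < δ})
    (S' := {p | ‖p‖ ≤ bigR e R ∧ p.2 < δ})
    fun s hs p hp => ⟨norm_tau_le_bigR hs.1.le (hs.2.trans hh1) hp.1, hp.2⟩
  rw [← ofReal_integral_eq_lintegral_ofReal (integrableOn_sq (hv2.dq e h) _ R fun p hp => hp.1)
    (Eventually.of_forall fun s => sq_nonneg _),
    ← ofReal_integral_eq_lintegral_ofReal (integrableOn_sq hZ _ (bigR e R) fun p hp => hp.1)
    (Eventually.of_forall fun s => sq_nonneg _)] at h1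
  exact (ENNReal.ofReal_le_ofReal_iff (integral_nonneg fun p => sq_nonneg _)).1 h1

lemma measurableSet_slab (R δ : ℝ) : MeasurableSet {p : ExtHeis | ‖p‖ ≤ R ∧ p.2 < δ} := by
  refine MeasurableSet.inter (isClosed_le continuous_norm continuous_const).measurableSet
    (isOpen_lt continuous_snd continuous_const).measurableSet

lemma tendsto_slab {F : ExtHeis → ℝ} (R : ℝ)
    (hF : IntegrableOn F {p | ‖p‖ ≤ R} (wMeas a)) :
    Tendsto (fun n => ∫ p in {p | ‖p‖ ≤ R ∧ p.2 < step n}, F p ∂wMeas a) atTop (𝓝 0) := by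
  have hanti : Antitone fun n => {p : ExtHeis | ‖p‖ ≤ R ∧ p.2 < step n} := by
    intro n m hnm p hp
    refine ⟨hp.1, hp.2.trans_le ?_⟩
    unfold step
    have : (n : ℝ) ≤ m := by exact_mod_cast hnm
    gcongr
  have h1 := tendsto_setIntegral_of_antitone (μ := wMeas a) (f := F)
    (fun n => measurableSet_slab R (step n)) hanti ⟨0, hF.mono_set fun p hp => hp.1⟩
  have h2 : wMeas a (⋂ n, {p : ExtHeis | ‖p‖ ≤ R ∧ p.2 < step n}) = 0 := by
    refine measure_mono_null (t := halfSpaceᶜ) (fun p hp hp' => ?_) (ae_mem_halfSpace a)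
    have h3 : ∀ n, p.2 ≤ step n := fun n => (mem_iInter.1 hp n).2.le
    have h4 : p.2 ≤ 0 := ge_of_tendsto' tendsto_step h3
    exact absurd hp' (not_lt.2 h4)
  rwa [setIntegral_measure_zero _ h2] at h1

lemma abs_dq_le (hv : ContDiffOn ℝ 1 v halfSpace) (e : Heis) {h : ℝ} (hh : 0 < h)
    {p : ExtHeis} (hp : p ∈ halfSpace) {C : ℝ}
    (hC : ∀ s ∈ Icc 0 h, |Z e v (tau e s p)| ≤ C) : |dq e h v p| ≤ C := by
  rw [dq_eq_integral hv e hp, abs_div, abs_of_pos hh, div_le_iff₀ hh]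
  have := intervalIntegral.norm_integral_le_of_norm_le_const (a := 0) (b := h) (C := C)
    (f := fun s => Z e v (tau e s p)) fun s hs => hC s (by
      rw [uIoc_of_le hh.le] at hs; exact ⟨hs.1.le, hs.2⟩)
  simpa [abs_of_pos hh] using this

/-- Difference quotients converge to the derivative in `L²` up to the boundary. -/
lemma tendsto_setIntegral_dq [IsLocallyFiniteMeasure (wMeas a)] (hv : ContDiffOn ℝ 1 v halfSpace)
    (hv2 : L2loc a v) (e : Heis) (hZ : L2loc a (Z e v)) (R : ℝ) :
    Tendsto (fun n => ∫ p in {p | ‖p‖ ≤ R}, (dq e (step n) v p - Z e v p) ^ 2 ∂wMeas a)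
      atTop (𝓝 0) := by
  have hG : ∀ n, L2loc a fun p => dq e (step n) v p - Z e v p := fun n => (hv2.dq e _).sub hZ
  set B : Set ExtHeis := {p | ‖p‖ ≤ R} with hB
  have hBm : MeasurableSet B := (isClosed_le continuous_norm continuous_const).measurableSet
  have hBfin : wMeas a B < ⊤ := by
    have : B = Metric.closedBall 0 R := by ext; simp [hB]
    rw [this]; exact (isCompact_closedBall 0 R).measure_lt_top
  rw [Metric.tendsto_atTop]
  intro ε hε
  -- near the boundary
  have hk1 := tendsto_slab (bigR e R) (integrableOn_sq hZ {p | ‖p‖ ≤ bigR e R} _ fun p hp => hp)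
  have hk2 := tendsto_slab R (integrableOn_sq hZ {p | ‖p‖ ≤ R} _ fun p hp => hp)
  have hk := (hk1.const_mul 2).add (hk2.const_mul 2)
  simp only [mul_zero, add_zero] at hk
  obtain ⟨k, hk⟩ := (hk.eventually (gt_mem_nhds (half_pos hε))).exists
  set δ := step k with hδ
  have hnear : ∀ n, ∫ p in {p | ‖p‖ ≤ R ∧ p.2 < δ}, (dq e (step n) v p - Z e v p) ^ 2 ∂wMeas a
      < ε / 2 := by
    intro n
    have i1 := integrableOn_sq (hv2.dq e (step n)) {p | ‖p‖ ≤ R ∧ p.2 < δ} R fun p hp => hp.1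
    have i2 := integrableOn_sq hZ {p | ‖p‖ ≤ R ∧ p.2 < δ} R fun p hp => hp.1
    have h1 : ∫ p in {p | ‖p‖ ≤ R ∧ p.2 < δ}, (dq e (step n) v p - Z e v p) ^ 2 ∂wMeas a ≤
        ∫ p in {p | ‖p‖ ≤ R ∧ p.2 < δ}, (2 * dq e (step n) v p ^ 2 + 2 * Z e v p ^ 2)
          ∂wMeas a := by
      refine integral_mono (integrableOn_sq (hG n) _ R fun p hp => hp.1)
        ((i1.const_mul 2).add (i2.const_mul 2)) fun p => ?_
      simp only
      nlinarith [sq_nonneg (dq e (step n) v p + Z e v p)]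
    rw [integral_add (i1.const_mul 2) (i2.const_mul 2), integral_const_mul, integral_const_mul] at h1
    have h2 := setIntegral_dq_le hv hv2 e hZ (step_pos n) (step_le_one n) R δ
    linarith
  -- away from the boundary
  have hfar : Tendsto (fun n => ∫ p in B \ {p | ‖p‖ ≤ R ∧ p.2 < δ},
      (dq e (step n) v p - Z e v p) ^ 2 ∂wMeas a) atTop (𝓝 0) := by
    -- This compact set stays away from y = 0 and contains every orbit segment of length at most one
    -- starting in the region. The bound C of Zv on it dominates the quotients as well.
    set K : Set ExtHeis := Metric.closedBall 0 (max R (bigR e R)) ∩ {p | δ ≤ p.2} with hK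
    have hKc : IsCompact K := (isCompact_closedBall _ _).inter_right
      (isClosed_le continuous_const continuous_snd)
    have hKsub : K ⊆ halfSpace := fun p hp => (step_pos k).trans_le hp.2
    obtain ⟨C, hC⟩ := hKc.exists_bound_of_continuousOn (hZ.cont.mono hKsub)
    have hms : MeasurableSet (B \ {p | ‖p‖ ≤ R ∧ p.2 < δ}) :=
      hBm.diff (measurableSet_slab R δ)
    have h0 : (0 : ℝ) = ∫ p in B \ {p | ‖p‖ ≤ R ∧ p.2 < δ}, (0 : ℝ) ∂wMeas a := by simp
    rw [h0]
    refine tendsto_integral_of_dominated_convergence (fun _ => (2 * C) ^ 2)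
      (fun n => (aesm_of_continuousOn ((hG n).cont.pow 2)).restrict) ?_ ?_ ?_
    · exact integrableOn_const ((measure_mono sdiff_subset).trans_lt hBfin).ne
    · intro n
      filter_upwards [ae_restrict_mem hms] with p hp
      have hpδ : δ ≤ p.2 := not_lt.1 fun hlt => hp.2 ⟨hp.1, hlt⟩
      have hp0 : p ∈ halfSpace := (step_pos k).trans_le hpδ
      have hpK : p ∈ K := ⟨by simpa using Or.inl (show ‖p‖ ≤ R from hp.1), hpδ⟩
      have h1 : |dq e (step n) v p| ≤ C := abs_dq_le hv e (step_pos n) hp0 fun s hs =>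
        hC _ ⟨by simpa using Or.inr (norm_tau_le_bigR hs.1 (hs.2.trans (step_le_one n)) hp.1), hpδ⟩
      have h2 : |Z e v p| ≤ C := hC p hpK
      rw [Real.norm_eq_abs, abs_of_nonneg (sq_nonneg _), ← sq_abs (_ - _)]
      have := (abs_sub (dq e (step n) v p) (Z e v p)).trans (add_le_add h1 h2)
      gcongr
      linarith
    · filter_upwards [ae_restrict_mem hms] with p hp
      have hpδ : δ ≤ p.2 := not_lt.1 fun hlt => hp.2 ⟨hp.1, hlt⟩
      have := ((tendsto_dq hv e (p := p) ((step_pos k).trans_le hpδ)).sub_const (Z e v p)).pow 2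
      simpa using this
  obtain ⟨N, hN⟩ := eventually_atTop.1 (hfar.eventually (gt_mem_nhds (half_pos hε)))
  refine ⟨N, fun n hn => ?_⟩
  rw [Real.dist_eq, sub_zero, abs_of_nonneg (integral_nonneg fun p => sq_nonneg _)]
  have hsub : {p : ExtHeis | ‖p‖ ≤ R ∧ p.2 < δ} ⊆ B := fun p hp => hp.1
  rw [← integral_inter_add_sdiff (t := {p : ExtHeis | ‖p‖ ≤ R ∧ p.2 < δ}) (measurableSet_slab R δ)
    (integrableOn_sq (hG n) B R fun p hp => hp), inter_eq_self_of_subset_right hsub]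
  linarith [hN n hn, hnear n]

end

/-! ### Calculus of traces -/

section
variable {a : ℝ} {v ξ ψ : ExtHeis → ℝ}

lemma Adm.abs_trace_le (hv : Adm a v) (ha : a < 1) {M : ℝ} (hM : ∀ p ∈ halfSpace, |v p| ≤ M) :
    ∀ᵐ x : Heis, |trace v x| ≤ M := by
  filter_upwards [hv.tendsto ha] with x hx
  refine le_of_tendsto hx.abs ?_
  filter_upwards [self_mem_nhdsWithin] with y hy using hM _ hy

lemma Adm.trace_eq_zero (hv : Adm a v) (ha : a < 1) {R : ℝ}
    (hR : ∀ p ∈ halfSpace, R < ‖p‖ → v p = 0) : ∀ᵐ x : Heis, R < ‖x‖ → trace v x = 0 := by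
  filter_upwards [hv.tendsto ha] with x hx hxR
  refine tendsto_nhds_unique hx (tendsto_const_nhds.congr' ?_)
  filter_upwards [self_mem_nhdsWithin] with y hy
  exact (hR _ hy (hxR.trans_le (norm_fst_le (x, y)))).symm

lemma Adm.trace_mul (hv : Adm a v) (ha : a < 1) (hψ : Continuous ψ) :
    ∀ᵐ x : Heis, trace (fun p => v p * ψ p) x = trace v x * ψ (x, 0) := by
  filter_upwards [hv.tendsto ha] with x hx
  refine tendsto_trace (hx.mul ?_)
  have h1 : Continuous fun y : ℝ => ψ (x, y) := hψ.comp (by fun_prop)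
  exact (h1.tendsto 0).mono_left nhdsWithin_le_nhds

lemma Adm.trace_dq (hv : Adm a v) (ha : a < 1) (e : Heis) (h : ℝ) :
    ∀ᵐ x : Heis, trace (HeisenbergExtension.dq e h v) x = (trace v (tauH e h x) - trace v x) / h := by
  filter_upwards [hv.tendsto ha, (hv.comp_tau e h).tendsto ha] with x hx hx'
  exact tendsto_trace ((hx'.sub hx).div_const h)

lemma C1Test.integrable_mul_trace (hξ : C1Test a ξ) (ha : a < 1) {g : Heis → ℝ}
    (hg : AEStronglyMeasurable g volume) {B : ℝ} (hB : ∀ᵐ x, |g x| ≤ B) :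
    Integrable fun x => g x * trace ξ x := by
  obtain ⟨M, hM⟩ := hξ.bdd
  obtain ⟨R, -, hR⟩ := hξ.vanish
  have h1 : IntegrableOn (fun x => g x * trace ξ x) (Metric.closedBall 0 R) := by
    refine (integrableOn_const (C := B * M) (isCompact_closedBall (0 : Heis) R).measure_lt_top.ne).mono'
      (hg.mul (hξ.adm.aesm_trace ha)).restrict (ae_restrict_of_ae ?_)
    filter_upwards [hB, hξ.adm.abs_trace_le ha hM] with x h1 h2
    rw [Real.norm_eq_abs, abs_mul]
    exact mul_le_mul h1 h2 (abs_nonneg _) ((abs_nonneg _).trans h1)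
  refine h1.integrable_of_ae_notMem_eq_zero ?_
  filter_upwards [hξ.adm.trace_eq_zero ha hR] with x hx hxR
  rw [hx (by simpa using hxR), mul_zero]

end

/-! ### The equation for difference quotients -/

section
variable {a M K : ℝ} {f : ℝ → ℝ} {u ξ : ExtHeis → ℝ}

lemma weak_adm [IsLocallyFiniteMeasure (wMeas a)] (hu : ContDiffOn ℝ 2 u halfSpace)
    (hM : ∀ p ∈ halfSpace, |u p| ≤ M) (hweak : IsWeakSolution a f u) : Adm a u := by
  have hu1 : ContDiffOn ℝ 1 u halfSpace := hu.of_le (by norm_num)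
  refine ⟨hu1, (LocBdd.of_bound hM).l2loc hu.continuousOn, fun i => ⟨continuousOn_D i hu1, ?_⟩⟩
  refine locallyIntegrable_of_le ((continuousOn_D i hu1).pow 2)
    (locallyIntegrable_of_halfBall hweak.finiteEnergy) fun p _ => ?_
  rw [abs_of_nonneg (sq_nonneg _), gradSq, gradInner_eq_sum, sq]
  exact Finset.single_le_sum (f := fun i => D i u p * D i u p)
    (fun j _ => mul_self_nonneg _) (Finset.mem_univ i)

lemma weak_eq (hweak : IsWeakSolution a f u) (hξ : C1Test a ξ) :
    ∫ p, gradInner u ξ p ∂wMeas a = ∫ x, f (trace u x) * trace ξ x := by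
  rw [integral_wMeas]; exact hweak.weakEquation ξ hξ.isTestFunction

lemma aesm_comp_trace (ha : a < 1) (hu : Adm a u) (hf : Continuous f) :
    AEStronglyMeasurable (fun x => f (trace u x)) volume :=
  hf.comp_aestronglyMeasurable (hu.aesm_trace ha)

lemma ae_tauH {P : Heis → Prop} (h : ∀ᵐ x, P x) (e : Heis) (t : ℝ) : ∀ᵐ x, P (tauH e t x) :=
  (measurePreserving_tauH e t).quasiMeasurePreserving.ae h

/-- Test the equation with the translate of ξ by -h and change variables. Invariance of measure and
frame turns this into the equation of the translate of u; subtract and divide by h. -/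
lemma weak_eq_dq (ha : a < 1) (hu : Adm a u) (hM : ∀ p ∈ halfSpace, |u p| ≤ M)
    (hf : Continuous f) (hweak : IsWeakSolution a f u) (hξ : C1Test a ξ) (e : Heis) (h : ℝ) :
    ∫ p, gradInner (dq e h u) ξ p ∂wMeas a =
      ∫ x, (f (trace u (tauH e h x)) - f (trace u x)) / h * trace ξ x := by
  obtain ⟨B, hB⟩ := (isCompact_Icc (a := -M) (b := M)).exists_bound_of_continuousOn hf.continuousOn
  have hfB : ∀ᵐ x : Heis, |f (trace u x)| ≤ B := by
    filter_upwards [hu.abs_trace_le ha hM] with x hx using hB _ (abs_le.1 hx)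
  have hm := aesm_comp_trace ha hu hf
  have hm' : AEStronglyMeasurable (fun x => f (trace u (tauH e h x))) volume :=
    hm.comp_measurePreserving (measurePreserving_tauH e h)
  have i1 := hξ.integrable_mul_trace ha hm hfB
  have i2 := hξ.integrable_mul_trace ha hm' (ae_tauH hfB e h)
  have h1 : ∫ p, gradInner (fun q => u (tau e h q)) ξ p ∂wMeas a =
      ∫ x, f (trace u (tauH e h x)) * trace ξ x := by
    have h2 := weak_eq hweak (hξ.comp_tau e (-h))
    rw [← integral_comp_tau a e h, ← integral_comp_tauH e h] at h2
    refine Eq.trans (integral_congr_ae ?_) (h2.trans (integral_congr_ae ?_))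
    · filter_upwards [ae_mem_halfSpace a] with p hp
      simp only [gradInner_eq_sum]
      refine Finset.sum_congr rfl fun i _ => ?_
      have h3 : DifferentiableAt ℝ ξ (tau e (-h) (tau e h p)) := hξ.adm.diff hp
      rw [D_comp_tau e h i (hu.diff (tau_mem.2 hp)), D_comp_tau e (-h) i h3, tau_tau,
        neg_add_cancel, tau_zero]
    · refine Eventually.of_forall fun x => ?_
      change _ * trace ξ (tauH e (-h) (tauH e h x)) = _
      rw [tauH_tauH, neg_add_cancel, tauH_zero]
  have h4 : ∫ p, gradInner (dq e h u) ξ p ∂wMeas a = ∫ p, (gradInner (fun q => u (tau e h q)) ξ p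
      - gradInner u ξ p) / h ∂wMeas a := by
    refine integral_congr_ae ?_
    filter_upwards [ae_mem_halfSpace a] with p hp
    simp only [gradInner_eq_sum]
    rw [← Finset.sum_sub_distrib, Finset.sum_div]
    refine Finset.sum_congr rfl fun i _ => ?_
    rw [D_dq hu.smooth e h i hp, dq, D_comp_tau e h i (hu.diff (tau_mem.2 hp))]
    ring
  rw [h4, integral_div, integral_sub (hξ.integrable_gradInner (hu.comp_tau e h))
    (hξ.integrable_gradInner hu), h1, weak_eq hweak hξ, ← integral_sub i2 i1, ← integral_div]
  refine integral_congr_ae (Eventually.of_forall fun x => ?_)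
  simp only; ring

/-! ### Caccioppoli's inequality for difference quotients -/

/-- Weak solutions of equations with a linear boundary term bounded by `K`. -/
def SubLinear (a K : ℝ) (w : ExtHeis → ℝ) : Prop :=
  ∀ η, ContDiff ℝ 1 η → HasCompactSupport η →
    ∫ p, gradInner w (fun q => w q * (η q * η q)) p ∂wMeas a ≤
      K * ∫ x, trace (fun q => w q * η q) x ^ 2

lemma LocBdd.dq (hg : LocBdd u) (e : Heis) (h : ℝ) : LocBdd (dq e h u) := by
  intro R
  obtain ⟨C, hC⟩ := (hg.comp_tau e h) R
  obtain ⟨C', hC'⟩ := hg R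
  refine ⟨(C + C') / |h|, fun p hp hpR => ?_⟩
  rw [HeisenbergExtension.dq, abs_div]
  gcongr
  exact (abs_sub _ _).trans (add_le_add (hC p hp hpR) (hC' p hp hpR))

/-- The test function is wη² with w the quotient itself. The Lipschitz bound of f on the range of u
makes the boundary integrand at most K w²η². -/
lemma dq_subLinear (ha : a < 1) (hu : Adm a u) (hM : ∀ p ∈ halfSpace, |u p| ≤ M)
    (hf : Continuous f) (hK : ∀ s ∈ Icc (-M) M, ∀ t ∈ Icc (-M) M, |f s - f t| ≤ K * |s - t|)
    (hweak : IsWeakSolution a f u) (e : Heis) {h : ℝ} (hh : 0 < h) :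
    SubLinear a K (dq e h u) := by
  intro η hη hηc
  have hw := hu.dq e h
  have hb : LocBdd (dq e h u) := (LocBdd.of_bound hM).dq e h
  have hηη : HasCompactSupport fun q => η q * η q := hηc.mul_left
  have hξ := hw.c1Test hb (hη.mul hη) hηη
  have hξ' := hw.c1Test hb hη hηc
  obtain ⟨B, hB⟩ := hξ'.bdd
  have htr := hξ'.adm.abs_trace_le ha hB
  have hint : Integrable fun x => K * trace (fun q => dq e h u q * η q) x ^ 2 := by
    simp only [sq]
    exact (hξ'.integrable_mul_trace ha (hξ'.adm.aesm_trace ha) htr).const_mul K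
  rw [weak_eq_dq ha hu hM hf hweak hξ e h, ← integral_const_mul]
  have hpt : ∀ᵐ x : Heis, |(f (trace u (tauH e h x)) - f (trace u x)) / h *
      trace (fun q => dq e h u q * (η q * η q)) x| ≤
        K * trace (fun q => dq e h u q * η q) x ^ 2 := by
    filter_upwards [hw.trace_mul ha hη.continuous, hw.trace_mul ha (hη.mul hη).continuous,
      hu.trace_dq ha e h, hu.abs_trace_le ha hM, ae_tauH (hu.abs_trace_le ha hM) e h]
      with x h1 h2 h3 h4 h5
    rw [h1, h2, mul_pow, abs_mul, abs_div]
    have h6 := hK _ (abs_le.1 h5) _ (abs_le.1 h4)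
    have h7 : |f (trace u (tauH e h x)) - f (trace u x)| / |h| ≤ K * |trace (dq e h u) x| := by
      rw [h3, abs_div, ← mul_div_assoc]
      gcongr
    calc _ ≤ K * |trace (dq e h u) x| * |trace (dq e h u) x * (η (x, 0) * η (x, 0))| := by gcongr
      _ = K * (trace (dq e h u) x ^ 2 * η (x, 0) ^ 2) := by
        rw [abs_mul, ← sq, abs_of_nonneg (sq_nonneg (η (x, 0))), ← sq_abs (trace _ _)]; ring
  refine integral_mono_ae (hint.mono' ?_ hpt) hint ?_
  · simp only [div_eq_mul_inv]
    exact ((((aesm_comp_trace ha hu hf).comp_measurePreserving (measurePreserving_tauH e h)).sub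
      (aesm_comp_trace ha hu hf)).mul_const _).mul (hξ.adm.aesm_trace ha)
  · filter_upwards [hpt] with x hx using (le_abs_self _).trans hx

lemma gradSq_eq (w : ExtHeis → ℝ) (p : ExtHeis) : gradSq w p = ∑ i, D i w p ^ 2 := by
  simp [gradSq, gradInner_eq_sum, sq]

lemma gradSq_nonneg (w : ExtHeis → ℝ) (p : ExtHeis) : 0 ≤ gradSq w p := by
  rw [gradSq_eq]; positivity

lemma sq_D_le_gradSq (w : ExtHeis → ℝ) (i : Fin 3) (p : ExtHeis) : D i w p ^ 2 ≤ gradSq w p := by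
  rw [gradSq_eq]
  exact Finset.single_le_sum (f := fun i => D i w p ^ 2) (fun j _ => sq_nonneg _)
    (Finset.mem_univ i)

lemma sq_gradInner_le (w k : ExtHeis → ℝ) (p : ExtHeis) :
    gradInner w k p ^ 2 ≤ gradSq w p * gradSq k p := by
  rw [gradSq_eq, gradSq_eq, gradInner_eq_sum]
  exact Finset.sum_mul_sq_le_sq_mul_sq _ _ _

lemma Adm.locallyIntegrable_gradSq {w : ExtHeis → ℝ} (hw : Adm a w) :
    LocallyIntegrable (gradSq w) (wMeas a) := by
  have : gradSq w = fun p => ∑ i, D i w p ^ 2 := funext fun p => gradSq_eq w p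
  rw [this]
  exact locallyIntegrable_finsetSum _ fun i _ => (hw.grad i).sq

lemma integrable_mul_cutoff {F ψ : ExtHeis → ℝ} (hF : LocallyIntegrable F (wMeas a))
    (hψ : Continuous ψ) (hc : HasCompactSupport ψ) :
    Integrable (fun p => F p * ψ p) (wMeas a) :=
  hF.integrable_smul_right_of_hasCompactSupport hψ hc

lemma continuous_gradSq {η : ExtHeis → ℝ} (hη : ContDiff ℝ 1 η) : Continuous (gradSq η) := by
  have : gradSq η = fun p => ∑ i, D i η p ^ 2 := funext fun p => gradSq_eq η p
  rw [this]
  exact continuous_finsetSum _ fun i _ => (continuous_D hη i).pow 2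

lemma D_eq_zero_of_compact {η : ExtHeis → ℝ} (i : Fin 3) {p : ExtHeis} (hp : p ∉ tsupport η) :
    D i η p = 0 := by
  rw [D_congr i (notMem_tsupport_iff_eventuallyEq.1 hp)]
  simp [D]

lemma compact_gradSq {η : ExtHeis → ℝ} (hc : HasCompactSupport η) :
    HasCompactSupport (gradSq η) :=
  HasCompactSupport.intro (hc : IsCompact _) fun p hp => by
    simp [gradSq_eq, D_eq_zero_of_compact _ hp]

/-- Caccioppoli's inequality up to the boundary. -/
lemma caccioppoli (ha1 : -1 < a) (ha : a < 1) (hK : 0 ≤ K) :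
    ∃ C > 0, ∀ w : ExtHeis → ℝ, Adm a w → SubLinear a K w → ∀ η, ContDiff ℝ 1 η →
      HasCompactSupport η → ∫ p, gradSq w p * η p ^ 2 ∂wMeas a ≤
        C * ∫ p, w p ^ 2 * (η p ^ 2 + gradSq η p) ∂wMeas a := by
  -- With A, B, E the integrals of |∇w|²η², w²|∇η|² and w²η², the energy of wη in y is at most 2A +
  -- 2B. This ε makes its share in the boundary term at most A/4 + B/4. Young leaves 3A/4 - 4B on
  -- the left, so A/2 remains after absorption, which explains the constant chosen next.
  obtain ⟨C₀, hC₀, htr⟩ := trace_inequality ha1 ha (ε := 1 / (8 * (K + 1))) (by positivity)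
  refine ⟨2 * (4 + 1 / 4 + K * C₀), by positivity, fun w hw hsub η hη hηc => ?_⟩
  have hv := hw.mul_contDiff hη
  have c1 : HasCompactSupport fun p => η p ^ 2 :=
    HasCompactSupport.intro (hηc : IsCompact _) fun p hp => by
      simp [image_eq_zero_of_notMem_tsupport hp]
  have c2 : HasCompactSupport fun p => η p ^ 2 + gradSq η p :=
    HasCompactSupport.intro (hηc : IsCompact _) fun p hp => by
      simp [image_eq_zero_of_notMem_tsupport hp, gradSq_eq, D_eq_zero_of_compact _ hp]
  have iA : Integrable (fun p => gradSq w p * η p ^ 2) (wMeas a) :=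
    integrable_mul_cutoff hw.locallyIntegrable_gradSq (hη.continuous.pow 2) c1
  have iB := integrable_mul_cutoff hw.l2.sq (continuous_gradSq hη) (compact_gradSq hηc)
  have iC : Integrable (fun p => w p ^ 2 * η p ^ 2) (wMeas a) :=
    integrable_mul_cutoff hw.l2.sq (hη.continuous.pow 2) c1
  set A := ∫ p, gradSq w p * η p ^ 2 ∂wMeas a with hA
  set B := ∫ p, w p ^ 2 * gradSq η p ∂wMeas a with hB
  set E := ∫ p, w p ^ 2 * η p ^ 2 ∂wMeas a with hE
  have hBE : ∫ p, w p ^ 2 * (η p ^ 2 + gradSq η p) ∂wMeas a = E + B := by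
    simp only [mul_add]; exact integral_add iC iB
  have hB0 : 0 ≤ B := integral_nonneg fun p => mul_nonneg (sq_nonneg _) (gradSq_nonneg _ _)
  have hE0 : 0 ≤ E := integral_nonneg fun p => by positivity
  have hA0 : 0 ≤ A := integral_nonneg fun p => mul_nonneg (gradSq_nonneg _ _) (sq_nonneg _)
  -- the trace term
  have j0 : Integrable (fun p => (w p * η p) ^ 2) (wMeas a) := by simpa only [mul_pow] using iC
  have hD2 : ∀ p ∈ halfSpace, D 2 (fun q => w q * η q) p ^ 2 ≤
      2 * (gradSq w p * η p ^ 2) + 2 * (w p ^ 2 * gradSq η p) := by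
    intro p hp
    rw [D_mul 2 (hw.diff hp) (hη.differentiable one_ne_zero p)]
    have h1 := sq_D_le_gradSq w 2 p
    have h2 := sq_D_le_gradSq η 2 p
    have h3 := mul_le_mul_of_nonneg_right h1 (sq_nonneg (η p))
    have h4 := mul_le_mul_of_nonneg_left h2 (sq_nonneg (w p))
    nlinarith [sq_nonneg (w p * D 2 η p - D 2 w p * η p)]
  have j2' : Integrable (fun p => 2 * (gradSq w p * η p ^ 2) + 2 * (w p ^ 2 * gradSq η p))
    (wMeas a) := (iA.const_mul 2).add (iB.const_mul 2)
  have j2 : Integrable (fun p => D 2 (fun q => w q * η q) p ^ 2) (wMeas a) := by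
    refine j2'.mono' (aesm_of_continuousOn ((hv.grad 2).cont.pow 2)) ?_
    filter_upwards [ae_mem_halfSpace a] with p hp
    rw [Real.norm_eq_abs, abs_of_nonneg (sq_nonneg _)]
    exact hD2 p hp
  have hT := (htr _ hv j0 j2).2
  have hT2 : ∫ p, D 2 (fun q => w q * η q) p ^ 2 ∂wMeas a ≤ 2 * A + 2 * B := by
    have := integral_mono_ae j2 j2' (by filter_upwards [ae_mem_halfSpace a] with p hp using hD2 p hp)
    rwa [integral_add (iA.const_mul 2) (iB.const_mul 2), integral_const_mul,
      integral_const_mul] at this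
  simp only [mul_pow] at hT
  rw [← hE] at hT
  have hKT : K * ∫ x, trace (fun q => w q * η q) x ^ 2 ≤ A / 4 + B / 4 + K * C₀ * E := by
    have h1 := mul_le_mul_of_nonneg_left hT hK
    refine h1.trans ?_
    have h2 : K * (1 / (8 * (K + 1))) ≤ 1 / 8 := by
      rw [mul_one_div, div_le_div_iff₀ (by positivity) (by norm_num)]; linarith
    have h3 : 0 ≤ ∫ p, D 2 (fun q => w q * η q) p ^ 2 ∂wMeas a :=
      integral_nonneg fun p => sq_nonneg _
    have h4 := mul_le_mul_of_nonneg_right h2 h3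
    nlinarith
  -- the gradient term
  have hlow : ∀ p ∈ halfSpace, gradSq w p * η p ^ 2 * (3 / 4) - 4 * (w p ^ 2 * gradSq η p) ≤
      gradInner w (fun q => w q * (η q * η q)) p := by
    intro p hp
    have hηd := hη.differentiable one_ne_zero p
    have h1 : gradInner w (fun q => w q * (η q * η q)) p =
        gradSq w p * η p ^ 2 + 2 * (w p * η p * gradInner w η p) := by
      have : ∀ i, D i (fun q => w q * (η q * η q)) p =
          w p * (η p * D i η p + D i η p * η p) + D i w p * (η p * η p) := fun i => by
        have hηη : DifferentiableAt ℝ (fun q => η q * η q) p := hηd.mul hηd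
        rw [D_mul i (hw.diff hp) hηη, D_mul i hηd hηd]
      simp only [gradSq, gradInner_eq_sum, this, Fin.sum_univ_three]
      ring
    rw [h1]
    have h2 := sq_gradInner_le w η p
    have h3 : (2 * (w p * η p * gradInner w η p)) ^ 2 ≤
        4 * ((w p ^ 2 * gradSq η p) * (gradSq w p * η p ^ 2)) := by
      have := mul_le_mul_of_nonneg_left h2 (mul_nonneg (sq_nonneg (w p)) (sq_nonneg (η p)))
      nlinarith
    have hx : 0 ≤ gradSq w p * η p ^ 2 := mul_nonneg (gradSq_nonneg _ _) (sq_nonneg _)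
    have hy : 0 ≤ w p ^ 2 * gradSq η p := mul_nonneg (sq_nonneg _) (gradSq_nonneg _ _)
    generalize gradSq w p * η p ^ 2 = x at *
    generalize w p ^ 2 * gradSq η p = y at *
    generalize 2 * (w p * η p * gradInner w η p) = z at *
    -- Young's inequality for the cross term, using z² ≤ 4xy.
    have : |z| ≤ x / 4 + 4 * y := by
      apply abs_le_of_sq_le_sq _ (by positivity)
      nlinarith [sq_nonneg (x / 4 - 4 * y)]
    linarith [neg_abs_le z]
  have jL : Integrable (fun p => gradSq w p * η p ^ 2 * (3 / 4) - 4 * (w p ^ 2 * gradSq η p))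
    (wMeas a) := (iA.mul_const _).sub (iB.const_mul 4)
  have c3 : HasCompactSupport fun p => η p * η p := by simpa only [sq] using c1
  have jR : Integrable (gradInner w (fun q => w q * (η q * η q))) (wMeas a) := by
    obtain ⟨R, -, hR⟩ := exists_vanish_of_compact c3
    have hadm := hw.mul_contDiff (hη.mul hη)
    have : gradInner w (fun q => w q * (η q * η q)) =
        fun p => ∑ i, D i w p * D i (fun q => w q * (η q * η q)) p :=
      funext fun p => gradInner_eq_sum _ _ p
    rw [this]
    refine integrable_finsetSum _ fun i _ => integrable_of_vanishing
      ((hw.grad i).mul_locallyIntegrable (hadm.grad i)) (R := R) fun p hp hpR => ?_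
    rw [D_eq_zero_of_vanish (ξ := fun q => w q * (η q * η q))
      (fun q _ hq => by simp only [hR q hq, mul_zero]) i p hp hpR, mul_zero]
  have hfin := integral_mono_ae jL jR
    (by filter_upwards [ae_mem_halfSpace a] with p hp using hlow p hp)
  rw [integral_sub (iA.mul_const _) (iB.const_mul 4), integral_mul_const, integral_const_mul] at hfin
  have := hsub η hη hηc
  rw [hBE]
  have hKC : 0 ≤ K * C₀ := by positivity
  nlinarith [mul_nonneg hKC hB0]

end

/-! ### The vertical derivative is square integrable -/

section
variable {a M K : ℝ} {f : ℝ → ℝ} {u ψ χ : ExtHeis → ℝ}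

lemma continuous_slice {F : ExtHeis → ℝ} (hF : ContinuousOn F halfSpace) {y : ℝ} (hy : 0 < y) :
    Continuous fun x => F (x, y) := by
  rw [← continuousOn_univ]
  exact hF.comp (by fun_prop) fun x _ => hy

lemma compact_slice_of_vanish {F : ExtHeis → ℝ} {R : ℝ}
    (hR : ∀ p ∈ halfSpace, R < ‖p‖ → F p = 0) {y : ℝ} (hy : 0 < y) :
    HasCompactSupport fun x => F (x, y) :=
  HasCompactSupport.intro (isCompact_closedBall (0 : Heis) R) fun x hx => by
    refine hR (x, y) hy (lt_of_lt_of_le ?_ (norm_fst_le (x, y)))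
    simpa using hx

/-- On slices, `T u` is a commutator, which integrates by parts. -/
lemma integral_slice_T_mul_le (hu : ContDiffOn ℝ 2 u halfSpace) (hψ : ContDiffOn ℝ 1 ψ halfSpace)
    {R : ℝ} (hR : ∀ p ∈ halfSpace, R < ‖p‖ → ψ p = 0) (e : Heis) (s : ℝ)
    (hM : ∀ p ∈ halfSpace, ‖p‖ ≤ R → |X u (tau e s p)| ≤ M ∧ |Y u (tau e s p)| ≤ M)
    {y : ℝ} (hy : 0 < y) :
    ∫ x, T u (tau e s (x, y)) * ψ (x, y) ≤ M * ∫ x, (|X ψ (x, y)| + |Y ψ (x, y)|) := by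
  have hmem : ∀ x : Heis, ((x, y) : ExtHeis) ∈ halfSpace := fun _ => hy
  set A : ExtHeis → ℝ := fun p => Y u (tau e s p) with hA
  set B : ExtHeis → ℝ := fun p => X u (tau e s p) with hB
  have hXu := contDiffOn_D 0 hu
  have hYu := contDiffOn_D 1 hu
  have hAc : ContDiffOn ℝ 1 A halfSpace := hYu.comp (contDiff_tau e s).contDiffOn fun _ hp => hp
  have hBc : ContDiffOn ℝ 1 B halfSpace := hXu.comp (contDiff_tau e s).contDiffOn fun _ hp => hp
  have hvan : ∀ (C : ExtHeis → ℝ), ∀ p ∈ halfSpace, R < ‖p‖ → C p * ψ p = 0 := fun C p hp h => by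
    rw [hR p hp h, mul_zero]
  have h1 := integral_slice_D (i := 0) (hAc.mul hψ) hy (compact_slice_of_vanish (hvan A) hy)
    (by decide)
  have h2 := integral_slice_D (i := 1) (hBc.mul hψ) hy (compact_slice_of_vanish (hvan B) hy)
    (by decide)
  have hint : ∀ F : ExtHeis → ℝ, ContinuousOn F halfSpace →
      (∀ p ∈ halfSpace, R < ‖p‖ → F p = 0) → Integrable fun x => F (x, y) := fun F hF h0 =>
    (continuous_slice hF hy).integrable_of_hasCompactSupport (compact_slice_of_vanish h0 hy)
  have hD := D_eq_zero_of_vanish hR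
  have i1 : Integrable fun x => D 0 (A * ψ) (x, y) := hint _ (continuousOn_D 0 (hAc.mul hψ))
    (D_eq_zero_of_vanish (hvan A) 0)
  have i2 : Integrable fun x => D 1 (B * ψ) (x, y) := hint _ (continuousOn_D 1 (hBc.mul hψ))
    (D_eq_zero_of_vanish (hvan B) 1)
  have i3 := hint (fun p => |X ψ p| + |Y ψ p|)
    ((continuousOn_D 0 hψ).abs.add (continuousOn_D 1 hψ).abs) fun p hp h => by
      rw [← D_zero, ← D_one, hD 0 p hp h, hD 1 p hp h]; simp
  have i4 := hint (fun p => B p * Y ψ p - A p * X ψ p)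
    ((hBc.continuousOn.mul (continuousOn_D 1 hψ)).sub (hAc.continuousOn.mul (continuousOn_D 0 hψ)))
    fun p hp h => by rw [← D_zero, ← D_one, hD 0 p hp h, hD 1 p hp h]; simp
  -- Product rule for Tu = X(Yu) - Y(Xu): the two total derivatives integrate to zero on the slice,
  -- and the derivatives are left on ψ. Translations commute with the frame, so Tu may be evaluated
  -- at translated points.
  have hpt : ∀ x : Heis, T u (tau e s (x, y)) * ψ (x, y) = D 0 (A * ψ) (x, y)
      - D 1 (B * ψ) (x, y) + (B (x, y) * Y ψ (x, y) - A (x, y) * X ψ (x, y)) := by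
    intro x
    have hp := hmem x
    have hψd := differentiableAt_of_mem hψ hp
    rw [T_eq_commutator ((hu.contDiffAt (isOpen_halfSpace.mem_nhds (tau_mem.2 hp)))),
      show D 0 (A * ψ) (x, y) = _ from D_mul 0 (differentiableAt_of_mem hAc hp) hψd,
      show D 1 (B * ψ) (x, y) = _ from D_mul 1 (differentiableAt_of_mem hBc hp) hψd,
      show D 0 A (x, y) = _ from D_comp_tau e s 0 (differentiableAt_of_mem hYu (tau_mem.2 hp)),
      show D 1 B (x, y) = _ from D_comp_tau e s 1 (differentiableAt_of_mem hXu (tau_mem.2 hp))]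
    simp only [D_zero, D_one]
    ring
  simp only [hpt]
  have i12 : Integrable fun x => D 0 (A * ψ) (x, y) - D 1 (B * ψ) (x, y) := i1.sub i2
  rw [integral_add i12 i4, integral_sub i1 i2]
  rw [show ∫ x, D 0 (A * ψ) (x, y) = 0 from h1, show ∫ x, D 1 (B * ψ) (x, y) = 0 from h2,
    sub_zero, zero_add, ← integral_const_mul]
  refine integral_mono i4 (i3.const_mul M) fun x => ?_
  simp only
  have hp := hmem x
  rcases le_or_gt ‖((x, y) : ExtHeis)‖ R with h | h
  · obtain ⟨m1, m2⟩ := hM _ hp h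
    have := abs_sub (B (x, y) * Y ψ (x, y)) (A (x, y) * X ψ (x, y))
    rw [abs_mul, abs_mul] at this
    have n1 := mul_le_mul_of_nonneg_right m1 (abs_nonneg (Y ψ (x, y)))
    have n2 := mul_le_mul_of_nonneg_right m2 (abs_nonneg (X ψ (x, y)))
    have := le_abs_self (B (x, y) * Y ψ (x, y) - A (x, y) * X ψ (x, y))
    simp only [hA, hB] at *
    linarith
  · rw [← D_zero, ← D_one, hD 0 _ hp h, hD 1 _ hp h]; simp

/-- The direction of the vertical field `T`. -/
def eT : Heis := (0, 0, -4)

/-- The vertical quotient is the average of Tu over translates, so the slice estimate is averaged by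
Fubini; the bound does not depend on the step. -/
lemma integral_slice_dq_mul_le (hu : ContDiffOn ℝ 2 u halfSpace)
    (hψ : ContDiffOn ℝ 1 ψ halfSpace)
    {R h : ℝ} (hh : 0 < h) (hR : ∀ p ∈ halfSpace, R < ‖p‖ → ψ p = 0)
    (hM : ∀ s ∈ Icc 0 h, ∀ p ∈ halfSpace, ‖p‖ ≤ R →
      |X u (tau eT s p)| ≤ M ∧ |Y u (tau eT s p)| ≤ M)
    {y : ℝ} (hy : 0 < y) :
    ∫ x, dq eT h u (x, y) * ψ (x, y) ≤ M * ∫ x, (|X ψ (x, y)| + |Y ψ (x, y)|) := by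
  have hmem : ∀ x : Heis, ((x, y) : ExtHeis) ∈ halfSpace := fun _ => hy
  have hu1 : ContDiffOn ℝ 1 u halfSpace := hu.of_le (by norm_num)
  set I := ∫ x, (|X ψ (x, y)| + |Y ψ (x, y)|)
  set G : Heis → ℝ → ℝ := fun x s => T u (tau eT s (x, y)) * ψ (x, y) with hG
  have hGc : Continuous (Function.uncurry G) := by
    have h1 : Continuous fun q : Heis × ℝ => T u (tau eT q.2 (q.1, y)) := by
      rw [← continuousOn_univ, T_eq_Z]
      refine (continuousOn_Z _ hu1).comp ?_ fun q _ => tau_mem.2 (hmem q.1)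
      exact ((continuous_tau_uncurry eT).comp (by fun_prop :
        Continuous fun q : Heis × ℝ => (((q.1, y), q.2) : ExtHeis × ℝ))).continuousOn
    exact h1.mul ((continuous_slice hψ.continuousOn hy).comp continuous_fst)
  have hint : Integrable (Function.uncurry G) (volume.prod (volume.restrict (Ioc 0 h))) := by
    have h1 : IntegrableOn (Function.uncurry G) (Metric.closedBall (0 : Heis) R ×ˢ Icc 0 h)
        (volume.prod volume) :=
      hGc.continuousOn.integrableOn_compact ((isCompact_closedBall _ _).prod isCompact_Icc)
    have h2 : IntegrableOn (Function.uncurry G) (univ ×ˢ Ioc 0 h) (volume.prod volume) := by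
      refine (h1.mono_set (prod_mono_right Ioc_subset_Icc_self)).of_forall_sdiff_eq_zero
        (MeasurableSet.univ.prod measurableSet_Ioc) ?_
      rintro ⟨x, s⟩ ⟨⟨-, hs⟩, hx⟩
      have : R < ‖x‖ := by
        by_contra hle
        exact hx ⟨by simpa using hle, hs⟩
      have h0 := hR (x, y) (hmem x) (this.trans_le (norm_fst_le (x, y)))
      simp [Function.uncurry, hG, h0]
    rwa [IntegrableOn, ← Measure.prod_restrict, Measure.restrict_univ] at h2
  have hpt : ∀ x : Heis, dq eT h u (x, y) * ψ (x, y) = (∫ s in Ioc 0 h, G x s) / h := by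
    intro x
    rw [dq_eq_integral hu1 eT (hmem x), integral_mul_const, intervalIntegral.integral_of_le hh.le,
      T_eq_Z]
    simp only [eT]; ring
  simp only [hpt]
  rw [integral_div, integral_integral_swap hint, div_le_iff₀ hh]
  have h3 : ∫ s in Ioc 0 h, (∫ x, G x s) ≤ ∫ s in Ioc 0 h, M * I := by
    refine setIntegral_mono_on hint.integral_prod_right (integrableOn_const (by simp))
      measurableSet_Ioc fun s hs => ?_
    exact integral_slice_T_mul_le hu hψ hR eT s (hM s ⟨hs.1.le, hs.2⟩) hy
  refine h3.trans (le_of_eq ?_)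
  rw [setIntegral_const]
  simp [hh.le, mul_comm]

lemma integral_dq_mul_le (hu : ContDiffOn ℝ 2 u halfSpace) (hψ : Adm a ψ)
    {R h : ℝ} (hh : 0 < h) (hR : ∀ p ∈ halfSpace, R < ‖p‖ → ψ p = 0)
    (hM : ∀ s ∈ Icc 0 h, ∀ p ∈ halfSpace, ‖p‖ ≤ R →
      |X u (tau eT s p)| ≤ M ∧ |Y u (tau eT s p)| ≤ M)
    (i1 : Integrable (fun p => dq eT h u p * ψ p) (wMeas a))
    (i2 : Integrable (fun p => |X ψ p| + |Y ψ p|) (wMeas a)) :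
    ∫ p, dq eT h u p * ψ p ∂wMeas a ≤ M * ∫ p, (|X ψ p| + |Y ψ p|) ∂wMeas a := by
  rw [integral_wMeas_slices i1, integral_wMeas_slices i2, ← integral_const_mul]
  refine integral_mono_ae i1.integral_prod_right (i2.integral_prod_right.const_mul M) ?_
  filter_upwards [ae_mem_Ioi a] with y hy
  exact integral_slice_dq_mul_le hu hψ.smooth hh hR hM hy

/-- A smooth cutoff which is one on a ball. -/
lemma exists_cutoff (R : ℝ) : ∃ χ : ExtHeis → ℝ, ContDiff ℝ 1 χ ∧ HasCompactSupport χ ∧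
    (∀ p, ‖p‖ ≤ R → χ p = 1) ∧ ∀ p, 0 ≤ χ p ∧ χ p ≤ 1 := by
  let b : ContDiffBump (0 : ExtHeis) := ⟨|R| + 1, |R| + 2, by positivity, by linarith⟩
  refine ⟨b, b.contDiff, b.hasCompactSupport, fun p hp => b.one_of_mem_closedBall ?_,
    fun p => ⟨b.nonneg, b.le_one⟩⟩
  simp only [Metric.mem_closedBall, dist_zero_right]
  exact hp.trans ((le_abs_self R).trans (by simp [b]))

/-- The factor κ, equal to 1 wherever χ ≠ 0, is inserted first so that the constant term of Young's
inequality has compact support and finite integral. -/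
lemma young_aux {M c χ κ ε : ℝ} (hε : 0 < ε) (hκ : χ ^ 2 = χ ^ 2 * κ) :
    M * (|c| * χ ^ 2) ≤ ε * (c ^ 2 * (χ ^ 2) ^ 2) + M ^ 2 / (4 * ε) * κ ^ 2 := by
  have h1 : M * (|c| * χ ^ 2) = (|c| * χ ^ 2) * (M * κ) := by
    conv_lhs => rw [hκ]
    ring
  rw [h1, ← sq_abs c]
  have h2 : ε * (|c| ^ 2 * (χ ^ 2) ^ 2) + M ^ 2 / (4 * ε) * κ ^ 2
      - (|c| * χ ^ 2) * (M * κ) = ε * ((|c| * χ ^ 2) - M * κ / (2 * ε)) ^ 2 := by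
    field_simp
    ring
  nlinarith [mul_nonneg hε.le (sq_nonneg ((|c| * χ ^ 2) - M * κ / (2 * ε)))]

lemma tau_dq_bound (hb : LocBdd (X u)) (hb' : LocBdd (Y u)) (e : Heis) (R : ℝ) :
    ∃ M, 0 ≤ M ∧ ∀ s ∈ Icc (0 : ℝ) 1, ∀ p ∈ halfSpace, ‖p‖ ≤ R →
      |X u (tau e s p)| ≤ M ∧ |Y u (tau e s p)| ≤ M := by
  obtain ⟨C, hC⟩ := hb (bigR e R)
  obtain ⟨C', hC'⟩ := hb' (bigR e R)
  refine ⟨max 0 (max C C'), le_max_left _ _, fun s hs p hp hpR => ?_⟩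
  have h1 := norm_tau_le_bigR (e := e) hs.1 hs.2 hpR
  exact ⟨(hC _ (tau_mem.2 hp) h1).trans ((le_max_left C C').trans (le_max_right _ _)),
    (hC' _ (tau_mem.2 hp) h1).trans ((le_max_right C C').trans (le_max_right _ _))⟩

/-- Uniform `L²` bound for the vertical difference quotients. -/
lemma exists_bound_dq_T [IsLocallyFiniteMeasure (wMeas a)] (ha1 : -1 < a) (ha : a < 1)
    (hu : ContDiffOn ℝ 2 u halfSpace)
    (hua : Adm a u) (hM : ∀ p ∈ halfSpace, |u p| ≤ M) (hX : LocBdd (X u)) (hY : LocBdd (Y u))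
    (hK0 : 0 ≤ K) (hsub : ∀ h > 0, SubLinear a K (dq eT h u))
    (hχ : ContDiff ℝ 1 χ) (hχc : HasCompactSupport χ) :
    ∃ C, ∀ h ∈ Ioc (0 : ℝ) 1, ∫ p, dq eT h u p ^ 2 * χ p ^ 2 ∂wMeas a ≤ C := by
  obtain ⟨C₁, hC₁, hcac⟩ := caccioppoli ha1 ha hK0
  obtain ⟨R, hR0, hR⟩ := exists_vanish_of_compact hχc
  obtain ⟨N, hN0, hN⟩ := tau_dq_bound hX hY eT R
  obtain ⟨κ, hκ, hκc, hκ1, -⟩ := exists_cutoff R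
  -- a bound for the derivatives of the cutoff
  obtain ⟨B, hB⟩ : ∃ B, 0 < B ∧ ∀ p, χ p ^ 2 + 4 * gradSq χ p ≤ B := by
    have hc : Continuous fun p => χ p ^ 2 + 4 * gradSq χ p :=
      (hχ.continuous.pow 2).add (continuous_const.mul (continuous_gradSq hχ))
    have hcs : HasCompactSupport fun p => χ p ^ 2 + 4 * gradSq χ p :=
      HasCompactSupport.intro (hχc : IsCompact _) fun p hp => by
        simp [image_eq_zero_of_notMem_tsupport hp, gradSq_eq, D_eq_zero_of_compact _ hp]
    obtain ⟨B, hB⟩ := hcs.exists_bound_of_continuous hc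
    exact ⟨|B| + 1, by positivity, fun p => (le_abs_self _).trans ((hB p).trans
      (by linarith [le_abs_self B]))⟩
  obtain ⟨hB0, hB⟩ := hB
  -- With this ε, Caccioppoli bounds ε ∫|∇w|²χ⁴ by a quarter of ∫ w²χ².
  set ε := 1 / (4 * (C₁ * B)) with hε
  have hε0 : 0 < ε := by positivity
  have hone : LocallyIntegrable (fun _ : ExtHeis => (1 : ℝ)) (wMeas a) :=
    (continuous_const).locallyIntegrable
  have cκ : HasCompactSupport fun p => κ p ^ 2 :=
    HasCompactSupport.intro (hκc : IsCompact _) fun p hp => by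
      simp [image_eq_zero_of_notMem_tsupport hp]
  have iκ : Integrable (fun p => κ p ^ 2) (wMeas a) := by
    simpa using integrable_mul_cutoff hone (hκ.continuous.pow 2) cκ
  have iχ : Integrable (gradSq χ) (wMeas a) := by
    simpa using integrable_mul_cutoff hone (continuous_gradSq hχ) (compact_gradSq hχc)
  set P := ∫ p, (2 * (N ^ 2 / (4 * ε)) * κ p ^ 2 + 8 * N ^ 2 * gradSq χ p) ∂wMeas a with hP
  -- Writing E for ∫ w²χ², the estimates below combine to E ≤ E/4 + E/2 + P, that is E ≤ 4P, with P
  -- independent of the step.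
  refine ⟨2 * (2 * P), fun h hh => ?_⟩
  have hw := hua.dq eT h
  have hwb : LocBdd (dq eT h u) := (LocBdd.of_bound hM).dq eT h
  set w := dq eT h u with hwdef
  -- Caccioppoli is used with cutoff χ², because χ⁴ + |∇χ²|² = χ²(χ² + 4|∇χ|²) ≤ Bχ². Its right side
  -- is then a multiple of the same ∫ w²χ² and can be absorbed, with no loss of support.
  have cχ2 : HasCompactSupport fun p => χ p ^ 2 :=
    HasCompactSupport.intro (hχc : IsCompact _) fun p hp => by
      simp [image_eq_zero_of_notMem_tsupport hp]
  have dχ2 : ContDiff ℝ 1 fun p => χ p ^ 2 := hχ.pow 2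
  have hψ := hw.c1Test hwb dχ2 cχ2
  have hRψ : ∀ p ∈ halfSpace, R < ‖p‖ → w p * χ p ^ 2 = 0 := fun p _ hp => by
    rw [hR p hp]; ring
  have iE : Integrable (fun p => w p ^ 2 * χ p ^ 2) (wMeas a) :=
    integrable_mul_cutoff hw.l2.sq (hχ.continuous.pow 2) cχ2
  have i1 : Integrable (fun p => w p * (w p * χ p ^ 2)) (wMeas a) := by
    simpa only [sq, mul_assoc] using iE
  have i2 : Integrable (fun p => |X (fun p => w p * χ p ^ 2) p| + |Y (fun p => w p * χ p ^ 2) p|)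
      (wMeas a) := by
    have h1 : L2loc a fun _ => 1 := (LocBdd.of_continuous continuous_const).l2loc continuousOn_const
    have h2 := hψ.integrable_mul_D h1 0
    have h3 := hψ.integrable_mul_D h1 1
    simp only [one_mul] at h2 h3
    exact h2.abs.add h3.abs
  have hmain := integral_dq_mul_le hu hψ.adm hh.1 hRψ
    (fun s hs => hN s ⟨hs.1, hs.2.trans hh.2⟩) i1 i2
  have hc := hcac w hw (hsub h hh.1) _ dχ2 cχ2
  have c4 : HasCompactSupport fun p => (χ p ^ 2) ^ 2 :=
    HasCompactSupport.intro (hχc : IsCompact _) fun p hp => by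
      simp [image_eq_zero_of_notMem_tsupport hp]
  have iA : Integrable (fun p => gradSq w p * (χ p ^ 2) ^ 2) (wMeas a) :=
    integrable_mul_cutoff hw.locallyIntegrable_gradSq ((hχ.continuous.pow 2).pow 2) c4
  -- Caccioppoli with a smaller cutoff
  have hgχ2 : ∀ p, (χ p ^ 2) ^ 2 + gradSq (fun q => χ q ^ 2) p = χ p ^ 2 * (χ p ^ 2 + 4 * gradSq χ p) := by
    intro p
    have hd := hχ.differentiable one_ne_zero p
    have : ∀ i, D i (fun q => χ q ^ 2) p = 2 * (χ p * D i χ p) := fun i => by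
      simp only [sq]; rw [D_mul i hd hd]; ring
    simp only [gradSq_eq, this, Fin.sum_univ_three]
    ring
  have hA : ∫ p, gradSq w p * (χ p ^ 2) ^ 2 ∂wMeas a ≤
      C₁ * (B * ∫ p, w p ^ 2 * χ p ^ 2 ∂wMeas a) := by
    refine hc.trans (mul_le_mul_of_nonneg_left ?_ hC₁.le)
    rw [← integral_const_mul]
    refine integral_mono_of_nonneg (Eventually.of_forall fun p => ?_) (iE.const_mul B)
      (Eventually.of_forall fun p => ?_)
    · have := gradSq_nonneg (fun q => χ q ^ 2) p
      simp only [Pi.zero_apply]; positivity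
    · simp only [hgχ2]
      have := mul_le_mul_of_nonneg_left (hB p) (by positivity : 0 ≤ w p ^ 2 * χ p ^ 2)
      linarith
  -- the pointwise estimate
  have hκχ : ∀ p, χ p ^ 2 = χ p ^ 2 * κ p := by
    intro p
    rcases le_or_gt ‖p‖ R with hp | hp
    · rw [hκ1 p hp, mul_one]
    · rw [hR p hp]; ring
  have hpt : ∀ p ∈ halfSpace, N * (|X (fun p => w p * χ p ^ 2) p| + |Y (fun p => w p * χ p ^ 2) p|) ≤
      ε * (gradSq w p * (χ p ^ 2) ^ 2) + (1 / 2) * (w p ^ 2 * χ p ^ 2) +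
        (2 * (N ^ 2 / (4 * ε)) * κ p ^ 2 + 8 * N ^ 2 * gradSq χ p) := by
    intro p hp
    have hd := hχ.differentiable one_ne_zero p
    have hi : ∀ i, N * |D i (fun p => w p * χ p ^ 2) p| ≤ ε * (D i w p ^ 2 * (χ p ^ 2) ^ 2) +
        N ^ 2 / (4 * ε) * κ p ^ 2 + (1 / 4) * (w p ^ 2 * χ p ^ 2) + 4 * N ^ 2 * D i χ p ^ 2 := by
      intro i
      have h1 : D i (fun p => w p * χ p ^ 2) p = D i w p * χ p ^ 2 + 2 * (w p * χ p * D i χ p) := by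
        rw [D_mul i (hw.diff hp) (dχ2.differentiable one_ne_zero p)]
        simp only [sq]; rw [D_mul i hd hd]; ring
      have h2 : |D i (fun p => w p * χ p ^ 2) p| ≤ |D i w p| * χ p ^ 2 +
          2 * (|w p * χ p| * |D i χ p|) := by
        rw [h1]
        refine (abs_add_le _ _).trans ?_
        rw [abs_mul, abs_mul, abs_mul _ (D i χ p), abs_of_nonneg (sq_nonneg (χ p)), abs_two]
      have h3 := mul_le_mul_of_nonneg_left h2 hN0
      have h4 := young_aux (M := N) (c := D i w p) hε0 (hκχ p)
      have h5 : 2 * N * (|w p * χ p| * |D i χ p|) ≤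
          (1 / 4) * (w p ^ 2 * χ p ^ 2) + 4 * N ^ 2 * D i χ p ^ 2 := by
        rw [← mul_pow, ← sq_abs (w p * χ p), ← sq_abs (D i χ p)]
        nlinarith [sq_nonneg (|w p * χ p| / 2 - 2 * N * |D i χ p|)]
      nlinarith
    have h0 := hi 0
    have h1 := hi 1
    rw [D_zero] at h0
    rw [D_one] at h1
    have hs1 : X w p ^ 2 + Y w p ^ 2 ≤ gradSq w p := by
      rw [gradSq_eq, Fin.sum_univ_three]
      have := sq_nonneg (D 2 w p)
      rw [D_zero, D_one]; linarith
    have hs2 : X χ p ^ 2 + Y χ p ^ 2 ≤ gradSq χ p := by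
      rw [gradSq_eq, Fin.sum_univ_three]
      have := sq_nonneg (D 2 χ p)
      rw [D_zero, D_one]; linarith
    have hs3 := mul_le_mul_of_nonneg_right hs1
      (by positivity : 0 ≤ ε * (χ p ^ 2) ^ 2)
    have hs4 := mul_le_mul_of_nonneg_left hs2 (by positivity : 0 ≤ 4 * N ^ 2)
    have hs5 : 0 ≤ 4 * N ^ 2 * gradSq χ p := mul_nonneg (by positivity) (gradSq_nonneg _ _)
    rw [D_zero, D_zero] at h0
    rw [D_one, D_one] at h1
    nlinarith
  have iP : Integrable (fun p => 2 * (N ^ 2 / (4 * ε)) * κ p ^ 2 + 8 * N ^ 2 * gradSq χ p)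
    (wMeas a) := (iκ.const_mul _).add (iχ.const_mul _)
  have iQ : Integrable (fun p => ε * (gradSq w p * (χ p ^ 2) ^ 2) + (1 / 2) * (w p ^ 2 * χ p ^ 2))
    (wMeas a) := (iA.const_mul _).add (iE.const_mul _)
  have hint := integral_mono_ae (i2.const_mul N) (iQ.add iP)
    (by filter_upwards [ae_mem_halfSpace a] with p hp using hpt p hp)
  simp only [Pi.add_apply] at hint
  rw [integral_const_mul, integral_add iQ iP, integral_add (iA.const_mul _) (iE.const_mul _),
    integral_const_mul, integral_const_mul, ← hP] at hint
  have hE : ∫ p, w p * (w p * χ p ^ 2) ∂wMeas a = ∫ p, w p ^ 2 * χ p ^ 2 ∂wMeas a := by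
    simp only [sq, mul_assoc]
  rw [hE] at hmain
  have hεA := mul_le_mul_of_nonneg_left hA hε0.le
  have hεB : ε * (C₁ * (B * ∫ p, w p ^ 2 * χ p ^ 2 ∂wMeas a)) =
      (1 / 4) * ∫ p, w p ^ 2 * χ p ^ 2 ∂wMeas a := by
    rw [hε]; field_simp
  linarith

end

/-! ### Second derivatives have locally finite energy -/

section
variable {a M K : ℝ} {f : ℝ → ℝ} {u v : ExtHeis → ℝ}

lemma compact_sq {χ : ExtHeis → ℝ} (h : HasCompactSupport χ) :
    HasCompactSupport fun p => χ p ^ 2 :=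
  HasCompactSupport.intro (h : IsCompact _) fun p hp => by
    simp [image_eq_zero_of_notMem_tsupport hp]

lemma L2loc.integrable_sq_mul_sq {χ : ExtHeis → ℝ} (hv : L2loc a v) (hχ : Continuous χ)
    (hc : HasCompactSupport χ) : Integrable (fun p => v p ^ 2 * χ p ^ 2) (wMeas a) :=
  integrable_mul_cutoff hv.sq (hχ.pow 2) (compact_sq hc)

lemma l2loc_of_bound {g : ℕ → ExtHeis → ℝ} (hg : ∀ n, L2loc a (g n))
    (hv : ContinuousOn v halfSpace)
    (hlim : ∀ p ∈ halfSpace, Tendsto (fun n => g n p) atTop (𝓝 (v p)))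
    (hC : ∀ χ : ExtHeis → ℝ, ContDiff ℝ 1 χ → HasCompactSupport χ →
      ∃ C, ∀ n, ∫ p, g n p ^ 2 * χ p ^ 2 ∂wMeas a ≤ C) : L2loc a v := by
  refine ⟨hv, locallyIntegrable_iff.2 fun S hS => ?_⟩
  obtain ⟨R, hR⟩ := hS.isBounded.exists_norm_le
  obtain ⟨χ, hχ, hχc, hχ1, -⟩ := exists_cutoff R
  obtain ⟨C, hC⟩ := hC χ hχ hχc
  have h1 : Integrable (fun p => v p ^ 2 * χ p ^ 2) (wMeas a) := by
    refine integrable_of_tendsto_of_bound (fun n => Eventually.of_forall fun p => by positivity)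
      (fun n => (hg n).integrable_sq_mul_sq hχ.continuous hχc) hC ?_
    filter_upwards [ae_mem_halfSpace a] with p hp
    exact ((hlim p hp).pow 2).mul_const _
  refine h1.integrableOn.congr_fun (fun p hp => ?_) hS.measurableSet
  simp [hχ1 p (hR p hp)]

lemma exists_bound_of_compact {F : ExtHeis → ℝ} (hF : Continuous F) (hc : HasCompactSupport F) :
    ∃ B > 0, ∀ p, F p ≤ B := by
  obtain ⟨B, hB⟩ := hc.exists_bound_of_continuous hF
  exact ⟨|B| + 1, by positivity, fun p => (le_abs_self _).trans ((hB p).trans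
    (by linarith [le_abs_self B]))⟩

/-- Caccioppoli needs the L² bound only on the support of χ, hence for a larger cutoff κ equal to 1
there. -/
lemma energy_bound (ha1 : -1 < a) (ha : a < 1) (hu : Adm a u) (hK : 0 ≤ K) {e : Heis}
    (hsub : ∀ h > 0, SubLinear a K (dq e h u))
    (hC : ∀ χ : ExtHeis → ℝ, ContDiff ℝ 1 χ → HasCompactSupport χ →
      ∃ C, ∀ h ∈ Ioc (0 : ℝ) 1, ∫ p, dq e h u p ^ 2 * χ p ^ 2 ∂wMeas a ≤ C)
    {χ : ExtHeis → ℝ} (hχ : ContDiff ℝ 1 χ) (hχc : HasCompactSupport χ) :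
    ∃ C, ∀ h ∈ Ioc (0 : ℝ) 1, ∫ p, gradSq (dq e h u) p * χ p ^ 2 ∂wMeas a ≤ C := by
  obtain ⟨C₁, hC₁, hcac⟩ := caccioppoli ha1 ha hK
  obtain ⟨R, -, hR⟩ := exists_vanish_of_compact (compact_gradSq hχc)
  obtain ⟨R', -, hR'⟩ := exists_vanish_of_compact hχc
  obtain ⟨κ, hκ, hκc, hκ1, -⟩ := exists_cutoff (max R R')
  have cF : HasCompactSupport fun p => χ p ^ 2 + gradSq χ p := (compact_sq hχc).add
    (compact_gradSq hχc)
  have hF : Continuous fun p => χ p ^ 2 + gradSq χ p :=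
    (hχ.continuous.pow 2).add (continuous_gradSq hχ)
  obtain ⟨B, hB0, hB⟩ := exists_bound_of_compact hF cF
  obtain ⟨C, hC⟩ := hC κ hκ hκc
  refine ⟨C₁ * (B * C), fun h hh => (hcac _ (hu.dq e h) (hsub h hh.1) χ hχ hχc).trans
    (mul_le_mul_of_nonneg_left ?_ hC₁.le)⟩
  have i1 := (hu.dq e h).l2.integrable_sq_mul_sq hκ.continuous hκc
  refine le_trans ?_ (mul_le_mul_of_nonneg_left (hC h hh) hB0.le)
  rw [← integral_const_mul]
  refine integral_mono (integrable_mul_cutoff (hu.dq e h).l2.sq hF cF) (i1.const_mul B) fun p => ?_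
  simp only
  rcases le_or_gt ‖p‖ (max R R') with hp | hp
  · rw [hκ1 p hp]
    nlinarith [mul_le_mul_of_nonneg_left (hB p) (sq_nonneg (dq e h u p))]
  · rw [hR' p ((le_max_right _ _).trans_lt hp), hR p ((le_max_left _ _).trans_lt hp)]
    have : 0 ≤ B * (dq e h u p ^ 2 * κ p ^ 2) := by positivity
    simpa using this

/-- Uniformly bounded difference quotients give a derivative with locally finite energy. -/
lemma adm_Z_of_bound (ha1 : -1 < a) (ha : a < 1) (hu2 : ContDiffOn ℝ 2 u halfSpace) (hu : Adm a u)
    (hK : 0 ≤ K) {e : Heis} (hsub : ∀ h > 0, SubLinear a K (dq e h u))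
    (hC : ∀ χ : ExtHeis → ℝ, ContDiff ℝ 1 χ → HasCompactSupport χ →
      ∃ C, ∀ h ∈ Ioc (0 : ℝ) 1, ∫ p, dq e h u p ^ 2 * χ p ^ 2 ∂wMeas a ≤ C) :
    Adm a (Z e u) := by
  have hmem : ∀ n, step n ∈ Ioc (0 : ℝ) 1 := fun n => ⟨step_pos n, step_le_one n⟩
  refine ⟨contDiffOn_Z e hu2, ?_, fun i => ?_⟩
  · refine l2loc_of_bound (fun n => hu.l2.dq e (step n)) (continuousOn_Z e hu.smooth)
      (fun p hp => tendsto_dq hu.smooth e hp) fun χ hχ hχc => ?_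
    obtain ⟨C, hC⟩ := hC χ hχ hχc
    exact ⟨C, fun n => hC _ (hmem n)⟩
  · refine l2loc_of_bound (fun n => (hu.dq e (step n)).grad i)
      (continuousOn_D i (contDiffOn_Z e hu2)) (fun p hp => ?_) fun χ hχ hχc => ?_
    · rw [← Z_D_comm (hu2.contDiffAt (isOpen_halfSpace.mem_nhds hp))]
      refine (tendsto_dq (contDiffOn_D i hu2) e hp).congr fun n => ?_
      rw [D_dq hu.smooth e _ i hp]
    · obtain ⟨C, hC⟩ := energy_bound ha1 ha hu hK hsub hC hχ hχc
      refine ⟨C, fun n => le_trans ?_ (hC _ (hmem n))⟩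
      refine integral_mono (((hu.dq e _).grad i).integrable_sq_mul_sq hχ.continuous hχc)
        (integrable_mul_cutoff (hu.dq e _).locallyIntegrable_gradSq (hχ.continuous.pow 2)
          (compact_sq hχc)) fun p => ?_
      exact mul_le_mul_of_nonneg_right (sq_D_le_gradSq _ i p) (sq_nonneg _)

lemma bound_of_l2loc (hu : Adm a u) {e : Heis} (hZ : L2loc a (Z e u))
    {χ : ExtHeis → ℝ} (hχ : ContDiff ℝ 1 χ) (hχc : HasCompactSupport χ) :
    ∃ C, ∀ h ∈ Ioc (0 : ℝ) 1, ∫ p, dq e h u p ^ 2 * χ p ^ 2 ∂wMeas a ≤ C := by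
  obtain ⟨R, -, hR⟩ := exists_vanish_of_compact hχc
  obtain ⟨B, hB0, hB⟩ := exists_bound_of_compact
    (F := fun p => χ p ^ 2) (hχ.continuous.pow 2) (compact_sq hχc)
  -- The slab condition y < R + 1 is void on the ball of radius R; it only serves to reuse the slab
  -- estimate.
  refine ⟨B * ∫ p in {p | ‖p‖ ≤ bigR e R ∧ p.2 < R + 1}, Z e u p ^ 2 ∂wMeas a, fun h hh => ?_⟩
  refine le_trans ?_ (mul_le_mul_of_nonneg_left
    (setIntegral_dq_le hu.smooth hu.l2 e hZ hh.1 hh.2 R (R + 1)) hB0.le)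
  rw [← integral_const_mul, ← integral_indicator (measurableSet_slab R (R + 1))]
  have i1 := (integrableOn_sq (hu.l2.dq e h) {p | ‖p‖ ≤ R ∧ p.2 < R + 1} R
    fun p hp => hp.1).const_mul B
  refine integral_mono ((hu.dq e h).l2.integrable_sq_mul_sq hχ.continuous hχc)
    ((integrable_indicator_iff (measurableSet_slab R (R + 1))).2 i1) fun p => ?_
  simp only
  rcases le_or_gt ‖p‖ R with hp | hp
  · have hmem : p ∈ {p : ExtHeis | ‖p‖ ≤ R ∧ p.2 < R + 1} := ⟨hp, by
      have : |p.2| ≤ R := (norm_snd_le p).trans hp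
      linarith [le_abs_self p.2]⟩
    rw [indicator_of_mem hmem]
    nlinarith [mul_le_mul_of_nonneg_left (hB p) (sq_nonneg (dq e h u p))]
  · rw [hR p hp]
    simp only [ne_eq, OfNat.ofNat_ne_zero, not_false_eq_true, zero_pow, mul_zero]
    exact indicator_nonneg (fun p _ => by positivity) p

lemma locBdd_of_hGradNorm (hgrad : ∀ R > 0, ∃ C, ∀ p ∈ halfBall R, hGradNorm u p ≤ C) :
    LocBdd (X u) ∧ LocBdd (Y u) := by
  have h : ∀ R : ℝ, ∃ C, ∀ p ∈ halfSpace, ‖p‖ ≤ R → hGradNorm u p ≤ C := by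
    intro R
    obtain ⟨C, hC⟩ := hgrad (3 * (|R| + 1)) (by positivity)
    exact ⟨C, fun p hp hpR => hC p (mem_halfBall_of_norm (by positivity) hp
      (hpR.trans (by linarith [le_abs_self R])))⟩
  constructor <;>
  · intro R
    obtain ⟨C, hC⟩ := h R
    refine ⟨C, fun p hp hpR => le_trans (Real.abs_le_sqrt ?_) (hC p hp hpR)⟩
    nlinarith [sq_nonneg (X u p), sq_nonneg (Y u p)]

/-- Regularity of the first derivatives. -/
lemma adm_derivatives (ha1 : -1 < a) (ha : a < 1) [IsLocallyFiniteMeasure (wMeas a)]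
    (hu2 : ContDiffOn ℝ 2 u halfSpace) (hu : Adm a u)
    (hM : ∀ p ∈ halfSpace, |u p| ≤ M) (hX : LocBdd (X u)) (hY : LocBdd (Y u)) (hK : 0 ≤ K)
    (hsub : ∀ e, ∀ h > 0, SubLinear a K (dq e h u)) :
    Adm a (T u) ∧ Adm a (Z (1, 0, 0) u) ∧ Adm a (Z (0, 1, 0) u) := by
  have hT : Adm a (T u) := by
    rw [T_eq_Z]
    exact adm_Z_of_bound ha1 ha hu2 hu hK (hsub eT) fun χ hχ hχc =>
      exists_bound_dq_T ha1 ha hu2 hu hM hX hY hK (hsub eT) hχ hχc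
  have c1 : Continuous fun p : ExtHeis => p.1.1 := by fun_prop
  have c2 : Continuous fun p : ExtHeis => p.1.2.1 := by fun_prop
  refine ⟨hT, ?_, ?_⟩
  · refine adm_Z_of_bound ha1 ha hu2 hu hK (hsub _) fun χ hχ hχc => bound_of_l2loc hu ?_ hχ hχc
    exact ((hu.grad 0).add (hT.l2.mul_continuous c2)).congr fun p _ => by
      rw [D_zero, X_eq]; ring
  · refine adm_Z_of_bound ha1 ha hu2 hu hK (hsub _) fun χ hχ hχc => bound_of_l2loc hu ?_ hχ hχc
    exact ((hu.grad 1).sub (hT.l2.mul_continuous c1)).congr fun p _ => by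
      rw [D_one, Y_eq]; ring

lemma Adm.congr_fun (hv : Adm a v) (h : u = v) : Adm a u := h ▸ hv

lemma adm_X (hT : Adm a (T u)) (hZ : Adm a (Z (1, 0, 0) u)) : Adm a (X u) :=
  (hZ.sub (hT.mul_contDiff (c := fun p => p.1.2.1) (by fun_prop))).congr_fun (funext fun p => by
    rw [X_eq]; ring)

lemma adm_Y (hT : Adm a (T u)) (hZ : Adm a (Z (0, 1, 0) u)) : Adm a (Y u) :=
  (hZ.add (hT.mul_contDiff (c := fun p => p.1.1) (by fun_prop))).congr_fun (funext fun p => by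
    rw [Y_eq]; ring)

end

/-! ### The linearized equation -/

section
variable {a M : ℝ} {f : ℝ → ℝ} {u ξ : ExtHeis → ℝ}

lemma setIntegral_norm_eq {F : ExtHeis → ℝ} {R : ℝ} (hF : ∀ p ∈ halfSpace, R < ‖p‖ → F p = 0) :
    ∫ p in {p | ‖p‖ ≤ R}, F p ∂wMeas a = ∫ p, F p ∂wMeas a := by
  refine setIntegral_eq_integral_of_ae_compl_eq_zero ?_
  filter_upwards [ae_mem_halfSpace a] with p hp hpR
  exact hF p hp (not_le.1 hpR)

/-- The trace inequality reduces boundary convergence to L² convergence of the quotients of u and of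
∂_y u. Both follow from `tendsto_setIntegral_dq`, as ∂_y commutes with Z. -/
lemma tendsto_trace_dq [IsLocallyFiniteMeasure (wMeas a)] (ha1 : -1 < a) (ha : a < 1)
    (hu2 : ContDiffOn ℝ 2 u halfSpace) (hu : Adm a u)
    {e : Heis} (hZ : Adm a (Z e u)) {κ : ExtHeis → ℝ} (hκ : ContDiff ℝ 1 κ)
    (hκc : HasCompactSupport κ) :
    (∀ n, Integrable fun x => trace (fun p => (dq e (step n) u p - Z e u p) * κ p) x ^ 2) ∧
    Tendsto (fun n => ∫ x, trace (fun p => (dq e (step n) u p - Z e u p) * κ p) x ^ 2)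
      atTop (𝓝 0) := by
  obtain ⟨C, hC0, htr⟩ := trace_inequality ha1 ha one_pos
  obtain ⟨R, -, hR⟩ := exists_vanish_of_compact hκc
  have cD : HasCompactSupport fun p => D 2 κ p ^ 2 :=
    HasCompactSupport.intro (hκc : IsCompact _) fun p hp => by simp [D_eq_zero_of_compact _ hp]
  obtain ⟨B, hB0, hB⟩ := exists_bound_of_compact
    (F := fun p => κ p ^ 2) (hκ.continuous.pow 2) (compact_sq hκc)
  obtain ⟨B', hB0', hB'⟩ := exists_bound_of_compact
    (F := fun p => D 2 κ p ^ 2) ((continuous_D hκ 2).pow 2) cD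
  have hD2u := contDiffOn_D 2 hu2
  have hZD : L2loc a (Z e (D 2 u)) := (hZ.grad 2).congr fun p hp =>
    Z_D_comm (hu2.contDiffAt (isOpen_halfSpace.mem_nhds hp)) e 2
  have t0 := tendsto_setIntegral_dq hu.smooth hu.l2 e hZ.l2 R
  have t2 := tendsto_setIntegral_dq hD2u (hu.grad 2) e hZD R
  have hadm : ∀ n, Adm a fun p => (dq e (step n) u p - Z e u p) * κ p := fun n =>
    ((hu.dq e _).sub hZ).mul_contDiff hκ
  have hvan : ∀ n, ∀ p ∈ halfSpace, R < ‖p‖ → (dq e (step n) u p - Z e u p) * κ p = 0 :=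
    fun n p _ hp => by rw [hR p hp, mul_zero]
  have hi0 : ∀ n, Integrable (fun p => ((dq e (step n) u p - Z e u p) * κ p) ^ 2) (wMeas a) :=
    fun n => integrable_of_vanishing (hadm n).l2.sq (R := R) fun p hp h => by
      rw [hvan n p hp h]; simp
  have hi2 : ∀ n, Integrable (fun p => D 2 (fun p => (dq e (step n) u p - Z e u p) * κ p) p ^ 2)
      (wMeas a) :=
    fun n => integrable_of_vanishing ((hadm n).grad 2).sq (R := R) fun p hp h => by
      rw [D_eq_zero_of_vanish (hvan n) 2 p hp h]; simp
  have key := fun n => htr _ (hadm n) (hi0 n) (hi2 n)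
  refine ⟨fun n => (key n).1, ?_⟩
  set I0 : ℕ → ℝ := fun n => ∫ p in {p | ‖p‖ ≤ R}, (dq e (step n) u p - Z e u p) ^ 2 ∂wMeas a
  set I2 : ℕ → ℝ := fun n =>
    ∫ p in {p | ‖p‖ ≤ R}, (dq e (step n) (D 2 u) p - Z e (D 2 u) p) ^ 2 ∂wMeas a
  have b0 : ∀ n, ∫ p, ((dq e (step n) u p - Z e u p) * κ p) ^ 2 ∂wMeas a ≤ B * I0 n := by
    intro n
    rw [← setIntegral_norm_eq (R := R) fun p hp h => by rw [hvan n p hp h]; simp,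
      ← integral_const_mul]
    refine integral_mono (hi0 n).integrableOn ((integrableOn_sq ((hu.l2.dq e _).sub hZ.l2)
      _ R fun p hp => hp).const_mul B) fun p => ?_
    simp only [mul_pow]
    nlinarith [mul_le_mul_of_nonneg_left (hB p) (sq_nonneg (dq e (step n) u p - Z e u p))]
  have b2 : ∀ n, ∫ p, D 2 (fun p => (dq e (step n) u p - Z e u p) * κ p) p ^ 2 ∂wMeas a ≤
      2 * B' * I0 n + 2 * B * I2 n := by
    intro n
    rw [← setIntegral_norm_eq (R := R) fun p hp h => by
      rw [D_eq_zero_of_vanish (hvan n) 2 p hp h]; simp]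
    have j0 : Integrable (fun p => 2 * B' * (dq e (step n) u p - Z e u p) ^ 2)
      ((wMeas a).restrict {p | ‖p‖ ≤ R}) := (integrableOn_sq (a := a) ((hu.l2.dq e (step n)).sub hZ.l2) {p | ‖p‖ ≤ R} R
      fun p hp => hp).const_mul (2 * B')
    have j2 : Integrable (fun p => 2 * B * (dq e (step n) (D 2 u) p - Z e (D 2 u) p) ^ 2)
      ((wMeas a).restrict {p | ‖p‖ ≤ R}) := (integrableOn_sq (a := a) (((hu.grad 2).dq e (step n)).sub hZD) {p | ‖p‖ ≤ R} R
      fun p hp => hp).const_mul (2 * B)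
    rw [← integral_const_mul, ← integral_const_mul, ← integral_add j0 j2]
    refine integral_mono_ae (hi2 n).integrableOn (j0.add j2) ?_
    filter_upwards [ae_restrict_of_ae (ae_mem_halfSpace a)] with p hp
    rw [D_mul 2 (((hu.dq e _).sub hZ).diff hp) (hκ.differentiable one_ne_zero p),
      D_sub 2 ((hu.dq e _).diff hp) (hZ.diff hp), D_dq hu.smooth e _ 2 hp,
      ← Z_D_comm (hu2.contDiffAt (isOpen_halfSpace.mem_nhds hp)) e 2]
    have h1 := mul_le_mul_of_nonneg_left (hB p)
      (sq_nonneg (dq e (step n) (D 2 u) p - Z e (D 2 u) p))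
    have h2 := mul_le_mul_of_nonneg_left (hB' p) (sq_nonneg (dq e (step n) u p - Z e u p))
    nlinarith [sq_nonneg ((dq e (step n) u p - Z e u p) * D 2 κ p
      - (dq e (step n) (D 2 u) p - Z e (D 2 u) p) * κ p)]
  refine squeeze_zero (fun n => integral_nonneg fun x => sq_nonneg _) (fun n =>
    (key n).2.trans (add_le_add (mul_le_mul_of_nonneg_left (b2 n) zero_le_one)
      (mul_le_mul_of_nonneg_left (b0 n) hC0.le))) ?_
  have := ((((t0.const_mul (2 * B')).add (t2.const_mul (2 * B))).const_mul 1).add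
    ((t0.const_mul B).const_mul C))
  simpa using this

/-- Increments of the trace are small only in L², so the remainder must be bounded for large |s - t|
too. Below the modulus of uniform continuity of f' the error is ε; above it, the crude bound 2|B| is
at most a multiple of |s - t|. -/
lemma exists_taylor_bound (hf : ContDiff ℝ 1 f) (M : ℝ) {ε : ℝ} (hε : 0 < ε) :
    ∃ C, 0 ≤ C ∧ ∀ s ∈ Icc (-M) M, ∀ t ∈ Icc (-M) M,
      |f s - f t - deriv f t * (s - t)| ≤ (ε + C * |s - t|) * |s - t| := by
  have hc : Continuous (deriv f) := hf.continuous_deriv le_rfl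
  obtain ⟨B, hB⟩ := (isCompact_Icc (a := -M) (b := M)).exists_bound_of_continuousOn hc.continuousOn
  have huc := (isCompact_Icc (a := -M) (b := M)).uniformContinuousOn_of_continuous hc.continuousOn
  obtain ⟨δ, hδ, hδ'⟩ := Metric.uniformContinuousOn_iff.1 huc ε hε
  refine ⟨2 * |B| / δ, by positivity, fun s hs t ht => ?_⟩
  have hmod : ∀ r ∈ Icc (-M) M, |r - t| ≤ |s - t| →
      |deriv f r - deriv f t| ≤ ε + 2 * |B| / δ * |s - t| := by
    intro r hr hrs
    rcases lt_or_ge |r - t| δ with h | h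
    · have h1 : |deriv f r - deriv f t| < ε := hδ' r hr t ht h
      have : 0 ≤ 2 * |B| / δ * |s - t| := by positivity
      linarith
    · have h1 := abs_sub (deriv f r) (deriv f t)
      have h2 : |deriv f r| ≤ |B| := (hB r hr).trans (le_abs_self B)
      have h3 : |deriv f t| ≤ |B| := (hB t ht).trans (le_abs_self B)
      have h4 : 2 * |B| ≤ 2 * |B| / δ * |s - t| := by
        rw [div_mul_eq_mul_div, le_div_iff₀ hδ]
        have := h.trans hrs
        gcongr
      linarith
  have hd : ∀ r ∈ uIcc t s, HasDerivWithinAt (fun r => f r - deriv f t * r)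
      (deriv f r - deriv f t) (uIcc t s) r := by
    intro r _
    have h1 := (hf.differentiable one_ne_zero r).hasDerivAt
    have h2 : HasDerivAt (fun r => f r - deriv f t * r) (deriv f r - deriv f t * 1) r :=
      h1.sub ((hasDerivAt_id r).const_mul (deriv f t))
    rw [mul_one] at h2
    exact h2.hasDerivWithinAt
  have := (convex_uIcc t s).norm_image_sub_le_of_norm_hasDerivWithin_le hd
    (C := ε + 2 * |B| / δ * |s - t|) (fun r hr => hmod r
      ((convex_Icc (-M) M).ordConnected.uIcc_subset ht hs hr) (abs_sub_left_of_mem_uIcc hr)) left_mem_uIcc right_mem_uIcc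
  simp only [Real.norm_eq_abs] at this
  refine le_trans (le_of_eq ?_) this
  congr 1; ring

lemma tendsto_integral_gradInner_dq [IsLocallyFiniteMeasure (wMeas a)]
    (hu2 : ContDiffOn ℝ 2 u halfSpace) (hu : Adm a u) {e : Heis} (hZ : Adm a (Z e u))
    (hξ : C1Test a ξ) :
    Tendsto (fun n => ∫ p, gradInner (dq e (step n) u) ξ p ∂wMeas a) atTop
      (𝓝 (∫ p, gradInner (Z e u) ξ p ∂wMeas a)) := by
  obtain ⟨R, -, hR⟩ := hξ.vanish
  have hi : ∀ i, Tendsto (fun n => ∫ p in {p | ‖p‖ ≤ R},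
      (dq e (step n) (D i u) p - Z e (D i u) p) * D i ξ p ∂wMeas a) atTop (𝓝 0) := by
    intro i
    have hZD : L2loc a (Z e (D i u)) := (hZ.grad i).congr fun p hp =>
      Z_D_comm (hu2.contDiffAt (isOpen_halfSpace.mem_nhds hp)) e i
    have hL := fun n => ((hu.grad i).dq e (step n)).sub hZD
    exact tendsto_integral_mul (fun n => integrableOn_sq (hL n) _ R fun p hp => hp)
      (integrableOn_sq (hξ.adm.grad i) _ R fun p hp => hp)
      (fun n => (hξ.integrable_mul_D (hL n) i).integrableOn)
      (tendsto_setIntegral_dq (contDiffOn_D i hu2) (hu.grad i) e hZD R)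
  have hsum := tendsto_finsetSum Finset.univ fun i _ => hi i
  simp only [Finset.sum_const_zero] at hsum
  have := hsum.add_const (∫ p, gradInner (Z e u) ξ p ∂wMeas a)
  rw [zero_add] at this
  refine this.congr fun n => ?_
  have hL : ∀ i, L2loc a fun p => dq e (step n) (D i u) p - Z e (D i u) p := fun i =>
    ((hu.grad i).dq e (step n)).sub ((hZ.grad i).congr fun p hp =>
      Z_D_comm (hu2.contDiffAt (isOpen_halfSpace.mem_nhds hp)) e i)
  have h1 : ∀ i, ∫ p in {p | ‖p‖ ≤ R}, (dq e (step n) (D i u) p - Z e (D i u) p) * D i ξ p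
      ∂wMeas a = ∫ p, (dq e (step n) (D i u) p - Z e (D i u) p) * D i ξ p ∂wMeas a := fun i =>
    setIntegral_norm_eq fun p hp h => by rw [D_eq_zero_of_vanish hR i p hp h, mul_zero]
  simp only [h1]
  rw [← integral_finsetSum _ fun i _ => hξ.integrable_mul_D (hL i) i,
    ← integral_add (integrable_finsetSum _ fun i _ => hξ.integrable_mul_D (hL i) i)
    (hξ.integrable_gradInner hZ)]
  refine integral_congr_ae ?_
  filter_upwards [ae_mem_halfSpace a] with p hp
  simp only [gradInner_eq_sum]
  rw [← Finset.sum_add_distrib]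
  refine Finset.sum_congr rfl fun i _ => ?_
  rw [D_dq hu.smooth e _ i hp, Z_D_comm (hu2.contDiffAt (isOpen_halfSpace.mem_nhds hp)) e i]
  ring

/-- C may depend on ε, so ε is fixed first: as n grows the bound tends to A(2s + k)ε, and the choice
of ε puts this below η. -/
lemma tendsto_zero_of_eps_bound {I ρ h : ℕ → ℝ} {A s k : ℝ} (hA : 0 ≤ A) (hs : 0 ≤ s)
    (hk : 0 ≤ k) (hρ : Tendsto ρ atTop (𝓝 0)) (hh : Tendsto h atTop (𝓝 0))
    (hb : ∀ ε > 0, ∃ C : ℝ, ∀ n, |I n| ≤ A * ((ε + C * h n) * (2 * ρ n + 2 * s) + ε * k)) :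
    Tendsto I atTop (𝓝 0) := by
  rw [tendsto_zero_iff_abs_tendsto_zero, Metric.tendsto_atTop]
  intro η hη
  set W := A * (2 * s + k) with hW
  have hW0 : 0 ≤ W := by positivity
  obtain ⟨C, hC⟩ := hb (η / (2 * (W + 1))) (by positivity)
  set ε := η / (2 * (W + 1)) with hε
  have hlim : Tendsto (fun n => A * ((ε + C * h n) * (2 * ρ n + 2 * s) + ε * k)) atTop
      (𝓝 (A * ((ε + C * 0) * (2 * 0 + 2 * s) + ε * k))) :=
    ((((hh.const_mul C).const_add ε).mul ((hρ.const_mul 2).add_const _)).add_const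
      _).const_mul _
  have hlt : A * ((ε + C * 0) * (2 * 0 + 2 * s) + ε * k) < η := by
    have h1 : A * ((ε + C * 0) * (2 * 0 + 2 * s) + ε * k) = W * ε := by rw [hW]; ring
    rw [h1, hε, mul_div_assoc', div_lt_iff₀ (by positivity)]
    nlinarith
  obtain ⟨N, hN⟩ := eventually_atTop.1 (hlim.eventually (gt_mem_nhds hlt))
  refine ⟨N, fun n hn => ?_⟩
  simp only [Function.comp, Real.dist_eq, sub_zero, abs_abs]
  exact (hC n).trans_lt (hN n hn)

/-- Here d is the trace of the quotient, z its limit, k the cutoff and Q the Taylor remainder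
divided by h. Splitting d = (d - z) + z leaves only quantities with convergent or fixed integrals.
-/
lemma taylor_remainder_aux {A C ε h d z k t Q : ℝ} (hC : 0 ≤ C) (hε : 0 < ε) (hh : 0 < h)
    (hQ : |Q| ≤ (ε + C * (h * |d|)) * |d|) (ht : |t| ≤ A * k ^ 2) (hA : 0 ≤ A) :
    |Q * t| ≤ A * ((ε + C * h) * (2 * ((d - z) * k) ^ 2 + 2 * (z * k) ^ 2) + ε * k ^ 2) := by
  have hE : 0 ≤ (ε + C * (h * |d|)) * |d| := by positivity
  rw [abs_mul]
  refine (mul_le_mul hQ ht (abs_nonneg _) hE).trans ?_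
  rw [mul_left_comm]
  refine mul_le_mul_of_nonneg_left ?_ hA
  have hdk : d ^ 2 * k ^ 2 ≤ 2 * ((d - z) * k) ^ 2 + 2 * (z * k) ^ 2 := by
    nlinarith [sq_nonneg ((d - z) * k - z * k)]
  have h11 : |d| * k ^ 2 ≤ d ^ 2 * k ^ 2 + k ^ 2 := by
    have : |d| ≤ d ^ 2 + 1 := by rw [← sq_abs d]; nlinarith [sq_nonneg (|d| - 1)]
    nlinarith [mul_le_mul_of_nonneg_right this (sq_nonneg k)]
  have h12 : (ε + C * (h * |d|)) * |d| * k ^ 2 =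
      ε * (|d| * k ^ 2) + C * h * (d ^ 2 * k ^ 2) := by
    rw [← sq_abs d]; ring
  rw [h12]
  have h13 := mul_le_mul_of_nonneg_left h11 hε.le
  have h14 := mul_le_mul_of_nonneg_left hdk (by positivity : 0 ≤ ε + C * h)
  nlinarith

lemma integrable_mul_of_sq {α : Type*} [MeasurableSpace α] {μ : Measure α} {g k : α → ℝ}
    (mg : AEStronglyMeasurable g μ) (mk : AEStronglyMeasurable k μ)
    (hg : Integrable (fun x => g x ^ 2) μ) (hk : Integrable (fun x => k x ^ 2) μ) :
    Integrable (fun x => g x * k x) μ := by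
  refine (hg.add hk).mono' (mg.mul mk) (Eventually.of_forall fun x => ?_)
  simp only [Pi.add_apply, Real.norm_eq_abs, abs_mul]
  nlinarith [sq_nonneg (|g x| - |k x|), sq_abs (g x), sq_abs (k x), abs_nonneg (g x),
    abs_nonneg (k x), mul_nonneg (abs_nonneg (g x)) (abs_nonneg (k x))]

set_option maxHeartbeats 800000 in
/-- The linearized equation, satisfied by the right-invariant derivatives. -/
lemma linearized_eq [IsLocallyFiniteMeasure (wMeas a)] (ha1 : -1 < a) (ha : a < 1)
    (hu2 : ContDiffOn ℝ 2 u halfSpace) (hu : Adm a u) (hM : ∀ p ∈ halfSpace, |u p| ≤ M)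
    (hf : ContDiff ℝ 1 f) (hweak : IsWeakSolution a f u) {e : Heis} (hZ : Adm a (Z e u))
    (hξ : C1Test a ξ) :
    Integrable (fun x => deriv f (trace u x) * (trace (Z e u) x * trace ξ x)) ∧
    ∫ p, gradInner (Z e u) ξ p ∂wMeas a =
      ∫ x, deriv f (trace u x) * (trace (Z e u) x * trace ξ x) := by
  obtain ⟨R, hR0, hR⟩ := hξ.vanish
  obtain ⟨Mξ, hMξ⟩ := hξ.bdd
  -- the boundary terms
  have hcd : Continuous (deriv f) := hf.continuous_deriv le_rfl
  obtain ⟨L, hL⟩ := (isCompact_Icc (a := -M) (b := M)).exists_bound_of_continuousOn hcd.continuousOn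
  obtain ⟨B, hB⟩ := (isCompact_Icc (a := -M) (b := M)).exists_bound_of_continuousOn
    hf.continuous.continuousOn
  have hu0 := hu.abs_trace_le ha hM
  have hLae : ∀ᵐ x : Heis, |deriv f (trace u x)| ≤ L := by
    filter_upwards [hu0] with x hx using hL _ (abs_le.1 hx)
  have hBae : ∀ᵐ x : Heis, |f (trace u x)| ≤ B := by
    filter_upwards [hu0] with x hx using hB _ (abs_le.1 hx)
  have mf' := aesm_comp_trace ha hu hcd
  have mf := aesm_comp_trace ha hu hf.continuous
  obtain ⟨κ, hκ, hκc, hκ1, hκ01⟩ := exists_cutoff R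
  obtain ⟨hrint, hr⟩ := tendsto_trace_dq ha1 ha hu2 hu hZ hκ hκc
  set r : ℕ → Heis → ℝ := fun n => trace fun p => (dq e (step n) u p - Z e u p) * κ p with hrdef
  have hadm : ∀ n, Adm a fun p => (dq e (step n) u p - Z e u p) * κ p := fun n =>
    ((hu.dq e _).sub hZ).mul_contDiff hκ
  have hκtr := fun n => ((hu.dq e (step n)).sub hZ).trace_mul ha hκ.continuous
  -- the square integrable traces
  have hZκ := hZ.mul_contDiff hκ
  have hzint : Integrable fun x => trace (fun p => Z e u p * κ p) x ^ 2 := by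
    obtain ⟨C, -, htr⟩ := trace_inequality ha1 ha one_pos
    obtain ⟨R', -, hR'⟩ := exists_vanish_of_compact hκc
    have hvan : ∀ p ∈ halfSpace, R' < ‖p‖ → Z e u p * κ p = 0 := fun p _ h => by
      rw [hR' p h, mul_zero]
    exact (htr _ hZκ (integrable_of_vanishing hZκ.l2.sq (R := R') fun p hp h => by
      rw [hvan p hp h]; simp) (integrable_of_vanishing (hZκ.grad 2).sq (R := R') fun p hp h => by
      rw [D_eq_zero_of_vanish hvan 2 p hp h]; simp)).1
  have hξint : Integrable fun x => (deriv f (trace u x) * trace ξ x) ^ 2 := by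
    have h1 := hξ.integrable_mul_trace ha (g := fun x => deriv f (trace u x) ^ 2 * trace ξ x)
      ((mf'.pow 2).mul (hξ.adm.aesm_trace ha)) (B := L ^ 2 * Mξ) (by
        filter_upwards [hLae, hξ.adm.abs_trace_le ha hMξ] with x h1 h2
        rw [abs_mul, abs_pow]
        have := abs_nonneg (trace ξ x)
        gcongr)
    refine h1.congr (Eventually.of_forall fun x => ?_)
    simp only; ring
  have hξκ : ∀ᵐ x : Heis, trace ξ x = trace ξ x * κ (x, 0) := by
    filter_upwards [hξ.adm.trace_eq_zero ha hR] with x hx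
    rcases le_or_gt ‖x‖ R with h | h
    · rw [hκ1 (x, 0) (by rw [Prod.norm_def]; exact max_le h (by simpa using hR0.le)), mul_one]
    · rw [hx h, zero_mul]
  have mr : ∀ n, AEStronglyMeasurable (r n) volume := fun n => (hadm n).aesm_trace ha
  have mfξ : AEStronglyMeasurable (fun x => deriv f (trace u x) * trace ξ x) volume :=
    mf'.mul (hξ.adm.aesm_trace ha)
  have irn := fun n => integrable_mul_of_sq (mr n) mfξ (hrint n) hξint
  -- The first-order part f'(u)(d - z)ξ vanishes in the limit by Cauchy–Schwarz and the L²
  -- convergence of traces.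
  have t1 : Tendsto (fun n => ∫ x, r n x * (deriv f (trace u x) * trace ξ x)) atTop (𝓝 0) :=
    tendsto_integral_mul hrint hξint irn hr
  have izξ : Integrable fun x => deriv f (trace u x) * (trace (Z e u) x * trace ξ x) := by
    refine (integrable_mul_of_sq (hZκ.aesm_trace ha) mfξ hzint hξint).congr ?_
    filter_upwards [hZ.trace_mul ha hκ.continuous, hξκ] with x h1 h2
    rw [h1]
    conv_rhs => rw [h2]
    ring
  refine ⟨izξ, tendsto_nhds_unique (tendsto_integral_gradInner_dq hu2 hu hZ hξ) ?_⟩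
  set c : ℕ → Heis → ℝ := fun n x =>
    (f (trace u (tauH e (step n) x)) - f (trace u x)) / step n with hcdef
  have mc : ∀ n, AEStronglyMeasurable (c n) volume := fun n => by
    simp only [hcdef, div_eq_mul_inv]
    exact ((mf.comp_measurePreserving (measurePreserving_tauH e _)).sub mf).mul_const _
  have icξ : ∀ n, Integrable fun x => c n x * trace ξ x := fun n => by
    refine hξ.integrable_mul_trace ha (mc n) (B := (B + B) / step n) ?_
    filter_upwards [hBae, ae_tauH hBae e (step n)] with x h1 h2
    simp only [hcdef]
    rw [abs_div, abs_of_pos (step_pos n)]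
    have := step_pos n
    gcongr
    exact (abs_sub _ _).trans (add_le_add h2 h1)
  -- remainder of the Taylor expansion
  set q : ℕ → Heis → ℝ := fun n x => c n x * trace ξ x
    - deriv f (trace u x) * (trace (Z e u) x * trace ξ x)
    - r n x * (deriv f (trace u x) * trace ξ x) with hqdef
  have iq : ∀ n, Integrable (q n) := fun n => ((icξ n).sub izξ).sub (irn n)
  have cκ2 : HasCompactSupport fun x : Heis => κ (x, 0) ^ 2 := by
    obtain ⟨R', -, hR'⟩ := exists_vanish_of_compact hκc
    refine HasCompactSupport.intro (isCompact_closedBall (0 : Heis) R') fun x hx => ?_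
    rw [hR' (x, 0) (lt_of_lt_of_le (by simpa using hx) (norm_fst_le (x, (0 : ℝ))))]; simp
  have iκ : Integrable fun x : Heis => κ (x, 0) ^ 2 :=
    ((hκ.continuous.comp (by fun_prop : Continuous fun x : Heis => ((x, (0 : ℝ)) : ExtHeis))).pow
      2).integrable_of_hasCompactSupport cκ2
  set S : Heis → ℝ := fun x => trace (fun p => Z e u p * κ p) x ^ 2 with hS
  have hqb : ∀ ε > 0, ∃ C, 0 ≤ C ∧ ∀ n, ∀ᵐ x, |q n x| ≤ |Mξ| *
      ((ε + C * step n) * (2 * r n x ^ 2 + 2 * S x) + ε * κ (x, 0) ^ 2) := by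
    intro ε hε
    obtain ⟨C, hC0, hC⟩ := exists_taylor_bound hf M hε
    refine ⟨C, hC0, fun n => ?_⟩
    filter_upwards [hu0, ae_tauH hu0 e (step n), hκtr n, hu.trace_dq ha e (step n),
      (hu.dq e (step n)).tendsto ha, hZ.tendsto ha,
      hZ.trace_mul ha hκ.continuous, hξκ, hξ.adm.abs_trace_le ha hMξ]
      with x h1 h2 h3 h4 h5 h6 h7 h8 h9
    have h10 : trace (fun p => dq e (step n) u p - Z e u p) x =
        trace (dq e (step n) u) x - trace (Z e u) x := tendsto_trace (h5.sub h6)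
    have hh := step_pos n
    set k := κ (x, 0) with hk
    set d := trace (dq e (step n) u) x with hd
    set z := trace (Z e u) x with hz
    have hrx : r n x = (d - z) * k := by rw [hrdef]; simp only; rw [h3, h10]
    have hSx : S x = (z * k) ^ 2 := by rw [hS]; simp only; rw [h7]
    have hkk : |k| ≤ 1 := abs_le.2 ⟨by linarith [(hκ01 (x, 0)).1], (hκ01 (x, 0)).2⟩
    have hsd : trace u (tauH e (step n) x) - trace u x = step n * d := by
      rw [h4]; field_simp
    have hT := hC _ (abs_le.1 h2) _ (abs_le.1 h1)
    rw [hsd, abs_mul, abs_of_pos hh] at hT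
    -- The trace of ξ is unchanged by multiplication with κ, so the cutoffs drop out and only the
    -- Taylor remainder of f along the quotient survives.
    have hq : q n x = (c n x - deriv f (trace u x) * d) * trace ξ x := by
      rw [hqdef]; simp only; rw [hrx, h8]
      have hk2 : trace ξ x * k * k = trace ξ x * k := by rw [← h8, ← h8]
      linear_combination (deriv f (trace u x)) * (d - z) * (-hk2)
    have hcb : |c n x - deriv f (trace u x) * d| ≤ (ε + C * (step n * |d|)) * |d| := by
      have : c n x - deriv f (trace u x) * d = (f (trace u (tauH e (step n) x)) - f (trace u x)
          - deriv f (trace u x) * (step n * d)) / step n := by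
        rw [hcdef]; field_simp
      rw [this, abs_div, abs_of_pos hh, div_le_iff₀ hh]
      linarith
    have hξb : |trace ξ x| ≤ |Mξ| * k ^ 2 := by
      have hk2 : trace ξ x = trace ξ x * k ^ 2 := by
        rw [sq, ← mul_assoc, ← h8, ← h8]
      rw [hk2, abs_mul, abs_of_nonneg (sq_nonneg k)]
      exact mul_le_mul_of_nonneg_right (h9.trans (le_abs_self _)) (sq_nonneg k)
    rw [hq, hrx, hSx]
    exact taylor_remainder_aux hC0 hε hh hcb hξb (abs_nonneg _)
  have hqt : Tendsto (fun n => ∫ x, q n x) atTop (𝓝 0) := by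
    set s := ∫ x, S x
    set k := ∫ x : Heis, κ (x, 0) ^ 2
    have hs0 : 0 ≤ s := integral_nonneg fun x => sq_nonneg _
    have hk0 : 0 ≤ k := integral_nonneg fun x => sq_nonneg _
    have hint : ∀ ε > 0, ∃ C : ℝ, ∀ n, |∫ x, q n x| ≤ |Mξ| *
        ((ε + C * step n) * (2 * (∫ x, r n x ^ 2) + 2 * s) + ε * k) := by
      intro ε hε
      obtain ⟨C, -, hC⟩ := hqb ε hε
      refine ⟨C, fun n => abs_integral_le_integral_abs.trans ?_⟩
      have i1 : Integrable fun x => 2 * r n x ^ 2 + 2 * S x :=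
        ((hrint n).const_mul 2).add (hzint.const_mul 2)
      refine (integral_mono_ae (iq n).abs (((i1.const_mul _).add (iκ.const_mul ε)).const_mul _)
        (hC n)).trans (le_of_eq ?_)
      rw [integral_const_mul]
      simp only [Pi.add_apply]
      rw [integral_add (i1.const_mul _) (iκ.const_mul ε), integral_const_mul, integral_const_mul,
        integral_add ((hrint n).const_mul 2) (hzint.const_mul 2), integral_const_mul,
        integral_const_mul]
    exact tendsto_zero_of_eps_bound (abs_nonneg Mξ) hs0 hk0 hr tendsto_step hint
  have hsum := (hqt.add t1).add_const
    (∫ x, deriv f (trace u x) * (trace (Z e u) x * trace ξ x))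
  simp only [add_zero, zero_add] at hsum
  refine hsum.congr fun n => ?_
  have iqr : Integrable fun x => q n x + r n x * (deriv f (trace u x) * trace ξ x) :=
    (iq n).add (irn n)
  rw [weak_eq_dq ha hu hM hf.continuous hweak hξ e (step n), ← integral_add (iq n) (irn n),
    ← integral_add iqr izξ]
  refine integral_congr_ae (Eventually.of_forall fun x => ?_)
  simp only [hqdef, hcdef]
  ring

end

/-! ### The pointwise identity -/

section
variable {a M : ℝ} {f : ℝ → ℝ} {u ξ v φ : ExtHeis → ℝ} {p : ExtHeis}

lemma hGradNorm_sq (u : ExtHeis → ℝ) (p : ExtHeis) :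
    hGradNorm u p ^ 2 = X u p ^ 2 + Y u p ^ 2 := Real.sq_sqrt (by positivity)

lemma hGrad_ne_zero : hGrad u p ≠ 0 ↔ X u p ^ 2 + Y u p ^ 2 ≠ 0 := by
  rw [not_iff_not]
  constructor
  · intro h
    have h0 := congrFun h 0
    have h1 := congrFun h 1
    simp only [hGrad, Matrix.cons_val_zero, Matrix.cons_val_one, Pi.zero_apply] at h0 h1
    rw [h0, h1]; ring
  · intro h
    have h0 : X u p = 0 := by nlinarith [sq_nonneg (X u p), sq_nonneg (Y u p)]
    have h1 : Y u p = 0 := by nlinarith [sq_nonneg (X u p), sq_nonneg (Y u p)]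
    ext i; fin_cases i <;> simp [hGrad, h0, h1]

lemma hGradNorm_pos (h : hGrad u p ≠ 0) : 0 < hGradNorm u p :=
  Real.sqrt_pos.2 (lt_of_le_of_ne (by positivity) (hGrad_ne_zero.1 h).symm)

lemma hessNorm_sq (u : ExtHeis → ℝ) (p : ExtHeis) :
    hessNorm u p ^ 2 = X (X u) p ^ 2 + Y (X u) p ^ 2 + X (Y u) p ^ 2 + Y (Y u) p ^ 2 :=
  Real.sq_sqrt (by positivity)

lemma hessSq_normal (h : hGrad u p ≠ 0) : (hessSq u p *ᵥ normal u p) ⬝ᵥ normal u p =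
    ((X (X u) p * X u p + X (Y u) p * Y u p) ^ 2 +
      (Y (X u) p * X u p + Y (Y u) p * Y u p) ^ 2) / hGradNorm u p ^ 2 := by
  have := hGradNorm_pos h
  simp [hessSq, hess, normal, dotProduct, Matrix.mulVec, Matrix.mul_apply, Fin.sum_univ_two]
  field_simp
  ring

lemma hasFDerivAt_hGradNorm (hX : DifferentiableAt ℝ (X u) p) (hY : DifferentiableAt ℝ (Y u) p)
    (h : hGrad u p ≠ 0) : DifferentiableAt ℝ (hGradNorm u) p ∧
      ∀ w, fderiv ℝ (hGradNorm u) p w =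
        (X u p * fderiv ℝ (X u) p w + Y u p * fderiv ℝ (Y u) p w) / hGradNorm u p := by
  have h1 := ((hX.hasFDerivAt.pow 2).add (hY.hasFDerivAt.pow 2)).sqrt (hGrad_ne_zero.1 h)
  have h2 : HasFDerivAt (hGradNorm u) _ p := h1
  refine ⟨h2.differentiableAt, fun w => ?_⟩
  rw [h2.fderiv]
  have := hGradNorm_pos h
  change _ = _ / √(X u p ^ 2 + Y u p ^ 2)
  have h3 : 0 < √(X u p ^ 2 + Y u p ^ 2) := this
  simp
  field_simp

lemma fderiv_quot {g k : ExtHeis → ℝ} (hg : DifferentiableAt ℝ g p) (hk : DifferentiableAt ℝ k p)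
    (h0 : k p ≠ 0) (w : ExtHeis) : fderiv ℝ (fun q => g q / k q) p w =
      (fderiv ℝ g p w * k p - g p * fderiv ℝ k p w) / k p ^ 2 := by
  have h1 : HasFDerivAt (fun q => (k q)⁻¹) _ p :=
    (hasDerivAt_inv h0).comp_hasFDerivAt p hk.hasFDerivAt
  simp only [div_eq_mul_inv]
  rw [(hg.hasFDerivAt.fun_mul h1).fderiv]
  simp
  field_simp
  ring

/-- In the basis (ν, v), h|∇_ℍ u| = ⟨Hu v, v⟩, while p|∇_ℍ u| = -Tu turns ⟨Hu v, ν⟩ into ⟨Hu ν, v⟩.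
The squares add up to |(Hu)ᵀv|² = |Hu|² - |(Hu)ᵀν|², and the Tν term is the commutator term. -/
lemma density_identity (hu : ContDiffOn ℝ 2 u halfSpace) (hp : p ∈ regularSet u) :
    analyticDensity u p = hGradNorm u p ^ 2 * curvatureDensity u p := by
  obtain ⟨hp0, hreg⟩ := hp
  have hX := differentiableAt_of_mem (contDiffOn_D 0 hu) hp0
  have hY := differentiableAt_of_mem (contDiffOn_D 1 hu) hp0
  rw [D_zero] at hX
  rw [D_one] at hY
  obtain ⟨hN, hN'⟩ := hasFDerivAt_hGradNorm hX hY hreg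
  have hNpos := hGradNorm_pos hreg
  have hsq := hGradNorm_sq u p
  have hT := T_eq_commutator (hu.contDiffAt (isOpen_halfSpace.mem_nhds hp0))
  have n0 : (fun q => normal u q 0) = fun q => X u q / hGradNorm u q := by
    funext q; simp [normal]
  have n1 : (fun q => normal u q 1) = fun q => Y u q / hGradNorm u q := by
    funext q; simp [normal]
  have e0 : ∀ w, fderiv ℝ (fun q => normal u q 0) p w =
      Y u p * (fderiv ℝ (X u) p w * Y u p - X u p * fderiv ℝ (Y u) p w) / hGradNorm u p ^ 3 := by
    intro w
    rw [n0, fderiv_quot hX hN hNpos.ne', hN', eq_div_iff (by positivity)]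
    field_simp
    rw [hsq]; ring
  have e1 : ∀ w, fderiv ℝ (fun q => normal u q 1) p w =
      X u p * (fderiv ℝ (Y u) p w * X u p - Y u p * fderiv ℝ (X u) p w) / hGradNorm u p ^ 3 := by
    intro w
    rw [n1, fderiv_quot hY hN hNpos.ne', hN', eq_div_iff (by positivity)]
    field_simp
    rw [hsq]; ring
  have hmc : meanCurvature u p = (Y u p * (X (X u) p * Y u p - X u p * X (Y u) p) +
      X u p * (Y (Y u) p * X u p - Y u p * Y (X u) p)) / hGradNorm u p ^ 3 := by
    rw [add_div]
    exact congrArg₂ (· + ·) (e0 _) (e1 _)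
  have hTn : TNormal u p ⬝ᵥ tangent u p =
      (T (X u) p * Y u p - T (Y u) p * X u p) / hGradNorm u p ^ 2 := by
    have h0 : T (fun q => normal u q 0) p = Y u p * (T (X u) p * Y u p - X u p * T (Y u) p)
      / hGradNorm u p ^ 3 := e0 _
    have h1 : T (fun q => normal u q 1) p = X u p * (T (Y u) p * X u p - Y u p * T (X u) p)
      / hGradNorm u p ^ 3 := e1 _
    simp only [TNormal, tangent, dotProduct, Fin.sum_univ_two, Matrix.cons_val_zero,
      Matrix.cons_val_one, h0, h1]
    rw [eq_div_iff (by positivity)]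
    field_simp
    rw [hsq]; ring
  have hHv : (hess u p *ᵥ tangent u p) ⬝ᵥ normal u p =
      ((X (X u) p * Y u p - Y (X u) p * X u p) * X u p +
        (X (Y u) p * Y u p - Y (Y u) p * X u p) * Y u p) / hGradNorm u p ^ 2 := by
    simp [hess, tangent, normal, dotProduct, Matrix.mulVec, Fin.sum_univ_two]
    field_simp
    ring
  rw [analyticDensity, curvatureDensity, hmc, hTn, hHv, hessSq_normal hreg, hessNorm_sq, imaginaryCurvature, hT]
  generalize X (X u) p = x0 at *
  generalize Y (X u) p = x1 at *
  generalize X (Y u) p = y0 at *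
  generalize Y (Y u) p = y1 at *
  generalize T (X u) p = xT at *
  generalize T (Y u) p = yT at *
  generalize X u p = x at *
  generalize Y u p = y at *
  generalize hGradNorm u p = N at *
  -- Tu has been replaced by the commutator y0 - x1; the numerator is then that of ⟨Hu ν, v⟩.
  have q1 : -(y0 - x1) / N + ((x0 * y - x1 * x) * x + (y0 * y - y1 * x) * y) / N ^ 2 / N =
      (-(y0 * x ^ 2) + x1 * y ^ 2 + x0 * x * y - y1 * x * y) / N ^ 3 := by
    rw [eq_div_iff (by positivity)]
    field_simp
    rw [hsq]; ring
  rw [q1]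
  have h6 : N ^ 2 * (((y * (x0 * y - x * y0) + x * (y1 * x - y * x1)) / N ^ 3) ^ 2
      + ((-(y0 * x ^ 2) + x1 * y ^ 2 + x0 * x * y - y1 * x * y) / N ^ 3) ^ 2
      + 2 * ((xT * y - yT * x) / N ^ 2)) =
      ((y * (x0 * y - x * y0) + x * (y1 * x - y * x1)) ^ 2
      + (-(y0 * x ^ 2) + x1 * y ^ 2 + x0 * x * y - y1 * x * y) ^ 2) / (N ^ 2) ^ 2
      + 2 * (xT * y - yT * x) := by
    field_simp
  rw [h6, hsq]
  have hpos : x ^ 2 + y ^ 2 ≠ 0 := by rw [← hsq]; positivity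
  field_simp
  ring

/-! ### The equations for the horizontal derivatives -/

lemma C1Test.mul_contDiff {c : ExtHeis → ℝ} (hξ : C1Test a ξ) (hc : ContDiff ℝ 1 c) :
    C1Test a fun p => ξ p * c p := by
  obtain ⟨M, hM⟩ := hξ.bdd
  obtain ⟨R, hR0, hR⟩ := hξ.vanish
  obtain ⟨C, hC⟩ := ((LocBdd.of_bound hM).mul (LocBdd.of_continuous hc.continuous)) R
  refine ⟨hξ.adm.mul_contDiff hc, ⟨|C|, fun p hp => ?_⟩, R, hR0, fun p hp h => by
    simp [hR p hp h]⟩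
  rcases le_or_gt ‖p‖ R with h | h
  · exact (hC p hp h).trans (le_abs_self _)
  · simp [hR p hp h]

/-- Horizontal fields are tangent to the slices and the weight depends on y only, so no boundary or
weight term appears; this fails for ∂_y. -/
lemma integral_mul_D (hv : Adm a v) (hξ : C1Test a ξ) {i : Fin 3} (hi : i ≠ 2) :
    ∫ p, v p * D i ξ p ∂wMeas a = -∫ p, D i v p * ξ p ∂wMeas a := by
  obtain ⟨R, -, hR⟩ := hξ.vanish
  have i1 := hξ.integrable_mul_D hv.l2 i
  have i2 := hξ.integrable_mul (hv.grad i)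
  have i12 : Integrable (fun p => v p * D i ξ p + D i v p * ξ p) (wMeas a) := i1.add i2
  have h1 : ∫ p, (v p * D i ξ p + D i v p * ξ p) ∂wMeas a = 0 := by
    rw [integral_wMeas_slices i12]
    refine integral_eq_zero_of_ae ?_
    filter_upwards [ae_mem_Ioi a] with y hy
    have h2 := integral_slice_D (g := fun p => v p * ξ p) (hv.smooth.mul hξ.adm.smooth) hy
      (compact_slice_of_vanish (F := fun p => v p * ξ p) (R := R)
        (fun p hp h => by rw [hR p hp h, mul_zero]) hy) hi
    have h3 : ∀ x : Heis, v (x, y) * D i ξ (x, y) + D i v (x, y) * ξ (x, y) =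
        D i (fun p => v p * ξ p) (x, y) := fun x =>
      (D_mul (p := (x, y)) i (hv.diff hy) (hξ.adm.diff hy)).symm
    simpa only [h3, Pi.zero_apply] using h2
  rw [integral_add i1 i2] at h1
  linarith

/-- The equation for a horizontal derivative `W = Z u + c T u`. -/
lemma horizontal_eq [IsLocallyFiniteMeasure (wMeas a)] (ha1 : -1 < a) (ha : a < 1)
    (hu2 : ContDiffOn ℝ 2 u halfSpace) (hu : Adm a u) (hM : ∀ p ∈ halfSpace, |u p| ≤ M)
    (hf : ContDiff ℝ 1 f) (hweak : IsWeakSolution a f u) (hT : Adm a (T u)) {e : Heis}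
    (hZ : Adm a (Z e u)) (hξ : C1Test a ξ) {c : ExtHeis → ℝ} (hc : ContDiff ℝ 1 c) {j : Fin 3}
    (hj : j ≠ 2) {s : ℝ} (hD : ∀ i p, D i c p = if i = j then s else 0)
    {W : ExtHeis → ℝ} (hW : ∀ p, W p = Z e u p + T u p * c p) :
    Integrable (fun x => deriv f (trace u x) * (trace W x * trace ξ x)) ∧
    ∫ p, gradInner W ξ p ∂wMeas a =
      (∫ x, deriv f (trace u x) * (trace W x * trace ξ x))
        - 2 * s * ∫ p, T (D j u) p * ξ p ∂wMeas a := by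
  have hξc := hξ.mul_contDiff hc
  obtain ⟨iZ, eZ⟩ := linearized_eq ha1 ha hu2 hu hM hf hweak hZ hξ
  obtain ⟨iT, eT⟩ := linearized_eq ha1 ha hu2 hu hM hf hweak (e := (0, 0, -4))
    (by rwa [← T_eq_Z]) hξc
  rw [← T_eq_Z] at iT eT
  have htr : ∀ᵐ x : Heis, deriv f (trace u x) * (trace W x * trace ξ x) =
      deriv f (trace u x) * (trace (Z e u) x * trace ξ x) +
      deriv f (trace u x) * (trace (T u) x * trace (fun p => ξ p * c p) x) := by
    filter_upwards [hZ.tendsto ha, (hT.mul_contDiff hc).tendsto ha, hT.trace_mul ha hc.continuous,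
      hξ.adm.trace_mul ha hc.continuous] with x h1 h2 h3 h4
    have h5 : trace W x = trace (Z e u) x + trace (fun p => T u p * c p) x := by
      rw [show W = fun p => Z e u p + T u p * c p from funext hW]
      exact tendsto_trace (h1.add h2)
    rw [h5, h3, h4]; ring
  have iZT : Integrable fun x => deriv f (trace u x) * (trace (Z e u) x * trace ξ x) +
      deriv f (trace u x) * (trace (T u) x * trace (fun p => ξ p * c p) x) := iZ.add iT
  refine ⟨iZT.congr (htr.mono fun x hx => hx.symm), ?_⟩
  -- The equation of Tu is tested with cξ. Since ∇c is s times the j-th frame vector, moving c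
  -- across leaves s(Tu D_jξ - D_jTu ξ), and integrating by parts doubles the second term.
  have hgrad : ∀ᵐ p ∂wMeas a, gradInner W ξ p =
      gradInner (Z e u) ξ p + gradInner (T u) (fun p => ξ p * c p) p
        + (s * (T u p * D j ξ p) - s * (D j (T u) p * ξ p)) := by
    filter_upwards [ae_mem_halfSpace a] with p hp
    have hcd := hc.differentiable one_ne_zero p
    have h1 : ∀ i, D i W p = D i (Z e u) p + (T u p * D i c p + D i (T u) p * c p) := by
      intro i
      rw [show W = fun p => Z e u p + T u p * c p from funext hW,
        D_add i (hZ.diff hp) ((hT.mul_contDiff hc).diff hp), D_mul i (hT.diff hp) hcd]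
    have h2 : ∀ i, D i (fun p => ξ p * c p) p = ξ p * D i c p + D i ξ p * c p := fun i =>
      D_mul i (hξ.adm.diff hp) hcd
    rw [gradInner_eq_sum, gradInner_eq_sum, gradInner_eq_sum]
    simp only [h1, h2, hD, Fin.sum_univ_three]
    fin_cases j
    · simp; ring
    · simp; ring
    · exact absurd rfl hj
  have i1 := hξ.integrable_gradInner hZ
  have i2 := hξc.integrable_gradInner hT
  have i3 := (hξ.integrable_mul_D hT.l2 j).const_mul s
  have i4 := (hξ.integrable_mul (hT.grad j)).const_mul s
  have i12 : Integrable (fun p => gradInner (Z e u) ξ p +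
      gradInner (T u) (fun p => ξ p * c p) p) (wMeas a) := i1.add i2
  have i34 : Integrable (fun p => s * (T u p * D j ξ p) - s * (D j (T u) p * ξ p)) (wMeas a) :=
    i3.sub i4
  have hcomm : ∫ p, T (D j u) p * ξ p ∂wMeas a = ∫ p, D j (T u) p * ξ p ∂wMeas a := by
    refine integral_congr_ae ?_
    filter_upwards [ae_mem_halfSpace a] with p hp
    rw [T_D_comm (hu2.contDiffAt (isOpen_halfSpace.mem_nhds hp))]
  rw [integral_congr_ae hgrad, integral_add i12 i34, integral_add i1 i2, integral_sub i3 i4,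
    integral_const_mul, integral_const_mul, integral_mul_D hT hξ hj, integral_congr_ae htr,
    integral_add iZ iT, eZ, eT, hcomm]
  ring

end

/-! ### The length of a pair of test functions as a test function -/

section
variable {a M : ℝ} {f : ℝ → ℝ} {u v φ A B : ExtHeis → ℝ} {p : ExtHeis}

/-- The length of the vector `(A, B)`. -/
noncomputable def pairNorm (A B : ExtHeis → ℝ) (p : ExtHeis) : ℝ := √(A p ^ 2 + B p ^ 2)

lemma pairNorm_sq (A B : ExtHeis → ℝ) (p : ExtHeis) : pairNorm A B p ^ 2 = A p ^ 2 + B p ^ 2 :=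
  Real.sq_sqrt (by positivity)

/-- A zero of the length is a minimum, so Fermat applies. At a corner `fderiv` is 0 by convention,
so the formula holds without differentiability. -/
lemma D_pairNorm_eq_zero (h : pairNorm A B p = 0) (i : Fin 3) : D i (pairNorm A B) p = 0 := by
  have : IsLocalMin (pairNorm A B) p := Eventually.of_forall fun q => by
    rw [h]; exact Real.sqrt_nonneg _
  rw [D, this.fderiv_eq_zero]; rfl

lemma pairNorm_mul_D (hA : DifferentiableAt ℝ A p) (hB : DifferentiableAt ℝ B p)
    (h : pairNorm A B p ≠ 0) (i : Fin 3) :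
    pairNorm A B p * D i (pairNorm A B) p = A p * D i A p + B p * D i B p := by
  have h0 : A p ^ 2 + B p ^ 2 ≠ 0 := by rw [← pairNorm_sq]; positivity
  have h1 := ((hA.hasFDerivAt.pow 2).add (hB.hasFDerivAt.pow 2)).sqrt h0
  have h2 : HasFDerivAt (pairNorm A B) _ p := h1
  have h3 : √(A p ^ 2 + B p ^ 2) ≠ 0 := h
  rw [D, D, D, h2.fderiv]
  change √(A p ^ 2 + B p ^ 2) * _ = _
  simp
  field_simp

/-- Lagrange's identity for the gradient of the length. -/
lemma gradSq_pairNorm_add (hA : DifferentiableAt ℝ A p) (hB : DifferentiableAt ℝ B p)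
    (h : pairNorm A B p ≠ 0) : gradSq (pairNorm A B) p +
      (∑ i, (A p * D i B p - B p * D i A p) ^ 2) / (A p ^ 2 + B p ^ 2) =
      gradSq A p + gradSq B p := by
  have h0 : A p ^ 2 + B p ^ 2 ≠ 0 := by rw [← pairNorm_sq]; positivity
  have h1 : ∀ i, D i (pairNorm A B) p ^ 2 =
      (A p * D i A p + B p * D i B p) ^ 2 / (A p ^ 2 + B p ^ 2) := fun i => by
    rw [← pairNorm_mul_D hA hB h, ← pairNorm_sq]
    field_simp
  rw [gradSq_eq, gradSq_eq, gradSq_eq]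
  simp only [h1, Fin.sum_univ_three]
  field_simp
  ring

lemma gradSq_pairNorm_le (hA : DifferentiableAt ℝ A p) (hB : DifferentiableAt ℝ B p) :
    gradSq (pairNorm A B) p ≤ gradSq A p + gradSq B p := by
  by_cases h : pairNorm A B p = 0
  · rw [gradSq_eq]
    simp only [D_pairNorm_eq_zero h]
    have := gradSq_nonneg A p
    have := gradSq_nonneg B p
    simpa using by linarith
  · rw [← gradSq_pairNorm_add hA hB h]
    have : 0 ≤ (∑ i, (A p * D i B p - B p * D i A p) ^ 2) / (A p ^ 2 + B p ^ 2) := by positivity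
    linarith

lemma measurable_gradSq (v : ExtHeis → ℝ) : Measurable (gradSq v) := by
  rw [show gradSq v = fun p => ∑ i, D i v p ^ 2 from funext fun p => gradSq_eq v p]
  exact Finset.measurable_sum _ fun i _ => (measurable_D v i).pow_const 2

lemma C1Test.integrable_gradSq_pairNorm (hA : C1Test a A) (hB : C1Test a B) :
    Integrable (gradSq (pairNorm A B)) (wMeas a) := by
  refine ((hA.integrable_gradInner hA.adm).add (hB.integrable_gradInner hB.adm)).mono'
    (measurable_gradSq _).aestronglyMeasurable ?_
  filter_upwards [ae_mem_halfSpace a] with p hp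
  rw [Real.norm_eq_abs, abs_of_nonneg (gradSq_nonneg _ _)]
  exact gradSq_pairNorm_le (hA.adm.diff hp) (hB.adm.diff hp)

lemma C1Test.isTestFunction_pairNorm (hA : C1Test a A) (hB : C1Test a B) :
    IsTestFunction a (pairNorm A B) := by
  obtain ⟨R, hR0, hR⟩ := hA.vanish
  obtain ⟨R', -, hR'⟩ := hB.vanish
  obtain ⟨C, hC⟩ := hA.bdd
  obtain ⟨C', hC'⟩ := hB.bdd
  refine ⟨⟨|C| + |C'|, fun p hp => ?_⟩, ?_, 3 * max R R', by positivity, ?_, ?_⟩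
  · rw [pairNorm, abs_of_nonneg (Real.sqrt_nonneg _)]
    refine Real.sqrt_le_iff.2 ⟨by positivity, ?_⟩
    have h1 := sq_le_sq' (abs_le.1 ((hC p hp).trans (le_abs_self _))).1
      ((le_abs_self _).trans ((hC p hp).trans (le_abs_self _)))
    have h2 := sq_le_sq' (abs_le.1 ((hC' p hp).trans (le_abs_self _))).1
      ((le_abs_self _).trans ((hC' p hp).trans (le_abs_self _)))
    nlinarith [mul_nonneg (abs_nonneg C) (abs_nonneg C')]
  -- The square root is not Lipschitz at 0, so the length is written as the modulus of the `C¹`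
  -- function A + iB and the norm is 1-Lipschitz.
  · have h1 : pairNorm A B = fun p => ‖((A p : ℂ) + B p * Complex.I)‖ := by
      funext p; rw [Complex.norm_add_mul_I]; rfl
    have h2 : ContDiffOn ℝ 1 (fun p => (A p : ℂ) + B p * Complex.I) halfSpace :=
      (Complex.ofRealCLM.contDiff.comp_contDiffOn hA.adm.smooth).add
        ((Complex.ofRealCLM.contDiff.comp_contDiffOn hB.adm.smooth).mul contDiffOn_const)
    intro p hp
    obtain ⟨K, t, ht, hK⟩ := (h2.contDiffAt
      (isOpen_halfSpace.mem_nhds hp)).exists_lipschitzOnWith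
    refine ⟨1 * K, t, mem_nhdsWithin_of_mem_nhds ht, ?_⟩
    rw [h1]
    exact lipschitzWith_one_norm.comp_lipschitzOnWith hK
  · rintro p ⟨hp, hp'⟩
    have h : max R R' < ‖p‖ := not_le.1 fun hle =>
      hp' (mem_halfBall_of_norm (lt_max_of_lt_left hR0) hp hle)
    rw [pairNorm, hR p hp ((le_max_left _ _).trans_lt h), hR' p hp ((le_max_right _ _).trans_lt h)]
    simp
  · exact (integrableOn_wMeas a (measurableSet_halfBall _) fun p hp => hp.1).1
      (hA.integrable_gradSq_pairNorm hB).integrableOn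

lemma trace_pairNorm (hA : Adm a A) (hB : Adm a B) (ha : a < 1) :
    ∀ᵐ x : Heis, trace (pairNorm A B) x ^ 2 = trace A x ^ 2 + trace B x ^ 2 := by
  filter_upwards [hA.tendsto ha, hB.tendsto ha] with x h1 h2
  have h3 : trace (pairNorm A B) x = √(trace A x ^ 2 + trace B x ^ 2) :=
    tendsto_trace (((h1.pow 2).add (h2.pow 2)).sqrt)
  rw [h3, Real.sq_sqrt (by positivity)]

/-! ### The energy of the horizontal gradient -/

lemma gradSq_mul (hv : DifferentiableAt ℝ v p) (hφ : DifferentiableAt ℝ φ p) :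
    gradSq (fun q => v q * φ q) p =
      gradInner v (fun q => v q * φ q ^ 2) p + v p ^ 2 * gradSq φ p := by
  have h1 : ∀ i, D i (fun q => v q * φ q) p = v p * D i φ p + D i v p * φ p := fun i =>
    D_mul i hv hφ
  have h2 : ∀ i, D i (fun q => v q * φ q ^ 2) p =
      v p * (2 * φ p * D i φ p) + D i v p * φ p ^ 2 := fun i => by
    have h3 : D i (fun q => φ q * φ q) p = φ p * D i φ p + D i φ p * φ p := D_mul i hφ hφ
    simp only [sq]
    rw [D_mul i hv (hφ.fun_mul hφ), h3]
    ring
  rw [gradSq_eq, gradSq_eq, gradInner_eq_sum]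
  simp only [h1, h2, Fin.sum_univ_three]
  ring

/-- The commutator term in the energy identity of the horizontal gradient. -/
noncomputable def twist (u : ExtHeis → ℝ) (p : ExtHeis) : ℝ :=
  2 * (T (Y u) p * X u p - T (X u) p * Y u p)

lemma l2loc_T_D (hu2 : ContDiffOn ℝ 2 u halfSpace) (hT : Adm a (T u)) (i : Fin 3) :
    L2loc a (T (D i u)) :=
  (hT.grad i).congr fun _ hp => T_D_comm (hu2.contDiffAt (isOpen_halfSpace.mem_nhds hp)) i

/-- For each v in {Xu, Yu}, |∇(vφ)|² = ⟨∇v, ∇(vφ²)⟩ + v²|∇φ|², and the equation of v evaluates the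
first summand. The two commutator terms combine into `twist`. -/
lemma integral_horizontal_energy [IsLocallyFiniteMeasure (wMeas a)] (ha1 : -1 < a) (ha : a < 1)
    (hu2 : ContDiffOn ℝ 2 u halfSpace) (hu : Adm a u) (hM : ∀ p ∈ halfSpace, |u p| ≤ M)
    (hf : ContDiff ℝ 1 f) (hweak : IsWeakSolution a f u) (hT : Adm a (T u))
    (hZ : Adm a (Z (1, 0, 0) u)) (hZ' : Adm a (Z (0, 1, 0) u)) (hX : LocBdd (X u))
    (hY : LocBdd (Y u)) (hφ : ContDiff ℝ 1 φ) (hφc : HasCompactSupport φ) :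
    ∫ p, (gradSq (fun q => X u q * φ q) p + gradSq (fun q => Y u q * φ q) p
        - twist u p * φ p ^ 2) ∂wMeas a =
      (∫ x, deriv f (trace u x) *
        trace (pairNorm (fun q => X u q * φ q) (fun q => Y u q * φ q)) x ^ 2) +
      ∫ p, hGradNorm u p ^ 2 * gradSq φ p ∂wMeas a := by
  have hAX := adm_X hT hZ
  have hAY := adm_Y hT hZ'
  have hφ2 : ContDiff ℝ 1 fun p => φ p ^ 2 := hφ.pow 2
  have tX := hAX.c1Test hX hφ2 (compact_sq hφc)
  have tY := hAY.c1Test hY hφ2 (compact_sq hφc)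
  -- In X = Z₁ - x₂T the coefficient varies along Y with slope -1; in Y = Z₂ + x₁T it varies along X
  -- with slope 1. The opposite signs produce the antisymmetric combination.
  have cX : ContDiff ℝ 1 fun p : ExtHeis => -p.1.2.1 := by fun_prop
  have cY : ContDiff ℝ 1 fun p : ExtHeis => p.1.1 := by fun_prop
  have dX : ∀ i p, D i (fun p : ExtHeis => -p.1.2.1) p = if i = 1 then -1 else 0 := by
    intro i p
    have h : HasFDerivAt (fun p : ExtHeis => -p.1.2.1) (-coordB) p := coordB.hasFDerivAt.neg
    rw [D, h.fderiv]
    fin_cases i <;> simp [frame, coordB]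
  have dY : ∀ i p, D i (fun p : ExtHeis => p.1.1) p = if i = 0 then 1 else 0 := by
    intro i p
    have h : HasFDerivAt (fun p : ExtHeis => p.1.1) coordA p := coordA.hasFDerivAt
    rw [D, h.fderiv]
    fin_cases i <;> simp [frame, coordA]
  obtain ⟨iX, eX⟩ := horizontal_eq ha1 ha hu2 hu hM hf hweak hT hZ tX cX (j := 1) (by decide) dX
    (W := X u) fun p => by rw [X_eq]; ring
  obtain ⟨iY, eY⟩ := horizontal_eq ha1 ha hu2 hu hM hf hweak hT hZ' tY cY (j := 0) (by decide) dY
    (W := Y u) fun p => by rw [Y_eq]; ring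
  have jX := tX.integrable_gradInner hAX
  have jY := tY.integrable_gradInner hAY
  have kX := (tX.integrable_mul (l2loc_T_D hu2 hT 1)).const_mul 2
  have kY := (tY.integrable_mul (l2loc_T_D hu2 hT 0)).const_mul 2
  have lX := integrable_mul_cutoff hAX.l2.sq (continuous_gradSq hφ) (compact_gradSq hφc)
  have lY := integrable_mul_cutoff hAY.l2.sq (continuous_gradSq hφ) (compact_gradSq hφc)
  have h1 : ∀ᵐ p ∂wMeas a, gradSq (fun q => X u q * φ q) p + gradSq (fun q => Y u q * φ q) p
        - twist u p * φ p ^ 2 =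
      ((gradInner (X u) (fun q => X u q * φ q ^ 2) p
        - 2 * (T (D 1 u) p * (X u p * φ p ^ 2))) +
      (gradInner (Y u) (fun q => Y u q * φ q ^ 2) p
        + 2 * (T (D 0 u) p * (Y u p * φ p ^ 2)))) + hGradNorm u p ^ 2 * gradSq φ p := by
    filter_upwards [ae_mem_halfSpace a] with p hp
    have := hφ.differentiable one_ne_zero p
    rw [gradSq_mul (hAX.diff hp) this, gradSq_mul (hAY.diff hp) this, hGradNorm_sq, twist, D_zero,
      D_one]
    ring
  have m1 : Integrable (fun p => gradInner (X u) (fun q => X u q * φ q ^ 2) p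
        - 2 * (T (D 1 u) p * (X u p * φ p ^ 2))) (wMeas a) := jX.sub kX
  have m2 : Integrable (fun p => gradInner (Y u) (fun q => Y u q * φ q ^ 2) p
        + 2 * (T (D 0 u) p * (Y u p * φ p ^ 2))) (wMeas a) := jY.add kY
  have m3 : Integrable (fun p => hGradNorm u p ^ 2 * gradSq φ p) (wMeas a) :=
    (lX.add lY).congr (Eventually.of_forall fun p => by
      simp only [Pi.add_apply]; rw [hGradNorm_sq]; ring)
  have m12 : Integrable (fun p => (gradInner (X u) (fun q => X u q * φ q ^ 2) p
        - 2 * (T (D 1 u) p * (X u p * φ p ^ 2))) +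
      (gradInner (Y u) (fun q => Y u q * φ q ^ 2) p
        + 2 * (T (D 0 u) p * (Y u p * φ p ^ 2)))) (wMeas a) := m1.add m2
  have h2 : ∀ᵐ x : Heis, deriv f (trace u x) *
        trace (pairNorm (fun q => X u q * φ q) (fun q => Y u q * φ q)) x ^ 2 =
      deriv f (trace u x) * (trace (X u) x * trace (fun q => X u q * φ q ^ 2) x) +
      deriv f (trace u x) * (trace (Y u) x * trace (fun q => Y u q * φ q ^ 2) x) := by
    filter_upwards [trace_pairNorm (hAX.mul_contDiff hφ) (hAY.mul_contDiff hφ) ha,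
      hAX.trace_mul ha hφ.continuous, hAY.trace_mul ha hφ.continuous,
      hAX.trace_mul ha hφ2.continuous, hAY.trace_mul ha hφ2.continuous] with x e1 e2 e3 e4 e5
    rw [e1, e2, e3, e4, e5]; ring
  rw [integral_congr_ae h1, integral_add m12 m3, integral_add m1 m2, integral_sub jX kX,
    integral_add jY kY, integral_const_mul, integral_const_mul, eX, eY, integral_congr_ae h2,
    integral_add iX iY]
  ring

end

/-! ### The geometric inequality -/

section
variable {a M : ℝ} {f : ℝ → ℝ} {u φ : ExtHeis → ℝ} {p : ExtHeis}

/-- An expression for the analytic density that makes sense on the whole half-space. -/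
noncomputable def extendedDensity (u : ExtHeis → ℝ) (p : ExtHeis) : ℝ :=
  ((X u p * D 0 (Y u) p - Y u p * D 0 (X u) p) ^ 2
    + (X u p * D 1 (Y u) p - Y u p * D 1 (X u) p) ^ 2) / (X u p ^ 2 + Y u p ^ 2) - twist u p

/-- Lagrange's identity in each direction X, Y: |Hu|² - |(Hu)ᵀν|² is the sum of squared determinants
of ∇_ℍ u and its derivative, divided by |∇_ℍ u|². -/
lemma analyticDensity_eq (hp : p ∈ regularSet u) :
    analyticDensity u p = extendedDensity u p := by
  have hsq := hGradNorm_sq u p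
  have h0 := hGrad_ne_zero.1 hp.2
  rw [analyticDensity, extendedDensity, hessSq_normal hp.2, hessNorm_sq, hsq, twist]
  simp only [D_zero, D_one]
  field_simp
  ring

/-- Off the regular set the quotient is 0/0, which is 0 by convention, so the density may be
integrated over the whole half-space. -/
lemma extendedDensity_eq_zero (hp : p ∈ halfSpace) (hp' : p ∉ regularSet u) :
    X u p = 0 ∧ Y u p = 0 ∧ twist u p = 0 ∧ extendedDensity u p = 0 := by
  have h0 : X u p ^ 2 + Y u p ^ 2 = 0 := by
    by_contra h; exact hp' ⟨hp, hGrad_ne_zero.2 h⟩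
  have hX : X u p = 0 := by nlinarith [sq_nonneg (X u p), sq_nonneg (Y u p)]
  have hY : Y u p = 0 := by nlinarith [sq_nonneg (X u p), sq_nonneg (Y u p)]
  simp [extendedDensity, twist, hX, hY]

lemma measurableSet_regularSet (u : ExtHeis → ℝ) : MeasurableSet (regularSet u) := by
  have : regularSet u = halfSpace ∩ {p | X u p ^ 2 + Y u p ^ 2 ≠ 0} := by
    ext p; exact and_congr_right fun _ => hGrad_ne_zero
  rw [this]
  exact measurableSet_halfSpace.inter ((((measurable_D u 0).pow_const 2).add
    ((measurable_D u 1).pow_const 2)) (measurableSet_singleton 0).compl)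

lemma measurable_extendedDensity (u : ExtHeis → ℝ) : Measurable (extendedDensity u) := by
  have mX : Measurable (X u) := measurable_D u 0
  have mY : Measurable (Y u) := measurable_D u 1
  have mT : ∀ v : ExtHeis → ℝ, Measurable (T v) := fun v => T_eq_Z v ▸ measurable_Z v _
  have h1 := fun i =>
    ((mX.mul (measurable_D (Y u) i)).sub (mY.mul (measurable_D (X u) i))).pow_const 2
  exact (((h1 0).add (h1 1)).div ((mX.pow_const 2).add (mY.pow_const 2))).sub
    ((((mT (Y u)).mul mX).sub ((mT (X u)).mul mY)).const_mul 2)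

/-- Cauchy–Schwarz cancels the singular denominator; the bound left over is locally integrable by
the regularity part. -/
lemma abs_extendedDensity_le (u : ExtHeis → ℝ) (p : ExtHeis) :
    |extendedDensity u p| ≤ gradSq (X u) p + gradSq (Y u) p +
      (T (Y u) p ^ 2 + X u p ^ 2 + T (X u) p ^ 2 + Y u p ^ 2) := by
  have hlag : ∀ i, (X u p * D i (Y u) p - Y u p * D i (X u) p) ^ 2 ≤
      (D i (X u) p ^ 2 + D i (Y u) p ^ 2) * (X u p ^ 2 + Y u p ^ 2) := fun i => by
    nlinarith [sq_nonneg (X u p * D i (X u) p + Y u p * D i (Y u) p)]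
  set q := ((X u p * D 0 (Y u) p - Y u p * D 0 (X u) p) ^ 2
    + (X u p * D 1 (Y u) p - Y u p * D 1 (X u) p) ^ 2) / (X u p ^ 2 + Y u p ^ 2) with hq
  have hq0 : 0 ≤ q := by positivity
  have hq1 : q ≤ gradSq (X u) p + gradSq (Y u) p := by
    refine div_le_of_le_mul₀ (by positivity)
      (add_nonneg (gradSq_nonneg _ _) (gradSq_nonneg _ _)) ?_
    rw [gradSq_eq, gradSq_eq, Fin.sum_univ_three, Fin.sum_univ_three]
    nlinarith [hlag 0, hlag 1, mul_nonneg (add_nonneg (sq_nonneg (D 2 (X u) p))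
      (sq_nonneg (D 2 (Y u) p))) (add_nonneg (sq_nonneg (X u p)) (sq_nonneg (Y u p)))]
  rw [extendedDensity, ← hq, twist, abs_le]
  constructor <;> nlinarith [sq_nonneg (T (Y u) p - X u p), sq_nonneg (T (Y u) p + X u p),
    sq_nonneg (T (X u) p - Y u p), sq_nonneg (T (X u) p + Y u p)]

lemma integrable_extendedDensity_mul (hu2 : ContDiffOn ℝ 2 u halfSpace) (hT : Adm a (T u))
    (hX : Adm a (X u)) (hY : Adm a (Y u)) (hφ : Continuous φ) (hφc : HasCompactSupport φ) :
    Integrable (fun p => extendedDensity u p * φ p ^ 2) (wMeas a) := by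
  have h1 := (hX.locallyIntegrable_gradSq.add hY.locallyIntegrable_gradSq).add
    ((((l2loc_T_D hu2 hT 1).sq.add hX.l2.sq).add (l2loc_T_D hu2 hT 0).sq).add hY.l2.sq)
  refine (integrable_mul_cutoff h1 (hφ.pow 2) (compact_sq hφc)).mono'
    ((measurable_extendedDensity u).mul (hφ.measurable.pow_const 2)).aestronglyMeasurable
    (Eventually.of_forall fun p => ?_)
  rw [Real.norm_eq_abs, abs_mul, abs_of_nonneg (sq_nonneg (φ p))]
  exact mul_le_mul_of_nonneg_right (abs_extendedDensity_le u p) (sq_nonneg _)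

lemma integrable_twist_mul (hu2 : ContDiffOn ℝ 2 u halfSpace) (hT : Adm a (T u))
    (hX : Adm a (X u)) (hY : Adm a (Y u)) (hφ : Continuous φ) (hφc : HasCompactSupport φ) :
    Integrable (fun p => twist u p * φ p ^ 2) (wMeas a) := by
  have h1 := ((l2loc_T_D hu2 hT 1).mul_locallyIntegrable hX.l2).sub
    ((l2loc_T_D hu2 hT 0).mul_locallyIntegrable hY.l2)
  have h2 := (integrable_mul_cutoff h1 (hφ.pow 2) (compact_sq hφc)).const_mul 2
  refine h2.congr (Eventually.of_forall fun p => ?_)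
  simp [twist, D_zero, D_one]
  ring

lemma integrable_hGradNorm_sq_mul (hX : Adm a (X u)) (hY : Adm a (Y u)) (hφ : ContDiff ℝ 1 φ)
    (hφc : HasCompactSupport φ) :
    Integrable (fun p => hGradNorm u p ^ 2 * gradSq φ p) (wMeas a) := by
  refine (integrable_mul_cutoff (hX.l2.sq.add hY.l2.sq) (continuous_gradSq hφ)
    (compact_gradSq hφc)).congr (Eventually.of_forall fun p => ?_)
  simp [hGradNorm_sq]

/-- The pointwise inequality behind the geometric inequality. -/
lemma extendedDensity_mul_le (hX : DifferentiableAt ℝ (X u) p) (hY : DifferentiableAt ℝ (Y u) p)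
    (hφ : DifferentiableAt ℝ φ p) (hp : p ∈ halfSpace) :
    extendedDensity u p * φ p ^ 2 ≤ gradSq (fun q => X u q * φ q) p
      + gradSq (fun q => Y u q * φ q) p - twist u p * φ p ^ 2
      - gradSq (pairNorm (fun q => X u q * φ q) (fun q => Y u q * φ q)) p := by
  have hle := gradSq_pairNorm_le (hX.fun_mul hφ) (hY.fun_mul hφ)
  by_cases hreg : p ∈ regularSet u
  -- Where φ vanishes so does the length, and Lagrange's identity is unavailable; the inequality
  -- between the gradients suffices.
  · by_cases h0 : φ p = 0
    · rw [h0]; linarith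
    · have hN := hGrad_ne_zero.1 hreg.2
      have hAB : pairNorm (fun q => X u q * φ q) (fun q => Y u q * φ q) p ≠ 0 := by
        refine (Real.sqrt_pos.2 ?_).ne'
        have : 0 < φ p ^ 2 * (X u p ^ 2 + Y u p ^ 2) := by positivity
        nlinarith
      rw [← gradSq_pairNorm_add (hX.fun_mul hφ) (hY.fun_mul hφ) hAB]
      have h1 : ∀ i, X u p * φ p * D i (fun q => Y u q * φ q) p
          - Y u p * φ p * D i (fun q => X u q * φ q) p =
          φ p ^ 2 * (X u p * D i (Y u) p - Y u p * D i (X u) p) := fun i => by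
        rw [D_mul i hX hφ, D_mul i hY hφ]; ring
      simp only [h1, Fin.sum_univ_three, extendedDensity]
      have h2 : (X u p * φ p) ^ 2 + (Y u p * φ p) ^ 2 = φ p ^ 2 * (X u p ^ 2 + Y u p ^ 2) := by
        ring
      rw [h2]
      have h3 : ((φ p ^ 2 * (X u p * D 0 (Y u) p - Y u p * D 0 (X u) p)) ^ 2 +
          (φ p ^ 2 * (X u p * D 1 (Y u) p - Y u p * D 1 (X u) p)) ^ 2 +
          (φ p ^ 2 * (X u p * D 2 (Y u) p - Y u p * D 2 (X u) p)) ^ 2) /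
          (φ p ^ 2 * (X u p ^ 2 + Y u p ^ 2)) =
          ((X u p * D 0 (Y u) p - Y u p * D 0 (X u) p) ^ 2 +
          (X u p * D 1 (Y u) p - Y u p * D 1 (X u) p) ^ 2) / (X u p ^ 2 + Y u p ^ 2) * φ p ^ 2 +
          (X u p * D 2 (Y u) p - Y u p * D 2 (X u) p) ^ 2 / (X u p ^ 2 + Y u p ^ 2) * φ p ^ 2 := by
        field_simp
      rw [h3]
      -- This ∂_y summand does not occur in the density; discarding it is one source of the
      -- inequality.
      have : 0 ≤ (X u p * D 2 (Y u) p - Y u p * D 2 (X u) p) ^ 2 / (X u p ^ 2 + Y u p ^ 2) *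
        φ p ^ 2 := by positivity
      linarith
  · obtain ⟨-, -, h3, h4⟩ := extendedDensity_eq_zero hp hreg
    rw [h3, h4]
    linarith

/-- Integrate the pointwise inequality, insert the energy identity, and use stability for |∇_ℍ u|φ;
the integrals of f'(u)|∇_ℍ u|²φ² cancel. -/
lemma integral_extendedDensity_le [IsLocallyFiniteMeasure (wMeas a)] (ha1 : -1 < a) (ha : a < 1)
    (hu2 : ContDiffOn ℝ 2 u halfSpace) (hu : Adm a u) (hM : ∀ p ∈ halfSpace, |u p| ≤ M)
    (hf : ContDiff ℝ 1 f) (hweak : IsWeakSolution a f u) (hstable : IsStable a f u)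
    (hT : Adm a (T u)) (hZ : Adm a (Z (1, 0, 0) u)) (hZ' : Adm a (Z (0, 1, 0) u))
    (hX : LocBdd (X u)) (hY : LocBdd (Y u)) (hφ : ContDiff ℝ 1 φ) (hφc : HasCompactSupport φ) :
    ∫ p, extendedDensity u p * φ p ^ 2 ∂wMeas a ≤
      ∫ p, hGradNorm u p ^ 2 * gradSq φ p ∂wMeas a := by
  have hAX := adm_X hT hZ
  have hAY := adm_Y hT hZ'
  have tX := hAX.c1Test hX hφ hφc
  have tY := hAY.c1Test hY hφ hφc
  have iξ := tX.integrable_gradSq_pairNorm tY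
  have iG : Integrable (fun p => gradSq (fun q => X u q * φ q) p
      + gradSq (fun q => Y u q * φ q) p - twist u p * φ p ^ 2) (wMeas a) :=
    ((tX.integrable_gradInner tX.adm).add (tY.integrable_gradInner tY.adm)).sub
      (integrable_twist_mul hu2 hT hAX hAY hφ.continuous hφc)
  have h1 := integral_horizontal_energy ha1 ha hu2 hu hM hf hweak hT hZ hZ' hX hY hφ hφc
  have h2 := hstable _ (tX.isTestFunction_pairNorm tY)
  rw [← integral_wMeas] at h2
  have h3 : ∫ p, extendedDensity u p * φ p ^ 2 ∂wMeas a ≤ ∫ p, (gradSq (fun q => X u q * φ q) p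
      + gradSq (fun q => Y u q * φ q) p - twist u p * φ p ^ 2
      - gradSq (pairNorm (fun q => X u q * φ q) (fun q => Y u q * φ q)) p) ∂wMeas a := by
    refine integral_mono_ae (integrable_extendedDensity_mul hu2 hT hAX hAY hφ.continuous hφc)
      (iG.sub iξ) ?_
    filter_upwards [ae_mem_halfSpace a] with p hp
    exact extendedDensity_mul_le (hAX.diff hp) (hAY.diff hp) (hφ.differentiable one_ne_zero p) hp
  rw [integral_sub iG iξ, h1] at h3
  linarith

lemma exists_lipschitz_bound (hf : ContDiff ℝ 1 f) (M : ℝ) : ∃ K, 0 ≤ K ∧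
    ∀ s ∈ Icc (-M) M, ∀ t ∈ Icc (-M) M, |f s - f t| ≤ K * |s - t| := by
  obtain ⟨L, hL⟩ := (isCompact_Icc (a := -M) (b := M)).exists_bound_of_continuousOn
    (hf.continuous_deriv le_rfl).continuousOn
  refine ⟨|L|, abs_nonneg L, fun s hs t ht => ?_⟩
  exact (convex_Icc (-M) M).norm_image_sub_le_of_norm_deriv_le
    (fun x _ => hf.differentiable one_ne_zero x) (fun x hx => (hL x hx).trans (le_abs_self L)) ht hs

end

end HeisenbergExtension

/-! ### Assembly of the theorem -/

theorem theorem1 (a γ : ℝ) (ha : -1 < a) (ha' : a < 1) (hγ : max 0 a < γ)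
    (f : ℝ → ℝ) (hf : IsC1Holder γ f)
    (u : ExtHeis → ℝ) (hu : ContDiffOn ℝ 2 u halfSpace)
    (hbdd : ∃ M, ∀ p ∈ halfSpace, |u p| ≤ M)
    (hweak : IsWeakSolution a f u) (hstable : IsStable a f u)
    (hgrad : ∀ R > 0, ∃ C, ∀ p ∈ halfBall R, hGradNorm u p ≤ C)
    (φ : ExtHeis → ℝ) (hφ : ContDiff ℝ ∞ φ) (hφc : HasCompactSupport φ) :
    IntegrableOn (fun p => p.2 ^ a * hGradNorm u p ^ 2 * gradSq φ p) halfSpace ∧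
    IntegrableOn (fun p => p.2 ^ a * analyticDensity u p * φ p ^ 2) (regularSet u) ∧
    ∫ p in regularSet u, p.2 ^ a * analyticDensity u p * φ p ^ 2
      ≤ ∫ p in halfSpace, p.2 ^ a * hGradNorm u p ^ 2 * gradSq φ p ∧
    ∫ p in regularSet u, p.2 ^ a * analyticDensity u p * φ p ^ 2
      = ∫ p in regularSet u, p.2 ^ a * hGradNorm u p ^ 2 * curvatureDensity u p * φ p ^ 2 ∧
    ∀ p ∈ regularSet u,
      analyticDensity u p = hGradNorm u p ^ 2 * curvatureDensity u p := by
  obtain ⟨M, hM⟩ := hbdd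
  have := isLocallyFinite_wMeas ha
  have hAu := weak_adm hu hM hweak
  obtain ⟨hX, hY⟩ := locBdd_of_hGradNorm hgrad
  obtain ⟨K, hK0, hK⟩ := exists_lipschitz_bound hf.1 M
  obtain ⟨hT, hZ, hZ'⟩ := adm_derivatives ha ha' hu hAu hM hX hY hK0 fun e h hh =>
    dq_subLinear ha' hAu hM hf.1.continuous hK hweak e hh
  have hAX := adm_X hT hZ
  have hAY := adm_Y hT hZ'
  have hφ1 : ContDiff ℝ 1 φ := hφ.of_le (by exact_mod_cast le_top)
  have hR := measurableSet_regularSet u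
  have hRsub : regularSet u ⊆ halfSpace := fun p hp => hp.1
  have hid : ∀ p ∈ regularSet u, analyticDensity u p = hGradNorm u p ^ 2 * curvatureDensity u p :=
    fun p hp => density_identity hu hp
  have iQ := integrable_extendedDensity_mul hu hT hAX hAY hφ.continuous hφc
  have hext : EqOn (fun p => p.2 ^ a * (extendedDensity u p * φ p ^ 2))
      (fun p => p.2 ^ a * analyticDensity u p * φ p ^ 2) (regularSet u) := fun p hp => by
    simp only; rw [analyticDensity_eq hp, mul_assoc]
  refine ⟨?_, ?_, ?_, ?_, hid⟩
  · simpa only [mul_assoc] using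
      (integrable_wMeas a).1 (integrable_hGradNorm_sq_mul hAX hAY hφ1 hφc)
  · exact ((integrableOn_wMeas a hR hRsub).1 iQ.integrableOn).congr_fun hext hR
  · have h1 := integral_extendedDensity_le ha ha' hu hAu hM hf.1 hweak hstable hT hZ hZ' hX hY
      hφ1 hφc
    rw [integral_wMeas a fun p => hGradNorm u p ^ 2 * gradSq φ p] at h1
    simp only [mul_assoc] at h1 ⊢
    refine le_trans (le_of_eq ?_) h1
    -- The extended density vanishes off the regular set, so both domains give the same integral.
    have h2 : ∫ p in regularSet u, extendedDensity u p * φ p ^ 2 ∂wMeas a =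
        ∫ p, extendedDensity u p * φ p ^ 2 ∂wMeas a := by
      refine setIntegral_eq_integral_of_ae_compl_eq_zero ?_
      filter_upwards [ae_mem_halfSpace a] with p hp hp'
      rw [(extendedDensity_eq_zero hp hp').2.2.2, zero_mul]
    rw [← h2, setIntegral_wMeas a hR hRsub]
    refine (setIntegral_congr_fun hR fun p hp => ?_).symm
    simpa only [mul_assoc] using hext hp
  · refine setIntegral_congr_fun hR fun p hp => ?_
    rw [hid p hp]
    ring
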